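/- Let $n\in\mathbb N$, let $B=\operatorname{diag}(b_1,\dots,b_n)$ with $b_j\in\mathbb C\setminus\{0\}$, let $Q\in L^1([0,1];\mathbb C^{n\times n})$, and let $C,D\in\mathbb C^{n\times n}$ satisfy $\operatorname{rank}\begin{pmatrix} C & D\end{pmatrix}=n$. Let $L_{C,D}(Q)$ be the operator in $L^2([0,1];\mathbb C^n)$ given by $y\mapsto -iB^{-1}y'+Q(x)y$ on the domain of all absolutely continuous $y:[0,1]\to\mathbb C^n$ with $-iB^{-1}y'+Qy\in L^2([0,1];\mathbb C^n)$ and $Cy(0)+Dy(1)=0$. For $\lambda\in\mathbb C$ let $\Phi(\cdot,\lambda)$ be the matrix solution of $-iB^{-1}\Phi'+Q(x)\Phi=\lambda\Phi$ on $[0,1]$ with $\Phi(0,\lambda)=I_n$, and let $\Delta(\lambda):=\det(C+D\,\Phi(1,\lambda))$ be the characteristic determinant. Call $z\in\mathbb C$ feasible if $\operatorname{Re}(ib_jz)\neq 0$ for all $j$ and $\operatorname{Re}(ib_jz)\ne\operatorname{Re}(ib_kz)$ whenever $b_j\ne b_k$. Assume that there exist real numbers $c,R>0$, an integer $s\ge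 0$ and three feasible numbers $z_1,z_2,z_3$ such that (i) the origin is an interior point of the triangle with vertices $z_1,z_2,z_3$; (ii) for $k\in\{1,2,3\}$, with $\tau_k:=\sum_{j:\ \operatorname{Re}(ib_jz_k)>0} b_j$, $$|\Delta(\lambda)|\ \ge\ \frac{c\,e^{\operatorname{Re}(i\tau_k\lambda)}}{|\lambda|^s}\qquad\text{for all }\lambda\in\mathbb C\text{ with }|\lambda|>R,\ \arg\lambda=\arg z_k .$$ Then the system of root functions (eigenfunctions and associated functions) of $L_{C,D}(Q)$ is complete and minimal in $L^2([0,1];\mathbb C^n)$. That is, if a basis is chosen in each root subspace $\bigcup_{m\ge 1}\ker(L_{C,D}(Q)-\lambda)^m$, $\lambda\in\mathbb C$, then the family formed by all these basis functions has dense linear span in $L^2([0,1];\mathbb C^n)$, and no member of it lies in the closed linear span of the other members. -/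

import Mathlib

open MeasureTheory Set Complex
open scoped Matrix

namespace FirstOrderBVP

/-- Lebesgue measure on `[0,1]`. -/
noncomputable abbrev unitVol : Measure ℝ := volume.restrict (Icc (0 : ℝ) 1)

/-- The Hilbert space `L²([0,1]; ℂⁿ)`. -/
abbrev L2 (n : ℕ) : Type := Lp (EuclideanSpace ℂ (Fin n)) 2 unitVol

/-- The differential expression `-i B⁻¹ y' + Q(x) y` with `B = diag(b₁, …, bₙ)`. -/
noncomputable def diffExpr {n : ℕ} (b : Fin n → ℂ) (Q : ℝ → Matrix (Fin n) (Fin n) ℂ)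
    (y : ℝ → Fin n → ℂ) (x : ℝ) : Fin n → ℂ :=
  (-I) • ((Matrix.diagonal b)⁻¹ *ᵥ deriv y x) + Q x *ᵥ y x

/-- An absolutely continuous function on `[0,1]` is differentiable almost everywhere. -/
theorem ae_differentiableAt_of_ac {n : ℕ} {y : ℝ → Fin n → ℂ}
    (hy : AbsolutelyContinuousOnInterval y 0 1) :
    ∀ᵐ x ∂unitVol, DifferentiableAt ℝ y x := by
  have h := hy.boundedVariationOn.locallyBoundedVariationOn.ae_differentiableWithinAt_of_mem
  rw [uIcc_of_le zero_le_one] at h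
  rw [unitVol, ← Measure.restrict_congr_set Ioo_ae_eq_Icc, ae_restrict_iff' measurableSet_Ioo]
  filter_upwards [h] with x hx hxI
  exact (hx (Ioo_subset_Icc_self hxI)).differentiableAt (Icc_mem_nhds hxI.1 hxI.2)

theorem ac_const_smul {n : ℕ} {y : ℝ → Fin n → ℂ} (c : ℂ)
    (hy : AbsolutelyContinuousOnInterval y 0 1) :
    AbsolutelyContinuousOnInterval (fun x => c • y x) 0 1 := by
  unfold AbsolutelyContinuousOnInterval at *
  refine squeeze_zero (fun t => Finset.sum_nonneg fun i _ => dist_nonneg) (fun t => ?_)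
    (by simpa using hy.const_mul ‖c‖)
  rw [Finset.mul_sum]
  exact Finset.sum_le_sum fun i _ => by rw [dist_smul₀]

/-- The graph of `L_{C,D}(Q)`: the pairs `(f, g)` in `L²` such that `f` is (the class of) an
absolutely continuous `y` on `[0,1]` with `C y(0) + D y(1) = 0` and `g = -i B⁻¹ y' + Q y`. -/
noncomputable def bvpGraph {n : ℕ} (b : Fin n → ℂ) (Q : ℝ → Matrix (Fin n) (Fin n) ℂ)
    (C D : Matrix (Fin n) (Fin n) ℂ) : Submodule ℂ (L2 n × L2 n) where
  carrier := {p | ∃ y : ℝ → Fin n → ℂ, AbsolutelyContinuousOnInterval y 0 1 ∧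
    (∀ᵐ x ∂unitVol, p.1 x = WithLp.toLp 2 (y x)) ∧
    (∀ᵐ x ∂unitVol, p.2 x = WithLp.toLp 2 (diffExpr b Q y x)) ∧
    C *ᵥ y 0 + D *ᵥ y 1 = 0}
  add_mem' := by
    rintro ⟨f, g⟩ ⟨f', g'⟩ ⟨y, hy, hf, hg, hb⟩ ⟨y', hy', hf', hg', hb'⟩
    refine ⟨y + y', hy.add hy', ?_, ?_, ?_⟩
    · filter_upwards [hf, hf', Lp.coeFn_add f f'] with x h1 h2 h3
      simp only [Prod.fst_add, Pi.add_apply] at *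
      rw [h3, h1, h2, WithLp.toLp_add]
    · filter_upwards [hg, hg', Lp.coeFn_add g g', ae_differentiableAt_of_ac hy,
        ae_differentiableAt_of_ac hy'] with x h1 h2 h3 h4 h5
      simp only [Prod.snd_add, Pi.add_apply] at *
      rw [h3, h1, h2, ← WithLp.toLp_add]
      congr 1
      simp only [diffExpr, deriv_add h4 h5, Pi.add_apply, Matrix.mulVec_add, smul_add]
      abel
    · simp only [Pi.add_apply, Matrix.mulVec_add]
      rw [add_add_add_comm, hb, hb', add_zero]
  zero_mem' := by
    refine ⟨fun _ => 0, ?_, ?_, ?_, by simp⟩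
    · simpa [AbsolutelyContinuousOnInterval] using tendsto_const_nhds
    · filter_upwards [Lp.coeFn_zero (EuclideanSpace ℂ (Fin n)) 2 unitVol] with x h
      simpa using h
    · filter_upwards [Lp.coeFn_zero (EuclideanSpace ℂ (Fin n)) 2 unitVol] with x h
      simpa [diffExpr] using h
  smul_mem' := by
    rintro c ⟨f, g⟩ ⟨y, hy, hf, hg, hb⟩
    refine ⟨fun x => c • y x, ac_const_smul c hy, ?_, ?_, ?_⟩
    · filter_upwards [hf, Lp.coeFn_smul c f] with x h1 h2
      simp only [Prod.smul_fst, Pi.smul_apply] at *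
      rw [h2, h1, WithLp.toLp_smul]
    · filter_upwards [hg, Lp.coeFn_smul c g, ae_differentiableAt_of_ac hy] with x h1 h2 h3
      simp only [Prod.smul_snd, Pi.smul_apply] at *
      rw [h2, h1, ← WithLp.toLp_smul]
      congr 1
      simp only [diffExpr, deriv_fun_const_smul c h3, Matrix.mulVec_smul, smul_add]
      rw [smul_comm]
    · simp only [Matrix.mulVec_smul]
      rw [← smul_add, hb, smul_zero]

theorem bvpGraph_single_valued {n : ℕ} (b : Fin n → ℂ) (Q : ℝ → Matrix (Fin n) (Fin n) ℂ)
    (C D : Matrix (Fin n) (Fin n) ℂ) :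
    ∀ p ∈ bvpGraph b Q C D, p.1 = 0 → p.2 = 0 := by
  rintro ⟨f, g⟩ ⟨y, hy, hf, hg, -⟩ (rfl : f = 0)
  have hcont : ContinuousOn y (Icc 0 1) := by
    simpa [uIcc_of_le zero_le_one] using hy.continuousOn
  have h0 : y =ᵐ[unitVol] fun _ => 0 := by
    filter_upwards [hf, Lp.coeFn_zero (EuclideanSpace ℂ (Fin n)) 2 unitVol] with x h1 h2
    have h3 : WithLp.toLp 2 (y x) = (0 : EuclideanSpace ℂ (Fin n)) := by
      rw [← h1]; simpa using h2
    simpa using congrArg WithLp.ofLp h3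
  have h1 : EqOn y (fun _ => 0) (Icc 0 1) :=
    Measure.eqOn_Icc_of_ae_eq volume zero_ne_one h0 hcont continuousOn_const
  refine Lp.ext ?_
  have hI : ∀ᵐ x ∂unitVol, x ∈ Ioo (0 : ℝ) 1 := by
    rw [unitVol, ← Measure.restrict_congr_set Ioo_ae_eq_Icc]
    exact ae_restrict_mem measurableSet_Ioo
  filter_upwards [hg, hI, Lp.coeFn_zero (EuclideanSpace ℂ (Fin n)) 2 unitVol] with x h2 h3 h4
  have h5 : y =ᶠ[nhds x] fun _ => 0 := by
    filter_upwards [Icc_mem_nhds h3.1 h3.2] with t ht using h1 ht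
  rw [h4]
  rw [h2]
  simp [diffExpr, h5.deriv_eq, h5.eq_of_nhds]

/-- The operator `L_{C,D}(Q)` in `L²([0,1]; ℂⁿ)`. -/
noncomputable def bvpOperator {n : ℕ} (b : Fin n → ℂ) (Q : ℝ → Matrix (Fin n) (Fin n) ℂ)
    (C D : Matrix (Fin n) (Fin n) ℂ) : L2 n →ₗ.[ℂ] L2 n :=
  (bvpGraph b Q C D).toLinearPMap

theorem bvpOperator_graph {n : ℕ} (b : Fin n → ℂ) (Q : ℝ → Matrix (Fin n) (Fin n) ℂ)
    (C D : Matrix (Fin n) (Fin n) ℂ) :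
    (bvpOperator b Q C D).graph = bvpGraph b Q C D :=
  Submodule.toLinearPMap_graph_eq _ (bvpGraph_single_valued b Q C D)

section Abstract

variable {E : Type*} [AddCommGroup E] [Module ℂ E]

/-- `ker (T - μ)ᵏ` for an unbounded operator `T`, with its natural domain: `x` lies in
`ker (T - μ)ᵏ⁺¹` iff `x ∈ dom T` and `T x - μ x ∈ ker (T - μ)ᵏ`. -/
def kerPow (T : E →ₗ.[ℂ] E) (μ : ℂ) : ℕ → Submodule ℂ E
  | 0 => ⊥
  | k + 1 => ((kerPow T μ k).comap (T.toFun - μ • T.domain.subtype)).map T.domain.subtype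

/-- The root subspace of `T` at `μ`: the eigenvectors and associated vectors at `μ`, and `0`.
It is `{0}` if `μ` is not an eigenvalue. -/
def rootSubspace (T : E →ₗ.[ℂ] E) (μ : ℂ) : Submodule ℂ E :=
  ⨆ k, kerPow T μ k

/-- The linear span of the family is dense. -/
def IsCompleteFamily [TopologicalSpace E] {ι : Type*} (e : ι → E) : Prop :=
  Dense (Submodule.span ℂ (range e) : Set E)

/-- No member of the family lies in the closed linear span of the other members. -/
def IsMinimalFamily [TopologicalSpace E] {ι : Type*} (e : ι → E) : Prop :=
  ∀ i, e i ∉ closure (Submodule.span ℂ (e '' {j | j ≠ i}) : Set E)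

end Abstract

/-- `Φ` is the fundamental matrix at `μ`: its columns are absolutely continuous solutions of
`-i B⁻¹ y' + Q y = μ y` on `[0,1]`, and `Φ(0) = I`. -/
def IsFundamentalMatrix {n : ℕ} (b : Fin n → ℂ) (Q : ℝ → Matrix (Fin n) (Fin n) ℂ) (μ : ℂ)
    (Φ : ℝ → Matrix (Fin n) (Fin n) ℂ) : Prop :=
  Φ 0 = 1 ∧ ∀ k, AbsolutelyContinuousOnInterval (fun x j => Φ x j k) 0 1 ∧
    ∀ᵐ x ∂unitVol, diffExpr b Q (fun t j => Φ t j k) x = μ • (fun j => Φ x j k)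

/-- The fundamental matrix `Φ(·, μ)`; for nonsingular `B` and integrable `Q` it exists and is
unique on `[0,1]`. -/
noncomputable def fundamentalMatrix {n : ℕ} (b : Fin n → ℂ) (Q : ℝ → Matrix (Fin n) (Fin n) ℂ)
    (μ : ℂ) : ℝ → Matrix (Fin n) (Fin n) ℂ :=
  Classical.epsilon (IsFundamentalMatrix b Q μ)

/-- The characteristic determinant `Δ(μ) = det (C + D Φ(1, μ))`. -/
noncomputable def charDet {n : ℕ} (b : Fin n → ℂ) (Q : ℝ → Matrix (Fin n) (Fin n) ℂ)
    (C D : Matrix (Fin n) (Fin n) ℂ) (μ : ℂ) : ℂ :=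
  (C + D * fundamentalMatrix b Q μ 1).det

/-- `z` lies on none of the lines `Re (i b_j z) = 0` and, for `b_j ≠ b_k`,
`Re (i b_j z) = Re (i b_k z)`. -/
def Feasible {n : ℕ} (b : Fin n → ℂ) (z : ℂ) : Prop :=
  (∀ j, (I * b j * z).re ≠ 0) ∧ ∀ j k, b j ≠ b k → (I * b j * z).re ≠ (I * b k * z).re

/-- The sum of those `b_j` with `Re (i b_j z) > 0`. -/
noncomputable def tau {n : ℕ} (b : Fin n → ℂ) (z : ℂ) : ℂ :=
  ∑ j with 0 < (I * b j * z).re, b j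

end FirstOrderBVP

/-! Solving `y' = (iμB - iBQ) y + iBg` under the boundary condition writes the resolvent of
`L_{C,D}(Q)` as `N(μ) / Δ(μ)`, with `N` entire and operator valued, since the boundary matrix
`C + D Φ(1, μ)` enters only through its adjugate and its determinant `Δ(μ)`.

Minors of `Φ` solve linear systems themselves, so every minor, and hence `Δ(μ)`, is
`O(exp ω(μ))`, where `ω(μ)` is the sum of the positive ones among the numbers `Re (i b_j μ)`. By
Cramer's rule the values of `N(μ) g` are determinants of the same kind for the system bordered by
the source term `iBg`, so `N` obeys the same bound. On the ray through `z_k` the lower bound for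
`Δ` has this same exponent, hence `N = O(|μ|^s |Δ|)` there.

Let `φ` annihilate all root vectors. Then `F g = φ (N(·) g) / Δ` is entire, of exponential type,
and polynomially bounded on the three rays. Since `F g - φ (ρ g)` is `(μ - ν) F (ρ g)` for the
resolvent `ρ` at a regular point `ν`, replacing `g` by `ρ^s g` makes `F` bounded on the rays,
hence constant by Phragmén–Lindelöf and Liouville, and then `φ (ρ^(s+2) g) = 0` for all `g`. The
domain is dense, so `ρ` has dense range and `φ = 0`.

Minimality needs no estimate: the vectors at which the resolvent is regular at `μ` form a closed
subspace that contains the root vectors of all the other eigenvalues and meets the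
finite-dimensional root subspace at `μ` only in `0`. -/

namespace FirstOrderBVP

section AbsoluteContinuity

open Filter Topology AbsolutelyContinuousOnInterval

variable {X Y : Type*} [PseudoMetricSpace X] [PseudoMetricSpace Y] {a b : ℝ}

theorem ac_of_dist_le {f : ℝ → X} {g : ℝ → Y} {L : ℝ}
    (hg : AbsolutelyContinuousOnInterval g a b)
    (h : ∀ x ∈ uIcc a b, ∀ y ∈ uIcc a b, dist (f x) (f y) ≤ L * dist (g x) (g y)) :
    AbsolutelyContinuousOnInterval f a b := by
  unfold AbsolutelyContinuousOnInterval at *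
  refine squeeze_zero' (Eventually.of_forall fun t => Finset.sum_nonneg fun i _ => dist_nonneg)
    ?_ (by simpa using hg.const_mul L)
  filter_upwards [mem_inf_of_right (mem_principal_self _)] with E hE
  rw [Finset.mul_sum]
  exact Finset.sum_le_sum fun i hi => h _ (hE.1 i hi).1 _ (hE.1 i hi).2

theorem ac_const (c : X) (a b : ℝ) : AbsolutelyContinuousOnInterval (fun _ => c) a b := by
  simpa [AbsolutelyContinuousOnInterval] using tendsto_const_nhds

theorem ac_congr {f g : ℝ → X} (hf : AbsolutelyContinuousOnInterval f a b)
    (hfg : EqOn f g (uIcc a b)) : AbsolutelyContinuousOnInterval g a b :=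
  ac_of_dist_le (L := 1) hf fun x hx y hy => by rw [hfg hx, hfg hy, one_mul]

theorem ac_comp_lipschitz {f : ℝ → X} {φ : X → Y} {K : NNReal}
    (hf : AbsolutelyContinuousOnInterval f a b) (hφ : LipschitzOnWith K φ (f '' uIcc a b)) :
    AbsolutelyContinuousOnInterval (fun x => φ (f x)) a b :=
  ac_of_dist_le hf fun _ hx _ hy => hφ.dist_le_mul _ (mem_image_of_mem f hx) _
    (mem_image_of_mem f hy)

theorem ac_comp_contDiff {f φ : ℝ → ℝ} (hf : AbsolutelyContinuousOnInterval f a b)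
    (hφ : ContDiff ℝ 1 φ) : AbsolutelyContinuousOnInterval (fun x => φ (f x)) a b := by
  obtain ⟨C, hC⟩ := hf.exists_bound
  obtain ⟨L, hL⟩ := hφ.contDiffOn.exists_lipschitzOnWith (s := Icc (-C) C) one_ne_zero
    (convex_Icc _ _) isCompact_Icc
  refine ac_comp_lipschitz hf (hL.mono ?_)
  rintro _ ⟨t, ht, rfl⟩
  exact abs_le.1 (hC t ht)

theorem ac_pi_apply {J : Type*} [Fintype J] {f : ℝ → J → X}
    (hf : AbsolutelyContinuousOnInterval f a b) (j : J) :
    AbsolutelyContinuousOnInterval (fun x => f x j) a b :=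
  ac_comp_lipschitz hf (LipschitzWith.eval (α := fun _ : J => X) j).lipschitzOnWith

theorem ac_finset_sum {ι F : Type*} [SeminormedAddCommGroup F] (s : Finset ι) {f : ι → ℝ → F}
    (hf : ∀ i ∈ s, AbsolutelyContinuousOnInterval (f i) a b) :
    AbsolutelyContinuousOnInterval (fun x => ∑ i ∈ s, f i x) a b := by
  classical
  induction s using Finset.induction_on with
  | empty => simpa using ac_const (0 : F) a b
  | insert i s hi ih =>
    simp only [Finset.sum_insert hi]
    exact (hf i (Finset.mem_insert_self i s)).fun_add
      (ih fun j hj => hf j (Finset.mem_insert_of_mem hj))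

theorem ac_finset_prod {ι : Type*} (s : Finset ι) {f : ι → ℝ → ℂ}
    (hf : ∀ i ∈ s, AbsolutelyContinuousOnInterval (f i) a b) :
    AbsolutelyContinuousOnInterval (fun x => ∏ i ∈ s, f i x) a b := by
  classical
  induction s using Finset.induction_on with
  | empty => simpa using ac_const (1 : ℂ) a b
  | insert i s hi ih =>
    simp only [Finset.prod_insert hi]
    exact (hf i (Finset.mem_insert_self i s)).fun_smul
      (ih fun j hj => hf j (Finset.mem_insert_of_mem hj))

variable {F : Type*} [NormedAddCommGroup F] [NormedSpace ℝ F]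

theorem ac_integral {h : ℝ → F} (hh : IntervalIntegrable h volume a b) :
    AbsolutelyContinuousOnInterval (fun x => ∫ t in a..x, h t) a b := by
  refine ac_of_dist_le (L := 1)
    (hh.norm.absolutelyContinuousOnInterval_intervalIntegral left_mem_uIcc) fun x hx y hy => ?_
  have hsub : ∀ {u}, u ∈ uIcc a b → IntervalIntegrable h volume a u := fun hu =>
    hh.mono_set (uIcc_subset_uIcc left_mem_uIcc hu)
  rw [one_mul, dist_eq_norm, intervalIntegral.integral_interval_sub_left (hsub hx) (hsub hy),
    Real.dist_eq, intervalIntegral.integral_interval_sub_left (hsub hx).norm (hsub hy).norm]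
  exact intervalIntegral.norm_integral_le_abs_integral_norm

theorem ac_eq_add_integral [CompleteSpace F] {y h : ℝ → F}
    (hy : AbsolutelyContinuousOnInterval y a b) (hh : IntervalIntegrable h volume a b)
    (hd : ∀ᵐ x, x ∈ uIcc a b → HasDerivAt y (h x) x) {x : ℝ} (hx : x ∈ uIcc a b) :
    y x = y a + ∫ t in a..x, h t := by
  obtain ⟨C, hC⟩ := (hy.fun_sub (ac_integral hh)).const_of_ae_hasDerivAt_zero (by
    filter_upwards [hd, hh.ae_hasDerivAt_integral] with x hyx hIx hx
    simpa using (hyx hx).fun_sub (hIx hx a left_mem_uIcc))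
  have hya : y a = C := by simpa using hC a left_mem_uIcc
  rw [hya, ← hC x hx, sub_add_cancel]

end AbsoluteContinuity

section IntegralInequalities

variable {k : ℝ → ℝ} {a b : ℝ}

theorem integral_mul_primitive_pow (hk : IntervalIntegrable k volume a b) (m : ℕ) :
    ∫ t in a..b, k t * (∫ r in a..t, k r) ^ m = (∫ r in a..b, k r) ^ (m + 1) / (m + 1) := by
  have hm : (m + 1 : ℝ) ≠ 0 := by positivity
  have hK := ac_integral hk
  have h_int : IntervalIntegrable (fun t => k t * (∫ r in a..t, k r) ^ m) volume a b :=
    hk.mul_continuousOn (hK.continuousOn.pow m)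
  have hftc := ac_eq_add_integral (ac_comp_contDiff hK (φ := fun u => u ^ (m + 1) / (m + 1))
    (by fun_prop)) h_int (by
      filter_upwards [hk.ae_hasDerivAt_integral] with t ht htab
      refine (((ht htab a left_mem_uIcc).fun_pow (m + 1)).div_const _).congr_deriv ?_
      push_cast
      field_simp) right_mem_uIcc
  simpa using hftc.symm

theorem gronwall_le_mul_exp_integral {w : ℝ → ℝ} {A : ℝ} (hab : a ≤ b)
    (hk : IntervalIntegrable k volume a b) (hk0 : ∀ t, 0 ≤ k t) (hw : ContinuousOn w (Icc a b))
    (h : ∀ x ∈ Icc a b, w x ≤ A + ∫ t in a..x, k t * w t) :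
    w b ≤ A * Real.exp (∫ t in a..b, k t) := by
  rw [← uIcc_of_le hab] at hw h
  set K : ℝ → ℝ := fun x => ∫ t in a..x, k t
  set v : ℝ → ℝ := fun x => A + ∫ t in a..x, k t * w t
  have hK : AbsolutelyContinuousOnInterval K a b := ac_integral hk
  have hkw : IntervalIntegrable (fun t => k t * w t) volume a b := hk.mul_continuousOn hw
  have hv : AbsolutelyContinuousOnInterval v a b := (ac_const A a b).fun_add (ac_integral hkw)
  have hexp : AbsolutelyContinuousOnInterval (fun x => Real.exp (-K x)) a b :=
    ac_comp_contDiff hK (φ := fun u => Real.exp (-u)) (by fun_prop)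
  have h_int : IntervalIntegrable
      (fun t => k t * w t * Real.exp (-K t) + v t * (Real.exp (-K t) * -k t)) volume a b :=
    (hkw.mul_continuousOn hexp.continuousOn).add
      ((hk.neg.continuousOn_mul hexp.continuousOn).continuousOn_mul hv.continuousOn)
  have hftc := ac_eq_add_integral (hv.fun_mul hexp) h_int (by
    filter_upwards [hk.ae_hasDerivAt_integral, hkw.ae_hasDerivAt_integral] with x hkx hwx hx
    exact ((hwx hx a left_mem_uIcc).const_add A).mul (hkx hx a left_mem_uIcc).neg.exp)
    right_mem_uIcc
  have hdecr : ∫ t in a..b, (k t * w t * Real.exp (-K t) + v t * (Real.exp (-K t) * -k t)) ≤ 0 := by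
    rw [← neg_nonneg, ← intervalIntegral.integral_neg]
    refine intervalIntegral.integral_nonneg hab fun t ht => ?_
    rw [← uIcc_of_le hab] at ht
    have hgap : 0 ≤ k t * (v t - w t) * Real.exp (-K t) :=
      mul_nonneg (mul_nonneg (hk0 t) (sub_nonneg.2 (h t ht))) (Real.exp_pos _).le
    linarith
  have hvb : v b * Real.exp (-K b) ≤ A := by
    simp only [v, K, intervalIntegral.integral_same, add_zero, neg_zero, Real.exp_zero,
      mul_one] at hftc hdecr ⊢
    linarith
  rw [Real.exp_neg, ← div_eq_mul_inv, div_le_iff₀ (Real.exp_pos _)] at hvb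
  exact (h b right_mem_uIcc).trans hvb

end IntegralInequalities

theorem isUnit_one_sub_of_norm_pow_lt_one {R : Type*} [NormedRing R] [HasSummableGeomSeries R]
    {x : R} {m : ℕ} (h : ‖x ^ m‖ < 1) : IsUnit (1 - x) := by
  have hunit := isUnit_one_sub_of_norm_lt_one h
  rw [← mul_neg_geom_sum x m] at hunit
  refine ((Commute.isUnit_mul_iff ?_).1 hunit).1
  exact Commute.sum_right _ _ _ fun i _ =>
    ((Commute.one_left _).sub_left (Commute.refl x)).pow_right i

theorem differentiable_inverse_affine {R : Type*} [NormedRing R] [NormedAlgebra ℂ R]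
    [CompleteSpace R] {V W : R} (h : ∀ μ : ℂ, IsUnit (1 - (V + μ • W))) :
    Differentiable ℂ fun μ : ℂ => Ring.inverse (1 - (V + μ • W)) := fun μ =>
  DifferentiableAt.comp (g := Ring.inverse) μ (differentiableAt_inverse (𝕜 := ℂ) (h μ))
    (show DifferentiableAt ℂ (fun μ : ℂ => 1 - (V + μ • W)) μ by fun_prop)

section LinearODE

open unitInterval

theorem norm_IccExtend_le {E : Type*} [SeminormedAddCommGroup E] (y : C(I, E)) (t : ℝ) :
    ‖IccExtend zero_le_one y t‖ ≤ ‖y‖ :=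
  y.norm_coe_le_norm _

variable {E : Type*} [NormedAddCommGroup E] [NormedSpace ℂ E]

section Primitive

variable {h h' : ℝ → E}

theorem uIcc_zero_subset_unit (x : I) : uIcc (0 : ℝ) x ⊆ uIcc 0 1 :=
  uIcc_subset_uIcc left_mem_uIcc (by rw [uIcc_of_le zero_le_one]; exact x.2)

/-- The primitive vanishing at `0` of an integrable function, as a continuous function. -/
noncomputable def primitive (h : ℝ → E) (hh : IntervalIntegrable h volume 0 1) : C(I, E) where
  toFun x := ∫ t in (0 : ℝ)..x, h t
  continuous_toFun := by
    have hcont := (ac_integral hh).continuousOn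
    rw [uIcc_of_le zero_le_one] at hcont
    exact continuousOn_iff_continuous_domRestrict.1 hcont

theorem primitive_apply (hh : IntervalIntegrable h volume 0 1) (x : I) :
    primitive h hh x = ∫ t in (0 : ℝ)..x, h t := rfl

theorem primitive_apply_zero (hh : IntervalIntegrable h volume 0 1) : primitive h hh 0 = 0 := by
  simp [primitive_apply]

theorem primitive_congr (hh : IntervalIntegrable h volume 0 1)
    (hh' : IntervalIntegrable h' volume 0 1) (heq : h =ᵐ[unitVol] h') :
    primitive h hh = primitive h' hh' := by
  ext1 x
  refine intervalIntegral.integral_congr_ae ?_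
  filter_upwards [(ae_restrict_iff' measurableSet_Icc).1 heq] with t ht htx
  rw [uIoc_of_le x.2.1] at htx
  exact ht ⟨htx.1.le, htx.2.trans x.2.2⟩

theorem primitive_zero (h0 : IntervalIntegrable (0 : ℝ → E) volume 0 1) : primitive 0 h0 = 0 := by
  ext1 x
  simp [primitive_apply]

theorem primitive_add (hh : IntervalIntegrable h volume 0 1)
    (hh' : IntervalIntegrable h' volume 0 1) :
    primitive (fun t => h t + h' t) (hh.add hh') = primitive h hh + primitive h' hh' := by
  ext1 x
  exact intervalIntegral.integral_add (hh.mono_set (uIcc_zero_subset_unit x))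
    (hh'.mono_set (uIcc_zero_subset_unit x))

theorem primitive_smul (c : ℂ) (hh : IntervalIntegrable h volume 0 1) :
    primitive (fun t => c • h t) (hh.smul c) = c • primitive h hh := by
  ext1 x
  exact intervalIntegral.integral_smul c h

theorem norm_primitive_apply_le {k : ℝ → ℝ} (hh : IntervalIntegrable h volume 0 1)
    (hk : IntervalIntegrable k volume 0 1) (x : I) (hle : ∀ t ∈ Icc (0 : ℝ) x, ‖h t‖ ≤ k t) :
    ‖primitive h hh x‖ ≤ ∫ t in (0 : ℝ)..x, k t :=
  intervalIntegral.norm_integral_le_of_norm_le x.2.1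
    (Filter.Eventually.of_forall fun t ht => hle t (Ioc_subset_Icc_self ht))
    (hk.mono_set (uIcc_zero_subset_unit x))

theorem norm_primitive_le {k : ℝ → ℝ} (hh : IntervalIntegrable h volume 0 1)
    (hk : IntervalIntegrable k volume 0 1) (hle : ∀ t, ‖h t‖ ≤ k t) :
    ‖primitive h hh‖ ≤ ∫ t in (0 : ℝ)..1, k t := by
  have hk0 : ∀ t, 0 ≤ k t := fun t => (norm_nonneg _).trans (hle t)
  refine (ContinuousMap.norm_le _ (intervalIntegral.integral_nonneg zero_le_one
    fun t _ => hk0 t)).2 fun x => ?_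
  exact (norm_primitive_apply_le hh hk x fun t _ => hle t).trans
    (intervalIntegral.integral_mono_interval le_rfl x.2.1 x.2.2
      (Filter.Eventually.of_forall hk0) hk)

end Primitive

section Volterra

variable {A : ℝ → E →L[ℂ] E}

theorem intervalIntegrable_clm_apply (hA : IntervalIntegrable A volume 0 1) {y : ℝ → E}
    (hy : ContinuousOn y (Icc 0 1)) : IntervalIntegrable (fun t => A t (y t)) volume 0 1 := by
  rw [intervalIntegrable_iff_integrableOn_Icc_of_le zero_le_one] at hA ⊢
  obtain ⟨C, hC⟩ := isCompact_Icc.exists_bound_of_continuousOn hy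
  refine (hA.norm.mul_const C).mono'
    ((ContinuousLinearMap.id ℂ (E →L[ℂ] E)).aestronglyMeasurable_comp₂ hA.aestronglyMeasurable
      (hy.aestronglyMeasurable measurableSet_Icc)) ?_
  filter_upwards [ae_restrict_mem measurableSet_Icc] with t ht
  exact (A t).le_opNorm_of_le (hC t ht)

theorem intervalIntegrable_clm_apply_IccExtend (hA : IntervalIntegrable A volume 0 1)
    (y : C(I, E)) : IntervalIntegrable (fun t => A t (IccExtend zero_le_one y t)) volume 0 1 :=
  intervalIntegrable_clm_apply hA y.continuous.Icc_extend'.continuousOn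

/-- The Volterra operator `y ↦ ∫₀ˣ A(t) y(t) dt`; outside `[0, 1]`, `y` is extended by its
boundary values. -/
noncomputable def volterra (A : ℝ → E →L[ℂ] E) (hA : IntervalIntegrable A volume 0 1) :
    C(I, E) →L[ℂ] C(I, E) :=
  LinearMap.mkContinuous
    { toFun := fun y => primitive (fun t => A t (IccExtend zero_le_one y t))
        (intervalIntegrable_clm_apply_IccExtend hA y)
      map_add' := fun y z => by
        rw [← primitive_add]
        congr 1
        exact funext fun t => map_add (A t) _ _
      map_smul' := fun c y => by
        rw [← primitive_smul]
        congr 1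
        exact funext fun t => map_smul (A t) _ _ }
    (∫ t in (0 : ℝ)..1, ‖A t‖) fun y => by
      rw [← intervalIntegral.integral_mul_const]
      exact norm_primitive_le (intervalIntegrable_clm_apply_IccExtend hA y)
        (hA.norm.mul_const _) fun t => (A t).le_opNorm_of_le (norm_IccExtend_le y t)

theorem volterra_apply (hA : IntervalIntegrable A volume 0 1) (y : C(I, E)) :
    volterra A hA y = primitive (fun t => A t (IccExtend zero_le_one y t))
      (intervalIntegrable_clm_apply_IccExtend hA y) := rfl

theorem volterra_add_smul {A' : ℝ → E →L[ℂ] E} (hA : IntervalIntegrable A volume 0 1)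
    (hA' : IntervalIntegrable A' volume 0 1) (μ : ℂ) :
    volterra (fun t => A t + μ • A' t) (hA.add (hA'.smul μ)) =
      volterra A hA + μ • volterra A' hA' := by
  ext1 y
  simp only [_root_.add_apply, _root_.smul_apply, volterra_apply]
  rw [← primitive_smul, ← primitive_add]

theorem norm_volterra_pow_apply_le (hA : IntervalIntegrable A volume 0 1) (m : ℕ) (y : C(I, E))
    (x : I) :
    ‖(volterra A hA ^ m) y x‖ ≤ (∫ t in (0 : ℝ)..x, ‖A t‖) ^ m / m.factorial * ‖y‖ := by
  induction m generalizing x with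
  | zero => simpa using y.norm_coe_le_norm x
  | succ m ih =>
    set K : ℝ → ℝ := fun x => ∫ t in (0 : ℝ)..x, ‖A t‖
    have h_int : IntervalIntegrable (fun t => ‖A t‖ * K t ^ m * (‖y‖ / m.factorial)) volume 0 1 :=
      (hA.norm.mul_continuousOn ((ac_integral hA.norm).continuousOn.pow m)).mul_const _
    rw [pow_succ', mul_apply_eq_comp, volterra_apply]
    calc _ ≤ ∫ t in (0 : ℝ)..x, ‖A t‖ * K t ^ m * (‖y‖ / m.factorial) := by
          refine norm_primitive_apply_le _ h_int x fun t ht => ?_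
          have htI : t ∈ I := ⟨ht.1, ht.2.trans x.2.2⟩
          rw [IccExtend_of_mem _ _ htI]
          exact ((A t).le_opNorm_of_le (ih ⟨t, htI⟩)).trans_eq (by ring)
      _ = K x ^ (m + 1) / (m + 1) * (‖y‖ / m.factorial) := by
          rw [intervalIntegral.integral_mul_const,
            integral_mul_primitive_pow (hA.norm.mono_set (uIcc_zero_subset_unit x))]
      _ = K x ^ (m + 1) / (m + 1).factorial * ‖y‖ := by
          rw [Nat.factorial_succ]
          push_cast
          field_simp

theorem norm_volterra_pow_le (hA : IntervalIntegrable A volume 0 1) (m : ℕ) :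
    ‖volterra A hA ^ m‖ ≤ (∫ t in (0 : ℝ)..1, ‖A t‖) ^ m / m.factorial := by
  have hnonneg : ∀ x : I, 0 ≤ ∫ t in (0 : ℝ)..x, ‖A t‖ := fun x =>
    intervalIntegral.integral_nonneg x.2.1 fun t _ => norm_nonneg _
  have hbound : 0 ≤ (∫ t in (0 : ℝ)..1, ‖A t‖) ^ m / m.factorial :=
    div_nonneg (pow_nonneg (hnonneg 1) m) (Nat.cast_nonneg _)
  refine ContinuousLinearMap.opNorm_le_bound _ hbound fun y =>
    (ContinuousMap.norm_le _ (mul_nonneg hbound (norm_nonneg y))).2 fun x =>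
      (norm_volterra_pow_apply_le hA m y x).trans ?_
  gcongr
  · exact hnonneg x
  · exact intervalIntegral.integral_mono_interval le_rfl x.2.1 x.2.2
      (Filter.Eventually.of_forall fun t => norm_nonneg _) hA.norm

variable [CompleteSpace E]

theorem isUnit_one_sub_volterra (hA : IntervalIntegrable A volume 0 1) :
    IsUnit (1 - volterra A hA) := by
  obtain ⟨m, hm⟩ := ((FloorSemiring.tendsto_pow_div_factorial_atTop
    (∫ t in (0 : ℝ)..1, ‖A t‖)).eventually_lt_const one_pos).exists
  exact isUnit_one_sub_of_norm_pow_lt_one (R := C(I, E) →L[ℂ] C(I, E))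
    ((norm_volterra_pow_le hA m).trans_lt hm)

/-- The operator `u ↦ y` solving the integral equation `y = u + ∫₀ˣ A y`. -/
noncomputable def solutionOp (A : ℝ → E →L[ℂ] E) (hA : IntervalIntegrable A volume 0 1) :
    C(I, E) →L[ℂ] C(I, E) := Ring.inverse (1 - volterra A hA)

theorem eq_solutionOp_iff (hA : IntervalIntegrable A volume 0 1) {u y : C(I, E)} :
    y = solutionOp A hA u ↔ y = u + volterra A hA y := by
  have hleft := DFunLike.congr_fun (Ring.inverse_mul_cancel _ (isUnit_one_sub_volterra hA))
  have hright := DFunLike.congr_fun (Ring.mul_inverse_cancel _ (isUnit_one_sub_volterra hA))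
  simp only [mul_apply_eq_comp, sub_apply, one_apply_eq_self] at hleft hright
  constructor
  · rintro rfl
    exact sub_eq_iff_eq_add.1 (hright u)
  · intro hy
    rw [solutionOp, ← sub_eq_iff_eq_add.2 hy]
    exact (hleft y).symm

theorem solutionOp_apply_zero (hA : IntervalIntegrable A volume 0 1) (u : C(I, E)) :
    solutionOp A hA u 0 = u 0 := by
  have hval := congrArg (fun y : C(I, E) => y 0) ((eq_solutionOp_iff hA (u := u)).1 rfl)
  simpa [volterra_apply, primitive_apply_zero] using hval

theorem differentiable_solutionOp {A₀ A₁ : ℝ → E →L[ℂ] E}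
    (hA₀ : IntervalIntegrable A₀ volume 0 1) (hA₁ : IntervalIntegrable A₁ volume 0 1) :
    Differentiable ℂ fun μ : ℂ =>
      solutionOp (fun t => A₀ t + μ • A₁ t) (hA₀.add (hA₁.smul μ)) := by
  simp only [solutionOp, volterra_add_smul hA₀ hA₁]
  refine differentiable_inverse_affine (R := C(I, E) →L[ℂ] C(I, E)) fun μ => ?_
  rw [← volterra_add_smul hA₀ hA₁]
  exact isUnit_one_sub_volterra (hA₀.add (hA₁.smul μ))

end Volterra

section Solutions

/-- Absolutely continuous solutions of `y' = A y + h` on `[0, 1]`. -/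
def IsSolution (A : ℝ → E →L[ℂ] E) (h y : ℝ → E) : Prop :=
  AbsolutelyContinuousOnInterval y 0 1 ∧
    ∀ᵐ x, x ∈ Icc (0 : ℝ) 1 → HasDerivAt y (A x (y x) + h x) x

variable {A : ℝ → E →L[ℂ] E} {h : ℝ → E}

theorem IsSolution.continuousOn {y : ℝ → E} (hy : IsSolution A h y) :
    ContinuousOn y (Icc 0 1) := by
  simpa [uIcc_of_le zero_le_one] using hy.1.continuousOn

theorem ae_mem_Ioo_of_mem_Icc : ∀ᵐ x : ℝ, x ∈ Icc (0 : ℝ) 1 → x ∈ Ioo (0 : ℝ) 1 :=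
  (Ioo_ae_eq_Icc (μ := volume)).mem_iff.mono fun _ hx => hx.2

variable [CompleteSpace E]

theorem isSolution_solutionOp (hA : IntervalIntegrable A volume 0 1)
    (hh : IntervalIntegrable h volume 0 1) (v : E) :
    IsSolution A h (IccExtend zero_le_one
      (solutionOp A hA (ContinuousMap.const I v + primitive h hh))) := by
  set y := solutionOp A hA (ContinuousMap.const I v + primitive h hh) with hy
  set y' := IccExtend zero_le_one y
  have h_int : IntervalIntegrable (fun t => A t (y' t) + h t) volume 0 1 :=
    (intervalIntegrable_clm_apply_IccExtend hA y).add hh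
  have hform : ∀ x ∈ Icc (0 : ℝ) 1, v + ∫ t in (0 : ℝ)..x, (A t (y' t) + h t) = y' x := by
    intro x hx
    have hval := congrArg (fun u : C(I, E) => u ⟨x, hx⟩) ((eq_solutionOp_iff hA).1 hy)
    rw [← primitive_apply h_int ⟨x, hx⟩,
      primitive_add (intervalIntegrable_clm_apply_IccExtend hA y) hh, ← volterra_apply hA,
      show y' x = y ⟨x, hx⟩ from IccExtend_of_mem _ _ hx]
    simp only [ContinuousMap.add_apply, ContinuousMap.const_apply] at hval ⊢
    rw [hval]
    abel
  refine ⟨ac_congr ((ac_const v 0 1).fun_add (ac_integral h_int)) ?_, ?_⟩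
  · rwa [uIcc_of_le zero_le_one]
  · filter_upwards [h_int.ae_hasDerivAt_integral, ae_mem_Ioo_of_mem_Icc] with x hderiv hIoo hx
    rw [uIcc_of_le zero_le_one] at hderiv
    refine ((hderiv hx 0 (left_mem_Icc.2 zero_le_one)).const_add v).congr_of_eventuallyEq ?_
    filter_upwards [Icc_mem_nhds (hIoo hx).1 (hIoo hx).2] with t ht using (hform t ht).symm

theorem IsSolution.apply_eq_solutionOp (hA : IntervalIntegrable A volume 0 1)
    (hh : IntervalIntegrable h volume 0 1) {y : ℝ → E} (hy : IsSolution A h y) (x : I) :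
    y x = solutionOp A hA (ContinuousMap.const I (y 0) + primitive h hh) x := by
  let y' : C(I, E) := ⟨fun x => y x, continuousOn_iff_continuous_domRestrict.1 hy.continuousOn⟩
  suffices hy' : y' = solutionOp A hA (ContinuousMap.const I (y 0) + primitive h hh) from
    DFunLike.congr_fun hy' x
  have hAy := intervalIntegrable_clm_apply hA hy.continuousOn
  have hvol : volterra A hA y' = primitive (fun t => A t (y t)) hAy := by
    refine primitive_congr (intervalIntegrable_clm_apply_IccExtend hA y') hAy ?_
    filter_upwards [ae_restrict_mem measurableSet_Icc] with t ht
    rw [IccExtend_of_mem _ _ ht]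
    rfl
  rw [eq_solutionOp_iff, hvol, add_assoc, add_comm (primitive h hh), ← primitive_add]
  ext1 x
  exact ac_eq_add_integral hy.1 (hAy.add hh) (by simpa [uIcc_of_le zero_le_one] using hy.2)
    (uIcc_zero_subset_unit x right_mem_uIcc)

theorem isSolution_solutionOp_const (hA : IntervalIntegrable A volume 0 1) (v : E) :
    IsSolution A 0 (IccExtend zero_le_one (solutionOp A hA (ContinuousMap.const I v))) := by
  have hzero : IntervalIntegrable (0 : ℝ → E) volume 0 1 := intervalIntegrable_const
  simpa only [primitive_zero, add_zero] using isSolution_solutionOp hA hzero v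

theorem IsSolution.apply_eq_solutionOp_const (hA : IntervalIntegrable A volume 0 1) {y : ℝ → E}
    (hy : IsSolution A 0 y) (x : I) : y x = solutionOp A hA (ContinuousMap.const I (y 0)) x := by
  have hzero : IntervalIntegrable (0 : ℝ → E) volume 0 1 := intervalIntegrable_const
  simpa only [primitive_zero, add_zero] using hy.apply_eq_solutionOp hA hzero x

end Solutions

end LinearODE

section ExponentialGrowth

theorem exp_mul_norm_le_add_integral {y g : ℝ → ℂ} {s : ℂ} {ω a b : ℝ} (hs : s.re ≤ ω)
    (hab : a ≤ b) (hy : AbsolutelyContinuousOnInterval y a b)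
    (hg : IntervalIntegrable g volume a b)
    (hd : ∀ᵐ t, t ∈ uIcc a b → HasDerivAt y (s * y t + g t) t) :
    Real.exp (-ω * b) * ‖y b‖ ≤
      Real.exp (-ω * a) * ‖y a‖ + ∫ t in a..b, Real.exp (-ω * t) * ‖g t‖ := by
  have hexp : ContDiff ℝ 1 fun t : ℝ => cexp (s * (b - t)) :=
    (contDiff_const.mul (contDiff_const.sub ofRealCLM.contDiff)).cexp
  have variation_of_constants : y b =
      cexp (s * (b - a)) * y a + ∫ t in a..b, cexp (s * (b - t)) * g t := by
    refine Eq.trans (by simp) (ac_eq_add_integral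
      (hexp.contDiffOn.absolutelyContinuousOnInterval.fun_smul hy)
      (hg.continuousOn_mul hexp.continuous.continuousOn) ?_ right_mem_uIcc)
    filter_upwards [hd] with t ht htm
    have hderiv : HasDerivAt (fun t : ℝ => cexp (s * (b - t))) (cexp (s * (b - t)) * -s) t := by
      simpa using (((hasDerivAt_const t (b : ℂ)).sub
        (ofRealCLM.hasDerivAt (x := t))).const_mul s).cexp
    exact (hderiv.fun_mul (ht htm)).congr_deriv (by ring)
  have weight_le : ∀ t ≤ b, Real.exp (-ω * b) * ‖cexp (s * (b - t))‖ ≤ Real.exp (-ω * t) := by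
    intro t ht
    rw [Complex.norm_exp, ← Real.exp_add, ← ofReal_sub, re_mul_ofReal]
    exact Real.exp_le_exp.2 (by nlinarith)
  have hbound : ∀ t ≤ b, ∀ z : ℂ,
      Real.exp (-ω * b) * ‖cexp (s * (b - t)) * z‖ ≤ Real.exp (-ω * t) * ‖z‖ := fun t ht z => by
    rw [norm_mul, ← mul_assoc]
    exact mul_le_mul_of_nonneg_right (weight_le t ht) (norm_nonneg z)
  calc Real.exp (-ω * b) * ‖y b‖
      ≤ Real.exp (-ω * b) *
          (‖cexp (s * (b - a)) * y a‖ + ∫ t in a..b, ‖cexp (s * (b - t)) * g t‖) := by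
        rw [variation_of_constants]
        gcongr
        exact (norm_add_le _ _).trans
          (add_le_add_right (intervalIntegral.norm_integral_le_integral_norm hab) _)
    _ ≤ _ := by
        rw [mul_add, ← intervalIntegral.integral_const_mul]
        refine add_le_add (hbound a hab _) (intervalIntegral.integral_mono_on hab ?_ ?_
          fun t ht => hbound t ht.2 _)
        · exact ((hg.continuousOn_mul hexp.continuous.continuousOn).norm).const_mul _
        · exact hg.norm.continuousOn_mul (by fun_prop)

variable {K : Type*} [Fintype K] {y : ℝ → K → ℂ} {s : K → ℂ} {g : K → ℝ → ℂ} {k : ℝ → ℝ}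
  {ω a b : ℝ}

theorem exp_mul_pi_norm_le_add_integral (hab : a ≤ b) (hs : ∀ i, (s i).re ≤ ω)
    (hy : ∀ i, AbsolutelyContinuousOnInterval (fun t => y t i) a b)
    (hg : ∀ i, IntervalIntegrable (g i) volume a b)
    (hd : ∀ i, ∀ᵐ t, t ∈ uIcc a b → HasDerivAt (fun t => y t i) (s i * y t i + g i t) t)
    (hky : IntervalIntegrable (fun t => k t * (Real.exp (-ω * t) * ‖y t‖)) volume a b)
    (hk0 : ∀ t, 0 ≤ k t) (hgk : ∀ i t, ‖g i t‖ ≤ k t * ‖y t‖) :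
    Real.exp (-ω * b) * ‖y b‖ ≤
      Real.exp (-ω * a) * ‖y a‖ + ∫ t in a..b, k t * (Real.exp (-ω * t) * ‖y t‖) := by
  have hky0 : ∀ t, 0 ≤ k t * (Real.exp (-ω * t) * ‖y t‖) := fun t =>
    mul_nonneg (hk0 t) (by positivity)
  rw [← le_div_iff₀' (Real.exp_pos _)]
  refine (pi_norm_le_iff_of_nonneg (div_nonneg (add_nonneg (by positivity)
    (intervalIntegral.integral_nonneg hab fun t _ => hky0 t)) (Real.exp_pos _).le)).2
    fun i => ?_
  rw [le_div_iff₀' (Real.exp_pos _)]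
  refine (exp_mul_norm_le_add_integral (hs i) hab (hy i) (hg i) (hd i)).trans (add_le_add ?_ ?_)
  · exact mul_le_mul_of_nonneg_left (norm_le_pi_norm _ i) (Real.exp_pos _).le
  · refine intervalIntegral.integral_mono_on hab ((hg i).norm.continuousOn_mul (by fun_prop)) hky
      fun t _ => ?_
    rw [mul_left_comm]
    exact mul_le_mul_of_nonneg_left (hgk i t) (Real.exp_pos _).le

theorem norm_le_exp_mul_norm (hab : a ≤ b) (hs : ∀ i, (s i).re ≤ ω)
    (hy : ∀ i, AbsolutelyContinuousOnInterval (fun t => y t i) a b)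
    (hg : ∀ i, IntervalIntegrable (g i) volume a b)
    (hd : ∀ i, ∀ᵐ t, t ∈ uIcc a b → HasDerivAt (fun t => y t i) (s i * y t i + g i t) t)
    (hk : IntervalIntegrable k volume a b) (hk0 : ∀ t, 0 ≤ k t)
    (hgk : ∀ i t, ‖g i t‖ ≤ k t * ‖y t‖) :
    ‖y b‖ ≤ Real.exp (ω * (b - a) + ∫ t in a..b, k t) * ‖y a‖ := by
  have hcont : ContinuousOn y (uIcc a b) := continuousOn_pi.2 fun i => (hy i).continuousOn
  have hw : ContinuousOn (fun t => Real.exp (-ω * t) * ‖y t‖) (uIcc a b) :=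
    ContinuousOn.mul (by fun_prop) hcont.norm
  have hgronwall := gronwall_le_mul_exp_integral hab hk hk0
    (by rwa [← uIcc_of_le hab]) fun x hx => by
      have hsub : uIcc a x ⊆ uIcc a b := uIcc_subset_uIcc_left (by rwa [uIcc_of_le hab])
      exact exp_mul_pi_norm_le_add_integral hx.1 hs (fun i => (hy i).mono hsub)
        (fun i => (hg i).mono_set hsub) (fun i => (hd i).mono fun t ht htm => ht (hsub htm))
        ((hk.mul_continuousOn hw).mono_set hsub) hk0 hgk
  calc ‖y b‖ = Real.exp (ω * b) * (Real.exp (-ω * b) * ‖y b‖) := by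
        rw [← mul_assoc, ← Real.exp_add]; simp
    _ ≤ Real.exp (ω * b) * (Real.exp (-ω * a) * ‖y a‖ * Real.exp (∫ t in a..b, k t)) := by gcongr
    _ = _ := by
        rw [mul_sub, sub_eq_add_neg, Real.exp_add, Real.exp_add, ← neg_mul]; ring

end ExponentialGrowth

section EntrySum

variable {J : Type*} [Fintype J]

/-- The matrix `A` has integrable entries on `[0,1]`. -/
def EntryIntegrable (A : ℝ → Matrix J J ℂ) : Prop :=
  ∀ i j, IntervalIntegrable (fun t => A t i j) volume 0 1

/-- The sum of the absolute values of the entries of `A`. -/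
noncomputable def entrySum (A : Matrix J J ℂ) : ℝ := ∑ i, ∑ j, ‖A i j‖

theorem entrySum_nonneg (A : Matrix J J ℂ) : 0 ≤ entrySum A :=
  Finset.sum_nonneg fun _ _ => Finset.sum_nonneg fun _ _ => norm_nonneg _

theorem EntryIntegrable.entrySum {A : ℝ → Matrix J J ℂ} (hA : EntryIntegrable A) :
    IntervalIntegrable (fun t => entrySum (A t)) volume 0 1 := by
  have hsum := IntervalIntegrable.sum Finset.univ fun i _ =>
    IntervalIntegrable.sum Finset.univ fun j _ => (hA i j).norm
  simpa only [Finset.sum_fn] using! hsum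

end EntrySum

section Determinants

variable {J : Type*} [DecidableEq J]

/-- The matrix whose rows with index in `S` are the rows of `N` chosen by `σ`, the others being
prescribed by `q`. -/
def mixedRows (S : Finset J) (q : J → J → ℂ) (σ : J → J) (N : Matrix J J ℂ) : Matrix J J ℂ :=
  Matrix.of fun j => if j ∈ S then N (σ j) else q j

theorem mixedRows_of_mem {S : Finset J} (q : J → J → ℂ) (σ : J → J) (N : Matrix J J ℂ)
    {j : J} (hj : j ∈ S) : mixedRows S q σ N j = N (σ j) := by
  ext k
  simp [mixedRows, hj]

theorem mixedRows_of_notMem {S : Finset J} (q : J → J → ℂ) (σ : J → J) (N : Matrix J J ℂ)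
    {j : J} (hj : j ∉ S) : mixedRows S q σ N j = q j := by
  ext k
  simp [mixedRows, hj]

theorem mixedRows_updateRow {S : Finset J} (q : J → J → ℂ) (σ : J → J) (N : Matrix J J ℂ)
    {l : J} (hl : l ∈ S) (k : J) :
    (mixedRows S q σ N).updateRow l (N k) = mixedRows S q (Function.update σ l k) N := by
  ext i j
  by_cases hi : i = l
  · subst hi
    rw [Matrix.updateRow_self, mixedRows_of_mem _ _ _ hl, Function.update_self]
  · simp [mixedRows, Matrix.updateRow_ne hi, Function.update_of_ne hi]

variable [Fintype J]

theorem hasDerivAt_det {M : ℝ → Matrix J J ℂ} {M' : Matrix J J ℂ} {x : ℝ}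
    (h : ∀ j, HasDerivAt (fun t => M t j) (M' j) x) :
    HasDerivAt (fun t => (M t).det) (∑ l, ((M x).updateRow l (M' l)).det) x := by
  let detRows : ContinuousMultilinearMap ℝ (fun _ : J => J → ℂ) ℂ :=
    { toMultilinearMap :=
        (Matrix.detRowAlternating (R := ℂ) (n := J)).toMultilinearMap.restrictScalars ℝ
      cont := Continuous.matrix_det continuous_id }
  refine (HasFDerivAt.multilinear_comp (f := detRows)
    fun j => (h j).hasFDerivAt).hasDerivAt.congr_deriv ?_
  rw [sum_apply]
  refine Finset.sum_congr rfl fun l _ => ?_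
  simp only [ContinuousLinearMap.comp_apply, ContinuousLinearMap.toSpanSingleton_apply, one_smul]
  rfl

theorem ac_det {M : ℝ → Matrix J J ℂ} {a b : ℝ}
    (h : ∀ i j, AbsolutelyContinuousOnInterval (fun t => M t i j) a b) :
    AbsolutelyContinuousOnInterval (fun t => (M t).det) a b := by
  simp only [Matrix.det_apply']
  exact ac_finset_sum _ fun σ _ => (ac_const (((Equiv.Perm.sign σ : ℤ) : ℂ)) a b).fun_smul
    (ac_finset_prod _ fun i _ => h _ _)

theorem det_updateRow_sum_smul (N : Matrix J J ℂ) (l : J) (c : J → ℂ) (r : J → J → ℂ) :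
    (N.updateRow l (∑ k, c k • r k)).det = ∑ k, c k * (N.updateRow l (r k)).det := by
  refine (Matrix.detRowAlternating.map_update_sum Finset.univ l (fun k => c k • r k) N).trans ?_
  exact Finset.sum_congr rfl fun k _ => Matrix.detRowAlternating.map_update_smul N l (c k) (r k)

theorem det_mixedRows_eq_zero {S : Finset J} (q : J → J → ℂ) {σ : J → J} (N : Matrix J J ℂ)
    (hσ : ¬ InjOn σ S) : (mixedRows S q σ N).det = 0 := by
  simp only [InjOn, not_forall] at hσ
  obtain ⟨i, hi, j, hj, hij, hne⟩ := hσ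
  refine Matrix.det_zero_of_row_eq hne ?_
  rw [mixedRows_of_mem _ _ _ hi, mixedRows_of_mem _ _ _ hj, hij]

theorem norm_det_rows_one_le (f : J → J) :
    ‖(Matrix.of fun j => (1 : Matrix J J ℂ) (f j)).det‖ ≤ 1 := by
  by_cases hf : Function.Injective f
  · have hperm := Matrix.det_permute
      (Equiv.ofBijective f (Finite.injective_iff_bijective.1 hf)) (1 : Matrix J J ℂ)
    rw [Matrix.det_one, mul_one] at hperm
    refine ((congrArg norm hperm).trans ?_).le
    rcases Int.units_eq_one_or
      (Equiv.Perm.sign (Equiv.ofBijective f (Finite.injective_iff_bijective.1 hf))) with h | h <;>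
    simp [h]
  · simp only [Function.Injective, not_forall] at hf
    obtain ⟨i, j, hij, hne⟩ := hf
    have hrow : (Matrix.of fun j => (1 : Matrix J J ℂ) (f j)) i =
        (Matrix.of fun j => (1 : Matrix J J ℂ) (f j)) j := congrArg (1 : Matrix J J ℂ) hij
    rw [Matrix.det_zero_of_row_eq hne hrow, norm_zero]
    exact zero_le_one

/-- The matrix `M` has absolutely continuous entries and satisfies `M' = A M`. -/
def IsMatrixSolution (A : ℝ → Matrix J J ℂ) (M : ℝ → Matrix J J ℂ) : Prop :=
  (∀ i j, AbsolutelyContinuousOnInterval (fun t => M t i j) 0 1) ∧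
    ∀ᵐ t, t ∈ Icc (0 : ℝ) 1 → ∀ i, HasDerivAt (fun t => M t i) ((A t * M t) i) t

theorem IsMatrixSolution.ac_det_mixedRows {A M : ℝ → Matrix J J ℂ} (hM : IsMatrixSolution A M)
    (S : Finset J) (q : J → J → ℂ) (σ : J → J) :
    AbsolutelyContinuousOnInterval (fun t => (mixedRows S q σ (M t)).det) 0 1 := by
  refine ac_det fun i j => ?_
  by_cases hi : i ∈ S
  · simpa only [mixedRows_of_mem _ _ _ hi] using hM.1 _ _
  · simpa only [mixedRows_of_notMem _ _ _ hi] using ac_const _ _ _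

theorem hasDerivAt_det_mixedRows {a : J → ℂ} {P M : ℝ → Matrix J J ℂ} {t : ℝ}
    (h : ∀ i, HasDerivAt (fun t => M t i) (((Matrix.diagonal a + P t) * M t) i) t)
    (S : Finset J) (q : J → J → ℂ) (σ : J → J) :
    HasDerivAt (fun t => (mixedRows S q σ (M t)).det)
      ((∑ l ∈ S, a (σ l)) * (mixedRows S q σ (M t)).det +
        ∑ l ∈ S, ∑ k, P t (σ l) k * (mixedRows S q (Function.update σ l k) (M t)).det) t := by
  have hrows : ∀ j, HasDerivAt (fun t => mixedRows S q σ (M t) j)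
      (mixedRows S 0 σ ((Matrix.diagonal a + P t) * M t) j) t := by
    intro j
    by_cases hj : j ∈ S
    · simpa only [mixedRows_of_mem _ _ _ hj] using h (σ j)
    · simp only [mixedRows_of_notMem _ _ _ hj]
      exact hasDerivAt_const t (q j)
  refine (hasDerivAt_det hrows).congr_deriv ?_
  rw [Finset.sum_mul, ← Finset.sum_add_distrib, ← Finset.sum_subset (Finset.subset_univ S)]
  · refine Finset.sum_congr rfl fun l hl => ?_
    have hrow : mixedRows S 0 σ ((Matrix.diagonal a + P t) * M t) l =
        a (σ l) • M t (σ l) + ∑ k, P t (σ l) k • M t k := by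
      ext j
      simp only [mixedRows_of_mem _ _ _ hl, add_mul, Matrix.add_apply, Matrix.diagonal_mul,
        Pi.add_apply, Pi.smul_apply, Finset.sum_apply, smul_eq_mul]
      rfl
    rw [hrow, Matrix.det_updateRow_add, Matrix.det_updateRow_smul, mixedRows_updateRow q σ _ hl,
      Function.update_eq_self]
    congr 1
    refine (det_updateRow_sum_smul _ l (P t (σ l)) (M t)).trans ?_
    exact Finset.sum_congr rfl fun k _ => by rw [mixedRows_updateRow q σ _ hl]
  · intro l _ hl
    refine Matrix.det_eq_zero_of_row_eq_zero l fun j => ?_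
    rw [Matrix.updateRow_self, mixedRows_of_notMem _ _ _ hl, Pi.zero_apply, Pi.zero_apply]

/-- The determinants of all the matrices `mixedRows S q σ N` with `σ` injective on `S`. For a
solution `N = M(t)` of `M' = A M` they form the solution of a linear system, the compound system. -/
noncomputable def mixedMinors (S : Finset J) (q : J → J → ℂ) (N : Matrix J J ℂ) :
    {σ : J → J // InjOn σ S} → ℂ :=
  fun σ => (mixedRows S q σ N).det

theorem norm_det_mixedRows_le_norm_mixedMinors (S : Finset J) (q : J → J → ℂ) (σ : J → J)
    (N : Matrix J J ℂ) : ‖(mixedRows S q σ N).det‖ ≤ ‖mixedMinors S q N‖ := by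
  by_cases hσ : InjOn σ S
  · exact norm_le_pi_norm (mixedMinors S q N) ⟨σ, hσ⟩
  · rw [det_mixedRows_eq_zero q N hσ, norm_zero]
    exact norm_nonneg _

theorem norm_sum_mul_det_mixedRows_le (B N : Matrix J J ℂ) (S : Finset J) (q : J → J → ℂ)
    {σ : J → J} (hσ : InjOn σ S) :
    ‖∑ l ∈ S, ∑ k, B (σ l) k * (mixedRows S q (Function.update σ l k) N).det‖ ≤
      entrySum B * ‖mixedMinors S q N‖ := by
  calc _ ≤ ∑ l ∈ S, ∑ k, ‖B (σ l) k‖ * ‖mixedMinors S q N‖ := by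
        refine norm_sum_le_of_le _ fun l _ => norm_sum_le_of_le _ fun k _ => ?_
        rw [norm_mul]
        exact mul_le_mul_of_nonneg_left (norm_det_mixedRows_le_norm_mixedMinors _ _ _ _)
          (norm_nonneg _)
    _ = (∑ i ∈ S.image σ, ∑ k, ‖B i k‖) * ‖mixedMinors S q N‖ := by
        rw [Finset.sum_image hσ]
        simp only [Finset.sum_mul]
    _ ≤ entrySum B * ‖mixedMinors S q N‖ := by
        refine mul_le_mul_of_nonneg_right ?_ (norm_nonneg _)
        exact Finset.sum_le_univ_sum_of_nonneg fun i => Finset.sum_nonneg fun k _ => norm_nonneg _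

theorem norm_mixedMinors_le {a : J → ℂ} {P M : ℝ → Matrix J J ℂ} (hP : EntryIntegrable P)
    (hM : IsMatrixSolution (fun t => Matrix.diagonal a + P t) M) {ω : ℝ}
    (hω : ∀ T : Finset J, (∑ j ∈ T, a j).re ≤ ω) (S : Finset J) (q : J → J → ℂ) {t₀ t₁ : ℝ}
    (h₀ : 0 ≤ t₀) (h₀₁ : t₀ ≤ t₁) (h₁ : t₁ ≤ 1) :
    ‖mixedMinors S q (M t₁)‖ ≤
      Real.exp (ω * (t₁ - t₀) + ∫ t in t₀..t₁, entrySum (P t)) * ‖mixedMinors S q (M t₀)‖ := by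
  have hsub : uIcc t₀ t₁ ⊆ uIcc (0 : ℝ) 1 := by
    rw [uIcc_of_le h₀₁, uIcc_of_le zero_le_one]
    exact Icc_subset_Icc h₀ h₁
  have hac := fun σ : J → J => (hM.ac_det_mixedRows S q σ).mono hsub
  refine norm_le_exp_mul_norm (y := fun t => mixedMinors S q (M t))
    (s := fun σ : {σ : J → J // InjOn σ S} => ∑ l ∈ S, a (σ.1 l))
    (g := fun σ t => ∑ l ∈ S, ∑ k, P t (σ.1 l) k *
      (mixedRows S q (Function.update σ.1 l k) (M t)).det)
    h₀₁ (fun σ => ?_) (fun σ => hac σ) (fun σ => ?_) (fun σ => ?_)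
    (hP.entrySum.mono_set hsub) (fun t => entrySum_nonneg _)
    fun σ t => norm_sum_mul_det_mixedRows_le _ _ _ _ σ.2
  · rw [← Finset.sum_image (f := a) σ.2]
    exact hω _
  · have h_int : IntervalIntegrable (∑ l ∈ S, ∑ k, fun t => P t (σ.1 l) k *
        (mixedRows S q (Function.update σ.1 l k) (M t)).det) volume t₀ t₁ :=
      IntervalIntegrable.sum _ fun l _ => IntervalIntegrable.sum _ fun k _ =>
        ((hP _ _).mono_set hsub).mul_continuousOn (hac _).continuousOn
    simpa only [Finset.sum_fn] using h_int
  · filter_upwards [hM.2] with t ht htm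
    exact hasDerivAt_det_mixedRows (ht (by simpa only [uIcc_of_le zero_le_one] using hsub htm))
      S q σ

theorem norm_det_mixedRows_le_of_forall {a : J → ℂ} {P M : ℝ → Matrix J J ℂ}
    (hP : EntryIntegrable P) (hM : IsMatrixSolution (fun t => Matrix.diagonal a + P t) M) {ω : ℝ}
    (hω : ∀ T : Finset J, (∑ j ∈ T, a j).re ≤ ω) {S : Finset J} {q : J → J → ℂ} {t₀ t₁ : ℝ}
    (h₀ : 0 ≤ t₀) (h₀₁ : t₀ ≤ t₁) (h₁ : t₁ ≤ 1) {C : ℝ}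
    (hC : ∀ σ, ‖(mixedRows S q σ (M t₀)).det‖ ≤ C) (σ : J → J) :
    ‖(mixedRows S q σ (M t₁)).det‖ ≤
      Real.exp (ω * (t₁ - t₀) + ∫ t in t₀..t₁, entrySum (P t)) * C :=
  (norm_det_mixedRows_le_norm_mixedMinors S q σ (M t₁)).trans <|
    (norm_mixedMinors_le hP hM hω S q h₀ h₀₁ h₁).trans <| by
      refine mul_le_mul_of_nonneg_left ?_ (Real.exp_pos _).le
      exact (pi_norm_le_iff_of_nonneg ((norm_nonneg _).trans (hC id))).2 fun τ => hC τ

theorem norm_det_rows_le {a : J → ℂ} {P M : ℝ → Matrix J J ℂ} (hP : EntryIntegrable P)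
    (hM : IsMatrixSolution (fun t => Matrix.diagonal a + P t) M) (hM0 : M 0 = 1) {ω : ℝ}
    (hω : ∀ T : Finset J, (∑ j ∈ T, a j).re ≤ ω) {x : ℝ} (hx : x ∈ Icc (0 : ℝ) 1)
    (f : J → J) (c : J → Fin 3) :
    ‖(Matrix.of fun j => M ((![0, x, 1] : Fin 3 → ℝ) (c j)) (f j)).det‖ ≤
      Real.exp (ω + ∫ t in (0 : ℝ)..1, entrySum (P t)) := by
  set S₁ : Finset J := {j | c j ≠ 0}
  set S₂ : Finset J := {j | c j = 2}
  set q₁ : J → J → ℂ := fun j => M 0 (f j)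
  set q₂ : J → J → ℂ := fun j => if c j = 0 then M 0 (f j) else M x (f j)
  have bound_zero : ∀ σ, ‖(mixedRows S₁ q₁ σ (M 0)).det‖ ≤ 1 := fun σ => by
    convert norm_det_rows_one_le fun j => if j ∈ S₁ then σ j else f j using 3
    ext j k
    simp only [mixedRows, q₁, hM0, Matrix.of_apply]
    by_cases hj : j ∈ S₁
    · rw [if_pos hj, if_pos hj]
    · rw [if_neg hj, if_neg hj]
  have bound_x := norm_det_mixedRows_le_of_forall hP hM hω le_rfl hx.1 hx.2 bound_zero
  have mixedRows_eq : ∀ σ, mixedRows S₂ q₂ σ (M x) =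
      mixedRows S₁ q₁ (fun j => if j ∈ S₂ then σ j else f j) (M x) := by
    intro σ
    ext j k
    simp only [mixedRows, S₁, S₂, q₁, q₂, Matrix.of_apply, Finset.mem_filter_univ]
    generalize c j = i
    fin_cases i <;> rfl
  have rows_eq : mixedRows S₂ q₂ f (M 1) =
      Matrix.of fun j => M ((![0, x, 1] : Fin 3 → ℝ) (c j)) (f j) := by
    ext j k
    simp only [mixedRows, S₂, q₂, Matrix.of_apply, Finset.mem_filter_univ]
    generalize c j = i
    fin_cases i <;> rfl
  have bound_one := norm_det_mixedRows_le_of_forall hP hM hω hx.1 hx.2 le_rfl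
    (fun σ => (congrArg (fun N => ‖Matrix.det N‖) (mixedRows_eq σ)).trans_le (bound_x _)) f
  rw [rows_eq, mul_one, ← Real.exp_add] at bound_one
  refine bound_one.trans_eq (congrArg Real.exp ?_)
  have h_int := hP.entrySum
  rw [← intervalIntegral.integral_add_adjacent_intervals (b := x)
    (h_int.mono_set (uIcc_subset_uIcc_left (by rwa [uIcc_of_le zero_le_one])))
    (h_int.mono_set (uIcc_subset_uIcc_right (by rwa [uIcc_of_le zero_le_one])))]
  ring

theorem norm_det_sum_smul_le {K : ℝ} {α : Type*} [Fintype α] (coef : J → α → ℂ) (ρ : α → J → ℂ)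
    (h : ∀ r : J → α, ‖(Matrix.of fun j => ρ (r j)).det‖ ≤ K) :
    ‖(Matrix.of fun j => ∑ s, coef j s • ρ s).det‖ ≤ (∑ r : J → α, ∏ j, ‖coef j (r j)‖) * K := by
  have expansion : (Matrix.of fun j => ∑ s, coef j s • ρ s).det =
      ∑ r : J → α, (∏ j, coef j (r j)) * (Matrix.of fun j => ρ (r j)).det := by
    refine (Matrix.detRowAlternating.toMultilinearMap.map_sum fun j s => coef j s • ρ s).trans ?_
    exact Finset.sum_congr rfl fun r _ =>
      Matrix.detRowAlternating.toMultilinearMap.map_smul_univ (fun j => coef j (r j)) _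
  rw [expansion, Finset.sum_mul]
  refine norm_sum_le_of_le _ fun r _ => ?_
  rw [norm_mul, norm_prod]
  exact mul_le_mul_of_nonneg_left (h r) (Finset.prod_nonneg fun _ _ => norm_nonneg _)

end Determinants

section QuotientGrowth

open Metric Filter Real InnerProductSpace

variable {R : ℝ} {u w z : ℂ}

/-- The product of `R` with `z - u` divided by the Blaschke-type factor of the disc of radius `R`
at `u`: it has the absolute value of `z - u` on the circle, but no zero in the disc. -/
noncomputable def reflectedFactor (R : ℝ) (u z : ℂ) : ℂ := (R ^ 2 - (starRingEnd ℂ) u * z) / R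

theorem differentiable_reflectedFactor (R : ℝ) (u : ℂ) :
    Differentiable ℂ (reflectedFactor R u) := by
  unfold reflectedFactor
  fun_prop

theorem reflectedFactor_ne_zero (hu : u ∈ ball (0 : ℂ) R) (hz : z ∈ closedBall (0 : ℂ) R) :
    reflectedFactor R u z ≠ 0 := by
  have hR : 0 < R := pos_of_mem_ball hu
  rw [mem_ball_zero_iff] at hu
  rw [mem_closedBall_zero_iff] at hz
  refine div_ne_zero (fun h => ?_) (by exact_mod_cast hR.ne')
  have hnorm := congrArg norm (sub_eq_zero.1 h)
  rw [norm_mul, RCLike.norm_conj, norm_pow, Complex.norm_real, Real.norm_of_nonneg hR.le] at hnorm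
  nlinarith [norm_nonneg z, norm_nonneg u]

theorem norm_reflectedFactor_of_mem_sphere (hu : u ∈ ball (0 : ℂ) R)
    (hz : z ∈ sphere (0 : ℂ) R) : ‖reflectedFactor R u z‖ = ‖z - u‖ := by
  have hzu : z - u ≠ 0 := sub_ne_zero.2 (by
    rintro rfl
    exact sphere_disjoint_ball.le_bot ⟨hz, hu⟩)
  have hone := Complex.norm_canonicalFactor_eval_circle_eq_one hu hz
  rw [Complex.canonicalFactor_apply, ← div_div, norm_div,
    div_eq_one_iff_eq (norm_ne_zero_iff.2 hzu)] at hone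
  exact hone

theorem norm_sub_le_norm_reflectedFactor (hu : u ∈ ball (0 : ℂ) R) (hw : w ∈ ball (0 : ℂ) R) :
    ‖w - u‖ ≤ ‖reflectedFactor R u w‖ := by
  have hR : 0 < R := pos_of_mem_ball hu
  rw [mem_ball_zero_iff] at hu hw
  rw [reflectedFactor, norm_div, Complex.norm_real, Real.norm_of_nonneg hR.le, le_div_iff₀ hR]
  refine le_of_sq_le_sq ?_ (norm_nonneg _)
  have hu2 : ‖u‖ ^ 2 ≤ R ^ 2 := by gcongr
  have hw2 : ‖w‖ ^ 2 ≤ R ^ 2 := by gcongr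
  rw [← Complex.normSq_eq_norm_sq, Complex.normSq_apply] at hu2 hw2
  rw [mul_pow, ← Complex.normSq_eq_norm_sq, ← Complex.normSq_eq_norm_sq]
  simp only [Complex.normSq_apply, sub_re, sub_im, mul_re, mul_im, conj_re, conj_im, ← ofReal_pow,
    ofReal_re, ofReal_im]
  nlinarith [mul_nonneg (sub_nonneg.2 hu2) (sub_nonneg.2 hw2)]

theorem log_norm_sub_le_circleAverage (hw : w ∈ ball (0 : ℂ) R)
    (hu : u ∈ closedBall (0 : ℂ) R) (hwu : w ≠ u) :
    Real.log ‖w - u‖ ≤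
      circleAverage ((Complex.re ∘ herglotzRieszKernel 0 w) • fun z => Real.log ‖z - u‖) 0 R := by
  rcases (mem_closedBall_zero_iff.1 hu).eq_or_lt with h | h
  · exact (circleAverage_re_herglotzRieszKernel_mul_log (mem_sphere_zero_iff_norm.2 h) hw).ge
  have hub : u ∈ ball (0 : ℂ) R := mem_ball_zero_iff.2 h
  have hharm : HarmonicOnNhd (fun z => Real.log ‖reflectedFactor R u z‖) (closedBall 0 R) :=
    fun z hz => ((differentiable_reflectedFactor R u).analyticAt z).harmonicAt_log_norm
      (reflectedFactor_ne_zero hub hz)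
  calc Real.log ‖w - u‖ ≤ Real.log ‖reflectedFactor R u w‖ :=
        Real.log_le_log (norm_pos_iff.2 (sub_ne_zero.2 hwu))
          (norm_sub_le_norm_reflectedFactor hub hw)
    _ = circleAverage ((Complex.re ∘ herglotzRieszKernel 0 w) •
          fun z => Real.log ‖reflectedFactor R u z‖) 0 R :=
        (hharm.circleAverage_re_herglotzRieszKernel_smul hw).symm
    _ = _ := circleAverage_congr_sphere fun z hz => by
        rw [abs_of_pos (pos_of_mem_ball hw)] at hz
        simp only [Pi.smul_apply', norm_reflectedFactor_of_mem_sphere hub hz]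

theorem circleIntegrable_kernel_smul (hw : w ∈ ball (0 : ℂ) R) {f : ℂ → ℝ}
    (hf : CircleIntegrable f 0 R) :
    CircleIntegrable ((Complex.re ∘ herglotzRieszKernel 0 w) • f) 0 R :=
  hf.continuousOn_smul
    (Complex.continuous_re.comp_continuousOn (continuousOn_herglotzRieszKernel_sphere hw))

theorem finsum_intCast_smul_eq_sum {ι V : Type*} [AddCommGroup V] [Module ℝ V] {D : ι → ℤ}
    (hD : D.support.Finite) (f : ι → V) :
    ∑ᶠ i, (D i : ℝ) • f i = ∑ i ∈ hD.toFinset, (D i : ℝ) • f i :=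
  finsum_eq_sum_of_support_subset _ fun i hi => by
    simpa using left_ne_zero_of_smul (Function.mem_support.1 hi)

theorem exists_log_norm_eq_sum_add {f : ℂ → ℂ} (hf : AnalyticOnNhd ℂ f (closedBall 0 R))
    (hw : w ∈ ball (0 : ℂ) R) (hfw : f w ≠ 0) :
    ∃ (Z : Finset ℂ) (m : ℂ → ℝ) (g : ℂ → ℂ),
      (∀ u ∈ Z, 0 ≤ m u ∧ u ∈ closedBall 0 R ∧ w ≠ u) ∧
      (∀ z ∈ closedBall 0 R, AnalyticAt ℂ g z ∧ g z ≠ 0) ∧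
      (fun z => Real.log ‖f z‖) =ᶠ[codiscreteWithin (closedBall 0 R)]
        (fun z => ∑ u ∈ Z, m u * Real.log ‖z - u‖ + Real.log ‖g z‖) ∧
      Real.log ‖f w‖ = ∑ u ∈ Z, m u * Real.log ‖w - u‖ + Real.log ‖g w‖ := by
  have hwc : w ∈ closedBall (0 : ℂ) R := ball_subset_closedBall hw
  have order_w : analyticOrderAt f w = 0 := (hf w hwc).analyticOrderAt_eq_zero.2 hfw
  set D := MeromorphicOn.divisor f (closedBall (0 : ℂ) R)
  have hDfin : D.support.Finite := D.finiteSupport (isCompact_closedBall 0 R)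
  have hDw : D w = 0 := by
    rw [MeromorphicOn.AnalyticOnNhd.divisor_apply hf hwc, order_w]
    rfl
  have order_ne_top : ∀ u : closedBall (0 : ℂ) R, meromorphicOrderAt f u ≠ ⊤ := by
    refine (hf.meromorphicOn.exists_meromorphicOrderAt_ne_top_iff_forall
      ⟨⟨w, hwc⟩, (convex_closedBall (0 : ℂ) R).isPreconnected⟩).1 ⟨⟨w, hwc⟩, ?_⟩
    rw [(hf w hwc).meromorphicOrderAt_eq, order_w]
    simp
  obtain ⟨g, hgA, hgne, hfg⟩ := hf.meromorphicOn.extract_zeros_poles order_ne_top hDfin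
  have hacc : AccPt w (𝓟 (closedBall (0 : ℂ) R)) :=
    accPt_iff_frequently_nhdsNE.mpr (compl_notMem (mem_nhdsWithin_of_mem_nhds
      (mem_of_superset (isOpen_ball.mem_nhds hw) ball_subset_closedBall)))
  have log_w := MeromorphicOn.log_norm_meromorphicTrailingCoeffAt_extract_zeros_poles hDfin hwc
    hacc (hf w hwc).meromorphicAt (hgA w hwc) (hgne ⟨w, hwc⟩) hfg
  rw [(hf w hwc).meromorphicTrailingCoeffAt_of_ne_zero hfw] at log_w
  refine ⟨hDfin.toFinset, fun u => D u, g, fun u hu => ?_, fun z hz => ⟨hgA z hz, hgne ⟨z, hz⟩⟩,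
    ?_, log_w.trans (congrArg (· + _) (finsum_intCast_smul_eq_sum hDfin _))⟩
  · have hu' : D u ≠ 0 := by simpa using hu
    exact ⟨Int.cast_nonneg (MeromorphicOn.AnalyticOnNhd.divisor_nonneg hf u),
      D.supportWithinDomain hu', by rintro rfl; exact hu' hDw⟩
  · filter_upwards [MeromorphicOn.extract_zeros_poles_log hgne hfg] with z hz
    have hsum := congrFun (finsum_intCast_smul_eq_sum hDfin fun u (z : ℂ) => Real.log ‖z - u‖) z
    rw [Finset.sum_apply] at hsum
    exact hz.trans (congrArg (· + _) hsum)

theorem log_norm_le_circleAverage_kernel {f : ℂ → ℂ} (hf : AnalyticOnNhd ℂ f (closedBall 0 R))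
    (hw : w ∈ ball (0 : ℂ) R) (hfw : f w ≠ 0) :
    Real.log ‖f w‖ ≤
      circleAverage ((Complex.re ∘ herglotzRieszKernel 0 w) • fun z => Real.log ‖f z‖) 0 R := by
  have hR : 0 < R := pos_of_mem_ball hw
  obtain ⟨Z, m, g, hZ, hg, log_f, log_w⟩ := exists_log_norm_eq_sum_add hf hw hfw
  set k : ℂ → ℝ := Complex.re ∘ herglotzRieszKernel 0 w
  have hint_sub : ∀ u : ℂ, CircleIntegrable (k • fun z => Real.log ‖z - u‖) 0 R := fun u =>
    circleIntegrable_kernel_smul hw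
      (analyticOnNhd_id.sub analyticOnNhd_const).meromorphicOn.circleIntegrable_log_norm
  have hint_g : CircleIntegrable (k • fun z => Real.log ‖g z‖) 0 R :=
    circleIntegrable_kernel_smul hw (MeromorphicOn.circleIntegrable_log_norm fun z hz =>
      (hg z (sphere_subset_closedBall (by rwa [abs_of_pos hR] at hz))).1.meromorphicAt)
  have average_g : circleAverage (k • fun z => Real.log ‖g z‖) 0 R = Real.log ‖g w‖ :=
    HarmonicOnNhd.circleAverage_re_herglotzRieszKernel_smul
      (fun z hz => (hg z hz).1.harmonicAt_log_norm (hg z hz).2) hw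
  calc Real.log ‖f w‖
      ≤ ∑ u ∈ Z, m u * circleAverage (k • fun z => Real.log ‖z - u‖) 0 R + Real.log ‖g w‖ := by
        rw [log_w]
        gcongr with u hu
        · exact (hZ u hu).1
        · exact log_norm_sub_le_circleAverage hw (hZ u hu).2.1 (hZ u hu).2.2
    _ = circleAverage ((∑ u ∈ Z, m u • k • fun z => Real.log ‖z - u‖) +
          k • fun z => Real.log ‖g z‖) 0 R := by
        rw [circleAverage_add (CircleIntegrable.sum _ fun u _ => (hint_sub u).const_smul) hint_g,
          circleAverage_sum fun u _ => (hint_sub u).const_smul, average_g]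
        simp only [circleAverage_smul, smul_eq_mul]
    _ = circleAverage (k • fun z => Real.log ‖f z‖) 0 R := by
        refine circleAverage_congr_codiscreteWithin ?_ hR.ne'
        rw [abs_of_pos hR]
        filter_upwards [codiscreteWithin_mono sphere_subset_closedBall log_f] with z hz
        simp only [Pi.smul_apply', Pi.smul_apply, Pi.mul_apply, Pi.add_apply, hz, Finset.sum_apply,
          smul_eq_mul, mul_add, Finset.mul_sum, mul_left_comm (k z)]

theorem log_norm_zero_le_circleAverage (hR : 0 < R) {f : ℂ → ℂ}
    (hf : AnalyticOnNhd ℂ f (closedBall 0 R)) (hf0 : f 0 ≠ 0) :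
    Real.log ‖f 0‖ ≤ circleAverage (fun z => Real.log ‖f z‖) 0 R := by
  refine (log_norm_le_circleAverage_kernel hf (mem_ball_self hR) hf0).trans_eq
    (circleAverage_congr_sphere fun z hz => ?_)
  have hz0 : z ≠ 0 := ne_of_mem_sphere hz (abs_pos.2 hR.ne').ne'
  simp [herglotzRieszKernel_def, hz0]

theorem re_herglotzRieszKernel_mem_Icc (hw : ‖w‖ ≤ R / 2) (hz : z ∈ sphere (0 : ℂ) R)
    (hR : 0 < R) : (herglotzRieszKernel 0 w z).re ∈ Icc (0 : ℝ) 3 := by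
  have hwb : w ∈ ball (0 : ℂ) R := mem_ball_zero_iff.2 (by linarith)
  refine ⟨le_trans ?_ (le_re_herglotzRieszKernel hz hwb),
    (re_herglotzRieszKernel_le hz hwb).trans ?_⟩
  · rw [sub_zero]
    exact div_nonneg (by linarith [norm_nonneg w]) (by linarith [norm_nonneg w])
  · rw [sub_zero, div_le_iff₀ (by linarith)]
    linarith

theorem circleAverage_kernel_smul_log_eq {F Δ : ℂ → ℂ} (hF : Differentiable ℂ F)
    (hΔ : Differentiable ℂ Δ) (hR : R ≠ 0) (hΔ0 : Δ 0 ≠ 0) (hFw : F w ≠ 0) (k : ℂ → ℝ) :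
    circleAverage (k • fun z => Real.log ‖F z‖) 0 R =
      circleAverage (k • fun z => Real.log ‖Δ z * F z‖ - Real.log ‖Δ z‖) 0 R := by
  have eventually_ne : ∀ {f : ℂ → ℂ} {x : ℂ}, Differentiable ℂ f → f x ≠ 0 →
      ∀ᶠ z in codiscreteWithin (sphere (0 : ℂ) |R|), f z ≠ 0 := fun {f x} hf hx =>
    codiscreteWithin_mono (subset_univ _)
      (AnalyticOnNhd.preimage_zero_mem_codiscrete (x := x) (fun z _ => hf.analyticAt z) hx)
  refine circleAverage_congr_codiscreteWithin ?_ hR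
  filter_upwards [eventually_ne hF hFw, eventually_ne hΔ hΔ0] with z hFz hΔz
  simp only [Pi.smul_apply', norm_mul]
  rw [Real.log_mul (norm_ne_zero_iff.2 hΔz) (norm_ne_zero_iff.2 hFz), add_sub_cancel_left]

theorem log_norm_quotient_le {F Δ : ℂ → ℂ} (hF : Differentiable ℂ F) (hΔ : Differentiable ℂ Δ)
    {M : ℝ} (hR : 0 < R) (hM : 1 ≤ M) (hΔ0 : Δ 0 ≠ 0) (hΔM : ∀ z, ‖z‖ = R → ‖Δ z‖ ≤ M)
    (hG : ∀ z, ‖z‖ = R → ‖Δ z * F z‖ ≤ M) (hw : ‖w‖ ≤ R / 2) (hFw : F w ≠ 0) :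
    Real.log ‖F w‖ ≤ 3 * (Real.log M - Real.log ‖Δ 0‖) := by
  have hwb : w ∈ ball (0 : ℂ) R := mem_ball_zero_iff.2 (by linarith)
  have hint_log : ∀ {f : ℂ → ℂ}, Differentiable ℂ f →
      CircleIntegrable (fun z => Real.log ‖f z‖) 0 R := fun hf =>
    MeromorphicOn.circleIntegrable_log_norm fun z _ => (hf.analyticAt z).meromorphicAt
  have hint_sub : CircleIntegrable (fun z => Real.log M - Real.log ‖Δ z‖) 0 R :=
    (circleIntegrable_const _ _ _).sub (hint_log hΔ)
  have log_le : ∀ {x : ℂ}, ‖x‖ ≤ M → Real.log ‖x‖ ≤ Real.log M := by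
    intro x hx
    rcases eq_or_ne x 0 with rfl | hx0
    · simpa using Real.log_nonneg hM
    · exact Real.log_le_log (norm_pos_iff.2 hx0) hx
  calc Real.log ‖F w‖
      ≤ circleAverage ((Complex.re ∘ herglotzRieszKernel 0 w) • fun z => Real.log ‖F z‖) 0 R :=
        log_norm_le_circleAverage_kernel (fun z _ => hF.analyticAt z) hwb hFw
    _ = circleAverage ((Complex.re ∘ herglotzRieszKernel 0 w) •
          fun z => Real.log ‖Δ z * F z‖ - Real.log ‖Δ z‖) 0 R :=
        circleAverage_kernel_smul_log_eq hF hΔ hR.ne' hΔ0 hFw _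
    _ ≤ circleAverage (fun z => (3 : ℝ) • (Real.log M - Real.log ‖Δ z‖)) 0 R := by
        refine circleAverage_mono (circleIntegrable_kernel_smul hwb
          ((hint_log (hΔ.mul hF)).sub (hint_log hΔ))) hint_sub.const_smul fun z hz => ?_
        rw [abs_of_pos hR] at hz
        have hzR : ‖z‖ = R := mem_sphere_zero_iff_norm.1 hz
        obtain ⟨kernel_nonneg, kernel_le⟩ := re_herglotzRieszKernel_mem_Icc hw hz hR
        exact (mul_le_mul_of_nonneg_left (sub_le_sub_right (log_le (hG z hzR)) _)
          kernel_nonneg).trans (mul_le_mul_of_nonneg_right kernel_le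
            (sub_nonneg.2 (log_le (hΔM z hzR))))
    _ = 3 * (Real.log M - circleAverage (fun z => Real.log ‖Δ z‖) 0 R) := by
        rw [circleAverage_fun_smul, smul_eq_mul, circleAverage_fun_sub
          (circleIntegrable_const _ _ _) (hint_log hΔ), circleAverage_const]
    _ ≤ _ := by
        gcongr
        exact log_norm_zero_le_circleAverage hR (fun z _ => hΔ.analyticAt z) hΔ0

theorem exists_exp_bound_of_mul {F Δ : ℂ → ℂ} (hF : Differentiable ℂ F) (hΔ : Differentiable ℂ Δ)
    {c : ℂ} (hc : Δ c ≠ 0) {A B : ℝ} (hA : 0 ≤ A) (hB : 0 ≤ B)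
    (hΔM : ∀ z, ‖Δ z‖ ≤ Real.exp (A * ‖z‖ + B))
    (hG : ∀ z, ‖Δ z * F z‖ ≤ Real.exp (A * ‖z‖ + B)) :
    ∃ A' B', 0 ≤ A' ∧ ∀ z, ‖F z‖ ≤ Real.exp (A' * ‖z‖ + B') := by
  refine ⟨6 * A, 3 * (A * (3 * ‖c‖ + 2) + B - Real.log ‖Δ c‖), by positivity, fun z => ?_⟩
  rcases eq_or_ne (F z) 0 with hz | hz
  · rw [hz, norm_zero]
    exact (Real.exp_pos _).le
  set R := 2 * (‖z - c‖ + 1)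
  have hRpos : 0 < R := by positivity
  have exponent_le : ∀ w : ℂ, ‖w‖ = R → A * ‖w + c‖ + B ≤ A * (R + ‖c‖) + B := fun w hw => by
    gcongr
    exact hw ▸ norm_add_le _ _
  have log_le := log_norm_quotient_le (F := fun w => F (w + c)) (Δ := fun w => Δ (w + c))
    (w := z - c) (hF.comp (differentiable_id.add_const c)) (hΔ.comp (differentiable_id.add_const c))
    hRpos (M := Real.exp (A * (R + ‖c‖) + B)) (Real.one_le_exp (by positivity)) (by simpa using hc)
    (fun w hw => (hΔM _).trans (Real.exp_le_exp.2 (exponent_le w hw)))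
    (fun w hw => (hG _).trans (Real.exp_le_exp.2 (exponent_le w hw)))
    (by linarith) (by simpa using hz)
  simp only [sub_add_cancel, zero_add, Real.log_exp] at log_le
  rw [← Real.exp_log (norm_pos_iff.2 hz)]
  refine Real.exp_le_exp.2 (log_le.trans ?_)
  have hRle : R ≤ 2 * ‖z‖ + 2 * ‖c‖ + 2 := by linarith [norm_sub_le z c]
  nlinarith

end QuotientGrowth

section Rays

open Filter Asymptotics

theorem exists_stdSimplex_of_mem_convexHull_range {ι E : Type*} [Fintype ι] [AddCommGroup E]
    [Module ℝ E] {z : ι → E} {x : E} (hx : x ∈ convexHull ℝ (range z)) :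
    ∃ t ∈ stdSimplex ℝ ι, ∑ i, t i • z i = x := by
  classical
  have hconv : Convex ℝ (Fintype.linearCombination ℝ z '' stdSimplex ℝ ι) :=
    (convex_stdSimplex ℝ ι).linear_image _
  refine convexHull_min ?_ hconv hx
  rintro - ⟨i, rfl⟩
  exact ⟨Pi.single i 1, single_mem_stdSimplex ℝ i, by simp⟩

theorem exists_nonneg_sum_smul_eq {ι E : Type*} [Fintype ι] [AddCommGroup E] [Module ℝ E]
    [TopologicalSpace E] [ContinuousSMul ℝ E] {z : ι → E}
    (h0 : (0 : E) ∈ interior (convexHull ℝ (range z))) (x : E) :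
    ∃ i, ∃ c : ι → ℝ, (∀ j, 0 ≤ c j) ∧ c i = 0 ∧ ∑ j, c j • z j = x := by
  obtain ⟨t, ⟨ht0, ht1⟩, hzero⟩ := exists_stdSimplex_of_mem_convexHull_range (interior_subset h0)
  obtain ⟨r, hr, hrx⟩ : ∃ r : ℝ, 0 < r ∧ r • x ∈ convexHull ℝ (range z) := by
    have hcont : Tendsto (fun r : ℝ => r • x) (nhds 0) (nhds 0) :=
      Continuous.tendsto' (by fun_prop) _ _ (zero_smul ℝ x)
    have hev : ∀ᶠ r in nhds (0 : ℝ), r • x ∈ convexHull ℝ (range z) :=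
      hcont.eventually (mem_interior_iff_mem_nhds.1 h0)
    exact ((eventually_mem_nhdsWithin (s := Ioi (0 : ℝ))).and
      (hev.filter_mono nhdsWithin_le_nhds)).exists
  obtain ⟨c, ⟨hc0, -⟩, hc⟩ := exists_stdSimplex_of_mem_convexHull_range hrx
  obtain ⟨k, hk⟩ : ∃ k, 0 < t k := by
    by_contra! h
    linarith [Finset.sum_nonpos fun i (_ : i ∈ Finset.univ) => h i]
  -- Subtracting the largest admissible multiple of `∑ j, t j • z j = 0` kills one coefficient.
  obtain ⟨i, hi, hmin⟩ := Finset.exists_min_image (Finset.univ.filter fun j => 0 < t j)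
    (fun j => c j / t j) ⟨k, by simpa using hk⟩
  rw [Finset.mem_filter_univ] at hi
  refine ⟨i, fun j => r⁻¹ * (c j - c i / t i * t j), fun j => mul_nonneg (inv_nonneg.2 hr.le) ?_,
    by simp only [div_mul_cancel₀ _ hi.ne', sub_self, mul_zero], ?_⟩
  · rcases (ht0 j).eq_or_lt with hj | hj
    · simpa [← hj] using hc0 j
    · have hle := hmin j (by simpa using hj)
      rw [le_div_iff₀ hj] at hle
      linarith
  · simp only [mul_smul, sub_smul, ← Finset.smul_sum, Finset.sum_sub_distrib, hc, hzero, smul_zero,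
      sub_zero]
    rw [inv_smul_smul₀ hr.ne']

theorem exists_ne_zero_of_zero_mem_interior {ι E : Type*} [Finite ι] [AddCommGroup E]
    [Module ℝ E] [TopologicalSpace E] [ContinuousSMul ℝ E] [Nontrivial E] {z : ι → E}
    (h0 : (0 : E) ∈ interior (convexHull ℝ (range z))) : ∃ i, z i ≠ 0 := by
  have := Fintype.ofFinite ι
  by_contra! hz
  obtain ⟨x, hx⟩ := exists_ne (0 : E)
  obtain ⟨_, c, -, -, hc⟩ := exists_nonneg_sum_smul_eq h0 x
  exact hx (by simpa [hz] using hc.symm)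

theorem arg_add_mul_mem_Icc {w : ℂ} (hw : 0 < w.im) {α β : ℝ} (hα : 0 ≤ α) (hβ : 0 ≤ β) :
    arg (α + β * w) ∈ Icc 0 (arg w) := by
  set v : ℂ := α + β * w
  have hv_im : v.im = β * w.im := by simp [v]
  have hv_nonneg : 0 ≤ arg v := arg_nonneg_iff.2 (hv_im ▸ mul_nonneg hβ hw.le)
  refine ⟨hv_nonneg, ?_⟩
  by_contra! hlt
  have hw_pos : 0 < arg w := (arg_nonneg_iff.2 hw.le).lt_of_ne fun h =>
    hw.ne' (arg_eq_zero_iff.1 h.symm).2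
  have hsin : 0 < Real.sin (arg v - arg w) :=
    Real.sin_pos_of_pos_of_lt_pi (by linarith) (by linarith [arg_le_pi v])
  have hcross : ‖v‖ * ‖w‖ * Real.sin (arg v - arg w) = -(α * w.im) := by
    calc ‖v‖ * ‖w‖ * Real.sin (arg v - arg w)
        = (‖v‖ * Real.sin (arg v)) * (‖w‖ * Real.cos (arg w)) -
          (‖v‖ * Real.cos (arg v)) * (‖w‖ * Real.sin (arg w)) := by
          rw [Real.sin_sub]
          ring
      _ = v.im * w.re - v.re * w.im := by
          rw [norm_mul_cos_arg v, norm_mul_sin_arg v, norm_mul_cos_arg w, norm_mul_sin_arg w]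
      _ = -(α * w.im) := by
          simp only [v, add_im, add_re, ofReal_im, ofReal_re, re_ofReal_mul, im_ofReal_mul]
          ring
  have hw0 : w ≠ 0 := fun h => by simp [h] at hw
  have hv0 : v ≠ 0 := fun h => by simp [h] at hlt; linarith
  have hprod : 0 < ‖v‖ * ‖w‖ * Real.sin (arg v - arg w) := by positivity
  linarith [mul_nonneg hα hw.le]

variable {F : ℂ → ℂ} {A B C : ℝ}

theorem norm_le_of_arg_mem_Icc (hF : Differentiable ℂ F) (hA : 0 ≤ A)
    (hexp : ∀ z, ‖F z‖ ≤ Real.exp (A * ‖z‖ + B)) {θ : ℝ} (hθ0 : 0 < θ) (hθπ : θ < Real.pi)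
    (hlower : ∀ r : ℝ, 0 ≤ r → ‖F r‖ ≤ C)
    (hupper : ∀ r : ℝ, 0 ≤ r → ‖F (r * cexp (θ * I))‖ ≤ C) {v : ℂ} (hv : arg v ∈ Icc 0 θ) :
    ‖F v‖ ≤ C := by
  rcases eq_or_ne v 0 with rfl | hv0
  · simpa using hlower 0 le_rfl
  rw [← Complex.exp_log hv0]
  refine PhragmenLindelof.horizontal_strip (f := fun ζ => F (cexp ζ)) (a := 0) (b := θ)
    (hF.comp Complex.differentiable_exp).diffContOnCl ⟨1, ?_, A, ?_⟩ (fun ζ hζ => ?_)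
    (fun ζ hζ => ?_) (by simpa only [log_im] using hv.1) (by simpa only [log_im] using hv.2)
  · rwa [sub_zero, lt_div_iff₀ hθ0, one_mul]
  · refine IsBigO.of_bound (Real.exp B) (Eventually.of_forall fun ζ => ?_)
    rw [Real.norm_of_nonneg (Real.exp_pos _).le, ← Real.exp_add]
    refine (hexp _).trans (Real.exp_le_exp.2 ?_)
    rw [Complex.norm_exp, one_mul, add_comm]
    gcongr
    exact le_abs_self _
  · rw [← re_add_im ζ, hζ, ofReal_zero, zero_mul, add_zero, ← ofReal_exp]
    exact hlower _ (Real.exp_pos _).le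
  · rw [← re_add_im ζ, hζ, Complex.exp_add, ← ofReal_exp]
    exact hupper _ (Real.exp_pos _).le

theorem norm_le_on_cone_of_im_pos (hF : Differentiable ℂ F) (hA : 0 ≤ A)
    (hexp : ∀ z, ‖F z‖ ≤ Real.exp (A * ‖z‖ + B)) {p q : ℂ} (hpq : 0 < (q / p).im)
    (hFp : ∀ r : ℝ, 0 ≤ r → ‖F (r * p)‖ ≤ C) (hFq : ∀ r : ℝ, 0 ≤ r → ‖F (r * q)‖ ≤ C)
    {α β : ℝ} (hα : 0 ≤ α) (hβ : 0 ≤ β) : ‖F (α * p + β * q)‖ ≤ C := by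
  have hp : p ≠ 0 := fun h => by simp [h] at hpq
  obtain ⟨w, rfl⟩ : ∃ w, q = w * p := ⟨q / p, (div_mul_cancel₀ _ hp).symm⟩
  rw [mul_div_cancel_right₀ _ hp] at hpq
  have hw0 : (‖w‖ : ℂ) ≠ 0 := ofReal_ne_zero.2 (norm_ne_zero_iff.2 fun h => by simp [h] at hpq)
  rw [show α * p + β * (w * p) = (α + β * w) * p by ring]
  refine norm_le_of_arg_mem_Icc (F := fun z => F (z * p)) (A := A * ‖p‖) (B := B) (θ := arg w)
    (hF.comp (differentiable_id.mul_const p)) (by positivity) (fun z => ?_)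
    ((arg_nonneg_iff.2 hpq.le).lt_of_ne fun h => hpq.ne' (arg_eq_zero_iff.1 h.symm).2)
    ((arg_le_pi w).lt_of_ne fun h => hpq.ne' (arg_eq_pi_iff.1 h).2) hFp (fun r hr => ?_)
    (arg_add_mul_mem_Icc hpq hα hβ)
  · exact (hexp _).trans_eq (by rw [norm_mul]; ring_nf)
  · have hray : r * cexp (arg w * I) * p = ((r / ‖w‖ : ℝ) : ℂ) * (w * p) := by
      have hpolar : ‖w‖ * cexp (arg w * I) = w := norm_mul_exp_arg_mul_I w
      rw [ofReal_div]
      field_simp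
      linear_combination r * hpolar
    rw [hray]
    exact hFq _ (by positivity)

theorem norm_le_on_cone (hF : Differentiable ℂ F) (hA : 0 ≤ A)
    (hexp : ∀ z, ‖F z‖ ≤ Real.exp (A * ‖z‖ + B)) {p q : ℂ}
    (hFp : ∀ r : ℝ, 0 ≤ r → ‖F (r * p)‖ ≤ C) (hFq : ∀ r : ℝ, 0 ≤ r → ‖F (r * q)‖ ≤ C)
    {α β : ℝ} (hα : 0 ≤ α) (hβ : 0 ≤ β) : ‖F (α * p + β * q)‖ ≤ C := by
  rcases lt_trichotomy (q / p).im 0 with him | him | him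
  · rw [add_comm]
    refine norm_le_on_cone_of_im_pos hF hA hexp ?_ hFq hFp hβ hα
    rw [← inv_div, inv_im]
    exact div_pos (neg_pos.2 him) (normSq_pos.2 fun h => by simp [h] at him)
  · rcases eq_or_ne p 0 with rfl | hp
    · simpa using hFq β hβ
    -- Here `p` and `q` are collinear, so that their cone is covered by the two rays.
    obtain ⟨s, rfl⟩ : ∃ s : ℝ, q = s * p :=
      ⟨(q / p).re, by rw [← div_eq_iff hp]; exact Complex.ext rfl him⟩
    rcases le_total 0 (α + β * s) with hs | hs
    · convert hFp _ hs using 3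
      push_cast
      ring
    · have hs0 : s < 0 ∨ α + β * s = 0 := by
        by_contra! h
        exact h.2 (le_antisymm hs (by nlinarith [mul_nonneg hβ h.1]))
      rcases hs0 with hs0 | hs0
      · convert hFq _ (div_nonneg_of_nonpos hs hs0.le) using 3
        have hsne : (s : ℂ) ≠ 0 := ofReal_ne_zero.2 hs0.ne
        push_cast
        field_simp
      · convert hFp 0 le_rfl using 3
        rw [← hs0]
        push_cast
        ring
  · exact norm_le_on_cone_of_im_pos hF hA hexp him hFp hFq hα hβ

theorem norm_le_of_three_rays {z : Fin 3 → ℂ} (h0 : (0 : ℂ) ∈ interior (convexHull ℝ (range z)))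
    (hF : Differentiable ℂ F) (hA : 0 ≤ A) (hexp : ∀ z, ‖F z‖ ≤ Real.exp (A * ‖z‖ + B))
    (hray : ∀ k, ∀ r : ℝ, 0 ≤ r → ‖F (r * z k)‖ ≤ C) (x : ℂ) : ‖F x‖ ≤ C := by
  obtain ⟨i, c, hc, hci, rfl⟩ := exists_nonneg_sum_smul_eq h0 x
  have cone_le : ∀ k l, ‖F (c k * z k + c l * z l)‖ ≤ C := fun k l =>
    norm_le_on_cone hF hA hexp (hray k) (hray l) (hc k) (hc l)
  rw [Fin.sum_univ_three]
  simp only [real_smul]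
  fin_cases i
  · simpa [show c 0 = 0 from hci] using cone_le 1 2
  · simpa [show c 1 = 0 from hci] using cone_le 0 2
  · simpa [show c 2 = 0 from hci] using cone_le 0 1

end Rays

section EntireQuotient

open Filter Topology

theorem eq_of_eventuallyEq_nhdsNE {E : Type*} [TopologicalSpace E] [T2Space E] {f g : ℂ → E}
    {μ : ℂ} (hf : ContinuousAt f μ) (hg : ContinuousAt g μ) (h : f =ᶠ[𝓝[≠] μ] g) : f μ = g μ :=
  tendsto_nhds_unique ((hf.tendsto.mono_left nhdsWithin_le_nhds).congr' h)
    (hg.tendsto.mono_left nhdsWithin_le_nhds)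

variable {Δ : ℂ → ℂ} {ν : ℂ}

theorem eventually_ne_zero_of_entire (hΔ : Differentiable ℂ Δ) (hν : Δ ν ≠ 0) (μ : ℂ) :
    ∀ᶠ x in 𝓝[≠] μ, Δ x ≠ 0 := by
  by_contra hfreq
  simp only [not_eventually, not_not] at hfreq
  have hzero : Δ = fun _ => 0 := AnalyticOnNhd.eq_of_frequently_eq (z₀ := μ)
    (fun x _ => hΔ.analyticAt x) (fun x _ => analyticAt_const) hfreq
  exact hν (congrFun hzero ν)

theorem exists_eq_pow_mul_of_entire (hΔ : Differentiable ℂ Δ) (hν : Δ ν ≠ 0) (μ : ℂ) :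
    ∃ (m : ℕ) (r : ℂ → ℂ), AnalyticAt ℂ r μ ∧ r μ ≠ 0 ∧
      ∀ᶠ x in 𝓝 μ, Δ x = (x - μ) ^ m * r x := by
  have hne : analyticOrderAt Δ μ ≠ ⊤ := by
    rw [Ne, analyticOrderAt_eq_top]
    intro hzero
    obtain ⟨x, hx, hx0⟩ := ((hzero.filter_mono nhdsWithin_le_nhds).and
      (eventually_ne_zero_of_entire hΔ hν μ)).exists
    exact hx0 hx
  obtain ⟨r, hr, hr0, hΔr⟩ := (hΔ.analyticAt μ).analyticOrderAt_ne_top.1 hne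
  exact ⟨_, r, hr, hr0, hΔr⟩

theorem exists_entire_quotient {G : ℂ → ℂ} (hG : Differentiable ℂ G) (hΔ : Differentiable ℂ Δ)
    (hν : Δ ν ≠ 0)
    (hdvd : ∀ μ, ∃ u : ℂ → ℂ, AnalyticAt ℂ u μ ∧ ∀ᶠ x in 𝓝[≠] μ, G x = Δ x * u x) :
    ∃ F : ℂ → ℂ, Differentiable ℂ F ∧ ∀ x, Δ x * F x = G x := by
  have hmer : MeromorphicOn (fun x => G x / Δ x) univ := fun x _ =>
    (hG.analyticAt x).meromorphicAt.div (hΔ.analyticAt x).meromorphicAt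
  have heq := fun x => hmer.toMeromorphicNFOn_eq_self_on_nhdsNE (mem_univ x)
  have hdiff : Differentiable ℂ (toMeromorphicNFOn (fun x => G x / Δ x) univ) := by
    intro x
    obtain ⟨u, hu, hux⟩ := hdvd x
    refine AnalyticAt.differentiableAt ?_
    rw [← (meromorphicNFOn_toMeromorphicNFOn _ univ
      (mem_univ x)).meromorphicOrderAt_nonneg_iff_analyticAt, meromorphicOrderAt_congr (heq x),
      meromorphicOrderAt_congr (f₂ := u)]
    · exact hu.meromorphicOrderAt_nonneg
    · filter_upwards [hux, eventually_ne_zero_of_entire hΔ hν x] with y hy hy0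
      rw [hy, mul_div_cancel_left₀ _ hy0]
  refine ⟨_, hdiff, fun x => ?_⟩
  refine eq_of_eventuallyEq_nhdsNE (f := fun x => Δ x * _) (hΔ.continuous.mul
    hdiff.continuous).continuousAt hG.continuous.continuousAt ?_
  filter_upwards [heq x, eventually_ne_zero_of_entire hΔ hν x] with y hy hy0
  rw [hy, mul_div_cancel₀ _ hy0]

end EntireQuotient

section CharacteristicPair

open Filter Topology

variable {H : Type*} [NormedAddCommGroup H] [NormedSpace ℂ H]

/-- `Δ` and `N` are entire, and `(T - μ)⁻¹ = Δ(μ)⁻¹ N(μ)` wherever `Δ(μ) ≠ 0`. For a boundary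
value problem `Δ` is the characteristic determinant. -/
structure IsCharacteristicPair (T : H →ₗ.[ℂ] H) (Δ : ℂ → ℂ) (N : ℂ → H →L[ℂ] H) : Prop where
  differentiable_det : Differentiable ℂ Δ
  differentiable_num : Differentiable ℂ N
  mem_graph : ∀ μ g, (N μ g, Δ μ • g + μ • N μ g) ∈ T.graph
  num_apply : ∀ μ y w, (y, w) ∈ T.graph → N μ (w - μ • y) = Δ μ • y

section KerPow

variable {E : Type*} [AddCommGroup E] [Module ℂ E] {T : E →ₗ.[ℂ] E} {μ : ℂ}

theorem mem_kerPow_succ {k : ℕ} {y : E} :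
    y ∈ kerPow T μ (k + 1) ↔ ∃ v ∈ kerPow T μ k, (y, v + μ • y) ∈ T.graph := by
  simp only [kerPow, Submodule.mem_map, Submodule.mem_comap, LinearPMap.mem_graph_iff]
  constructor
  · rintro ⟨x, hx, rfl⟩
    exact ⟨_, hx, x, rfl, by simp⟩
  · rintro ⟨v, hv, x, hx, hTx⟩
    refine ⟨x, ?_, hx⟩
    have hshift : (T.toFun - μ • T.domain.subtype) x = v := by
      change T x - μ • (x : E) = v
      rw [hTx, hx, add_sub_cancel_right]
    rwa [hshift]

variable (T μ)

theorem kerPow_le_succ (k : ℕ) : kerPow T μ k ≤ kerPow T μ (k + 1) := by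
  induction k with
  | zero => exact bot_le
  | succ k ih =>
    intro y hy
    obtain ⟨v, hv, hgraph⟩ := mem_kerPow_succ.1 hy
    exact mem_kerPow_succ.2 ⟨v, ih hv, hgraph⟩

theorem monotone_kerPow : Monotone (kerPow T μ) :=
  monotone_nat_of_le_succ (kerPow_le_succ T μ)

variable {T μ}

theorem mem_rootSubspace {y : E} : y ∈ rootSubspace T μ ↔ ∃ k, y ∈ kerPow T μ k :=
  Submodule.mem_iSup_of_directed _ (monotone_kerPow T μ).directed_le

theorem fg_kerPow (hfg : (kerPow T μ 1).FG) (k : ℕ) : (kerPow T μ k).FG := by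
  induction k with
  | zero => exact Submodule.fg_bot
  | succ k ih =>
    refine Submodule.FG.map _ (Submodule.fg_of_fg_map_of_fg_inf_ker
      (T.toFun - μ • T.domain.subtype) ?_ ?_)
    · exact Submodule.FG.of_le ih (Submodule.map_comap_le _ _)
    · have hker : (LinearMap.ker (T.toFun - μ • T.domain.subtype)).FG :=
        Submodule.fg_of_fg_map_injective T.domain.subtype T.domain.injective_subtype hfg
      exact Submodule.FG.of_le hker inf_le_right

end KerPow

theorem dslope_mem_graph {G : Submodule ℂ (H × H)} {n : ℂ → H} {v g : H} {μ x c : ℂ} {k : ℕ}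
    (hxμ : x ≠ μ) (hμ : (n μ, v + μ • n μ) ∈ G)
    (hx : (n x, x • n x + v + ((x - μ) ^ (k + 1) * c) • g) ∈ G) :
    (dslope n μ x, x • dslope n μ x + n μ + ((x - μ) ^ k * c) • g) ∈ G := by
  have hn : n x = n μ + (x - μ) • dslope n μ x := by
    rw [sub_smul_dslope, add_sub_cancel]
  have hsub : (n x, x • n x + v + ((x - μ) ^ (k + 1) * c) • g) - (n μ, v + μ • n μ) =
      (x - μ) • (dslope n μ x, x • dslope n μ x + n μ + ((x - μ) ^ k * c) • g) := by
    rw [hn, Prod.mk_sub_mk, Prod.smul_mk]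
    congr 1 <;> module
  rw [← inv_smul_smul₀ (sub_ne_zero.2 hxμ) (dslope n μ x, _), ← hsub]
  exact G.smul_mem _ (G.sub_mem hx hμ)

/- Divide by `x - μ` one factor at a time: `n μ` lies in `ker (T - μ)ʲ⁺¹`, where `φ` vanishes, and
the difference quotient of `n` at `μ` satisfies the same kind of equation with `v` replaced by
`n μ` and `k` lowered by one. -/
theorem exists_apply_eq_pow_mul {T : H →ₗ.[ℂ] H} (hcl : IsClosed (T.graph : Set (H × H)))
    {φ : H →L[ℂ] ℂ} {μ : ℂ} (hφ : ∀ j, ∀ y ∈ kerPow T μ j, φ y = 0) (g : H) {r : ℂ → ℂ}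
    (hr : ContinuousAt r μ) {k j : ℕ} {n : ℂ → H} {v : H} (hv : v ∈ kerPow T μ j)
    (hn : AnalyticAt ℂ n μ)
    (hgraph : ∀ᶠ x in 𝓝[≠] μ, (n x, x • n x + v + ((x - μ) ^ k * r x) • g) ∈ T.graph) :
    ∃ u : ℂ → ℂ, AnalyticAt ℂ u μ ∧ ∀ᶠ x in 𝓝[≠] μ, φ (n x) = (x - μ) ^ k * u x := by
  induction k generalizing n v j with
  | zero =>
    exact ⟨fun x => φ (n x), (φ.analyticAt _).comp hn, Eventually.of_forall fun x => by simp⟩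
  | succ k ih =>
    have hlim : (n μ, v + μ • n μ) ∈ T.graph := by
      have hcont : ContinuousAt
          (fun x => (n x, x • n x + v + ((x - μ) ^ (k + 1) * r x) • g)) μ := by
        have := hn.continuousAt
        fun_prop
      refine hcl.mem_of_tendsto ?_ hgraph
      simpa [add_comm] using hcont.tendsto.mono_left (nhdsWithin_le_nhds (s := {μ}ᶜ))
    have hnμ : n μ ∈ kerPow T μ (j + 1) := mem_kerPow_succ.2 ⟨v, hv, hlim⟩
    obtain ⟨p, hp⟩ := hn
    obtain ⟨u, hu, hux⟩ := ih hnμ hp.has_fpower_series_dslope_fslope.analyticAt (by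
      filter_upwards [hgraph, self_mem_nhdsWithin] with x hx hxμ
      exact dslope_mem_graph hxμ hlim hx)
    refine ⟨u, hu, ?_⟩
    filter_upwards [hux] with x hx
    rw [← add_sub_cancel (n μ) (n x), ← sub_smul_dslope, map_add, hφ _ _ hnμ, map_smul, hx,
      smul_eq_mul]
    ring

namespace IsCharacteristicPair

variable {T : H →ₗ.[ℂ] H} {Δ : ℂ → ℂ} {N : ℂ → H →L[ℂ] H} {ν : ℂ}

theorem mem_graph_iff (h : IsCharacteristicPair T Δ N) (hν : Δ ν ≠ 0) {y w : H} :
    (y, w) ∈ T.graph ↔ N ν (w - ν • y) = Δ ν • y := by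
  refine ⟨h.num_apply ν y w, fun hy => ?_⟩
  have hmem := T.graph.smul_mem (Δ ν)⁻¹ (h.mem_graph ν (w - ν • y))
  rwa [hy, smul_comm ν, ← smul_add, sub_add_cancel, Prod.smul_mk, inv_smul_smul₀ hν,
    inv_smul_smul₀ hν] at hmem

theorem isClosed_graph (h : IsCharacteristicPair T Δ N) (hν : Δ ν ≠ 0) :
    IsClosed (T.graph : Set (H × H)) := by
  have hgraph : (T.graph : Set (H × H)) = {p | N ν (p.2 - ν • p.1) = Δ ν • p.1} := by
    ext ⟨y, w⟩
    exact h.mem_graph_iff hν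
  rw [hgraph]
  exact isClosed_eq (by fun_prop) (by fun_prop)

theorem exists_entire_quotient_num_apply [CompleteSpace H] (h : IsCharacteristicPair T Δ N)
    (hν : Δ ν ≠ 0) {φ : H →L[ℂ] ℂ} (hφ : ∀ μ j, ∀ y ∈ kerPow T μ j, φ y = 0) (g : H) :
    ∃ F : ℂ → ℂ, Differentiable ℂ F ∧ ∀ x, Δ x * F x = φ (N x g) := by
  have hN : Differentiable ℂ fun x => N x g :=
    h.differentiable_num.clm_apply (differentiable_const g)
  refine exists_entire_quotient (φ.differentiable.comp hN) h.differentiable_det hν fun μ => ?_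
  obtain ⟨m, r, hr, hr0, hΔr⟩ := exists_eq_pow_mul_of_entire h.differentiable_det hν μ
  have hΔr' := hΔr.filter_mono (nhdsWithin_le_nhds (s := {μ}ᶜ))
  obtain ⟨u, hu, hux⟩ := exists_apply_eq_pow_mul (h.isClosed_graph hν) (hφ μ) g hr.continuousAt
    (k := m) (j := 0) (Submodule.zero_mem _) (hN.analyticAt μ) (by
      filter_upwards [hΔr'] with x hx
      simpa only [hx, add_comm, zero_add] using h.mem_graph x g)
  refine ⟨fun x => u x / r x, hu.div hr hr0, ?_⟩
  filter_upwards [hux, hΔr', (hr.continuousAt.eventually_ne hr0).filter_mono nhdsWithin_le_nhds]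
    with x hφx hΔx hrx
  rw [hφx, hΔx]
  field_simp

end IsCharacteristicPair

end CharacteristicPair

section CompletenessCriterion

open Filter Topology

theorem exists_bound_of_eq_sub_mul_add {f f' : ℂ → ℂ} (hf' : Continuous f') {ν c : ℂ}
    (hff' : ∀ x, f x = (x - ν) * f' x + c) {S : Set ℂ} {m : ℕ}
    (hb : ∃ K : ℝ, ∀ x ∈ S, ‖f x‖ ≤ K * (1 + ‖x‖) ^ (m + 1)) :
    ∃ K : ℝ, ∀ x ∈ S, ‖f' x‖ ≤ K * (1 + ‖x‖) ^ m := by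
  obtain ⟨K, hK⟩ := hb
  obtain ⟨K', hK'⟩ := (isCompact_closedBall (0 : ℂ) (2 * ‖ν‖ + 1)).exists_bound_of_continuousOn
    hf'.continuousOn
  refine ⟨max K' (2 * (K + ‖c‖)), fun x hx => ?_⟩
  have hone : 1 ≤ 1 + ‖x‖ := le_add_of_nonneg_right (norm_nonneg x)
  rcases le_or_gt ‖x‖ (2 * ‖ν‖ + 1) with hxν | hxν
  · have hle : ‖f' x‖ ≤ max K' (2 * (K + ‖c‖)) :=
      (hK' x (by simpa using hxν)).trans (le_max_left _ _)
    exact hle.trans (le_mul_of_one_le_right ((norm_nonneg _).trans hle) (one_le_pow₀ hone))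
  · have hdist : (1 + ‖x‖) / 2 ≤ ‖x - ν‖ := by
      linarith [norm_sub_norm_le x ν]
    have hc : ‖c‖ ≤ ‖c‖ * (1 + ‖x‖) ^ (m + 1) :=
      le_mul_of_one_le_right (norm_nonneg _) (one_le_pow₀ hone)
    have hmul : (1 + ‖x‖) / 2 * ‖f' x‖ ≤ (1 + ‖x‖) / 2 * (2 * (K + ‖c‖) * (1 + ‖x‖) ^ m) := by
      calc (1 + ‖x‖) / 2 * ‖f' x‖ ≤ ‖x - ν‖ * ‖f' x‖ := by gcongr
        _ = ‖f x - c‖ := by rw [hff' x, add_sub_cancel_right, norm_mul]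
        _ ≤ ‖f x‖ + ‖c‖ := norm_sub_le _ _
        _ ≤ K * (1 + ‖x‖) ^ (m + 1) + ‖c‖ * (1 + ‖x‖) ^ (m + 1) := add_le_add (hK x hx) hc
        _ = _ := by ring
    exact (le_of_mul_le_mul_left hmul (by positivity)).trans (by gcongr; exact le_max_right _ _)

section Recursion

variable {X : Type*} {F : X → ℂ → ℂ} {ρ : X → X} {ψ : X → ℂ} {ν : ℂ}

theorem exists_bound_iterate_of_recursion (hF : ∀ g, Continuous (F g))
    (hrec : ∀ g x, F g x = (x - ν) * F (ρ g) x + ψ (ρ g)) {S : Set ℂ} {m : ℕ} {g : X}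
    (hb : ∃ K : ℝ, ∀ x ∈ S, ‖F g x‖ ≤ K * (1 + ‖x‖) ^ m) :
    ∃ K : ℝ, ∀ x ∈ S, ‖F (ρ^[m] g) x‖ ≤ K := by
  induction m generalizing g with
  | zero => simpa using hb
  | succ m ih => exact ih (exists_bound_of_eq_sub_mul_add (hF _) (hrec g) hb)

/- A constant `(x - ν) * c + d` has `c = 0`. -/
theorem apply_iterate_eq_zero_of_recursion
    (hrec : ∀ g x, F g x = (x - ν) * F (ρ g) x + ψ (ρ g)) {m : ℕ}
    (hconst : ∀ g x y, F (ρ^[m] g) x = F (ρ^[m] g) y) (g : X) : ψ (ρ^[m + 2] g) = 0 := by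
  have hsucc : ρ (ρ^[m] g) = ρ^[m] (ρ g) := by
    rw [← Function.iterate_succ_apply, Function.iterate_succ_apply']
  have hzero : ∀ x, F (ρ (ρ^[m] g)) x = 0 := fun x => by
    have hν := hrec (ρ^[m] g) ν
    have hν1 := hrec (ρ^[m] g) (ν + 1)
    rw [hconst g (ν + 1) ν, hsucc, hconst (ρ g) (ν + 1) x, ← hsucc] at hν1
    linear_combination hν - hν1
  have hlast := hrec (ρ (ρ^[m] g)) ν
  rw [hzero, sub_self, zero_mul, zero_add] at hlast
  rw [Function.iterate_succ_apply', Function.iterate_succ_apply', ← hlast]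

end Recursion

theorem denseRange_iterate {X : Type*} [TopologicalSpace X] {ρ : X → X} (hρ : Continuous ρ)
    (hdense : DenseRange ρ) (m : ℕ) : DenseRange ρ^[m] := by
  induction m with
  | zero => exact denseRange_id
  | succ m ih => exact ih.comp hdense (hρ.iterate m)

theorem topologicalClosure_eq_top_of_forall_dual {H : Type*} [NormedAddCommGroup H]
    [NormedSpace ℂ H] {V : Submodule ℂ H}
    (hV : ∀ φ : H →L[ℂ] ℂ, (∀ y ∈ V, φ y = 0) → φ = 0) : V.topologicalClosure = ⊤ := by
  by_contra! hne
  obtain ⟨x, -, hx⟩ := SetLike.exists_of_lt hne.lt_top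
  have hclosed : IsClosed (V.topologicalClosure : Set H) := V.isClosed_topologicalClosure
  let π := V.topologicalClosure.mkQL
  have hπx : π x ≠ 0 := by simpa [π] using hx
  obtain ⟨f, hf⟩ := SeparatingDual.exists_ne_zero (R := ℂ) hπx
  refine hf (DFunLike.congr_fun (hV (f ∘L π) fun y hy => ?_) x)
  have hy : π y = 0 := by simpa [π] using V.le_topologicalClosure hy
  simp [hy]

namespace IsCharacteristicPair

variable {H : Type*} [NormedAddCommGroup H] [NormedSpace ℂ H] {T : H →ₗ.[ℂ] H} {Δ : ℂ → ℂ}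
  {N : ℂ → H →L[ℂ] H} {ν : ℂ}

theorem num_apply_resolvent (h : IsCharacteristicPair T Δ N) (hν : Δ ν ≠ 0) (g : H) (x : ℂ) :
    N x g = (x - ν) • N x (((Δ ν)⁻¹ • N ν) g) + Δ x • ((Δ ν)⁻¹ • N ν) g := by
  have hmem := T.graph.smul_mem (Δ ν)⁻¹ (h.mem_graph ν g)
  rw [Prod.smul_mk, smul_add, inv_smul_smul₀ hν, smul_comm _ ν] at hmem
  have hnum := h.num_apply x _ _ hmem
  simp only [map_sub, map_add, map_smul] at hnum
  simp only [_root_.smul_apply, map_smul]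
  rw [← hnum]
  module

theorem denseRange_resolvent (h : IsCharacteristicPair T Δ N) (hν : Δ ν ≠ 0)
    (hdense : Dense (T.domain : Set H)) : DenseRange ((Δ ν)⁻¹ • N ν) := by
  refine hdense.mono fun y hy => ⟨T ⟨y, hy⟩ - ν • y, ?_⟩
  rw [_root_.smul_apply, h.num_apply ν y _ (T.mem_graph ⟨y, hy⟩), inv_smul_smul₀ hν]

variable {φ : H →L[ℂ] ℂ}

theorem quotient_eq_sub_mul_add (h : IsCharacteristicPair T Δ N) (hν : Δ ν ≠ 0)
    {F : H → ℂ → ℂ} (hFc : ∀ g, Continuous (F g)) (hF : ∀ g x, Δ x * F g x = φ (N x g))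
    (g : H) (x : ℂ) :
    F g x = (x - ν) * F (((Δ ν)⁻¹ • N ν) g) x + φ (((Δ ν)⁻¹ • N ν) g) := by
  set ρ := (Δ ν)⁻¹ • N ν
  refine eq_of_eventuallyEq_nhdsNE (g := fun x => (x - ν) * F (ρ g) x + φ (ρ g))
    (hFc g).continuousAt ?_ ?_
  · have := hFc (ρ g)
    exact Continuous.continuousAt (by fun_prop)
  · filter_upwards [eventually_ne_zero_of_entire h.differentiable_det hν x] with y hy
    refine mul_left_cancel₀ hy ?_
    rw [hF, h.num_apply_resolvent hν g y, mul_add, mul_left_comm, hF, map_add, map_smul, map_smul,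
      smul_eq_mul, smul_eq_mul]

theorem exists_poly_bound_quotient {f : ℂ → ℂ} (hf : Continuous f) {g : H}
    (hfN : ∀ x, Δ x * f x = φ (N x g)) {S : Set ℂ} {C R : ℝ} {s : ℕ} (hC : 0 ≤ C)
    (hS : ∀ x ∈ S, R < ‖x‖ → Δ x ≠ 0 ∧ ‖N x‖ ≤ C * ‖x‖ ^ s * ‖Δ x‖) :
    ∃ K : ℝ, ∀ x ∈ S, ‖f x‖ ≤ K * (1 + ‖x‖) ^ s := by
  obtain ⟨K, hK⟩ := (isCompact_closedBall (0 : ℂ) R).exists_bound_of_continuousOn hf.continuousOn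
  refine ⟨max K (C * (‖φ‖ * ‖g‖)), fun x hxS => ?_⟩
  rcases le_or_gt ‖x‖ R with hxR | hxR
  · have hle : ‖f x‖ ≤ max K (C * (‖φ‖ * ‖g‖)) :=
      (hK x (by simpa using hxR)).trans (le_max_left _ _)
    exact hle.trans (le_mul_of_one_le_right ((norm_nonneg _).trans hle)
      (one_le_pow₀ (le_add_of_nonneg_right (norm_nonneg x))))
  · obtain ⟨hΔx, hNx⟩ := hS x hxS hxR
    have hmul : ‖Δ x‖ * ‖f x‖ ≤ ‖Δ x‖ * (C * (‖φ‖ * ‖g‖) * (1 + ‖x‖) ^ s) := by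
      calc ‖Δ x‖ * ‖f x‖ = ‖φ (N x g)‖ := by rw [← norm_mul, hfN]
        _ ≤ ‖φ‖ * (‖N x‖ * ‖g‖) := (φ.le_opNorm _).trans (by gcongr; exact (N x).le_opNorm g)
        _ ≤ ‖φ‖ * ((C * (1 + ‖x‖) ^ s * ‖Δ x‖) * ‖g‖) := by
          gcongr
          refine hNx.trans ?_
          gcongr
          exact le_add_of_nonneg_left zero_le_one
        _ = _ := by ring
    refine (le_of_mul_le_mul_left hmul (norm_pos_iff.2 hΔx)).trans ?_
    gcongr
    exact le_max_right _ _

theorem exists_exp_bound_quotient {f : ℂ → ℂ} (hf : Differentiable ℂ f)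
    (hΔ : Differentiable ℂ Δ) (hν : Δ ν ≠ 0) {g : H} (hfN : ∀ x, Δ x * f x = φ (N x g))
    {A B : ℝ} (hA : 0 ≤ A) (hB : 0 ≤ B) (hΔ_le : ∀ x, ‖Δ x‖ ≤ Real.exp (A * ‖x‖ + B))
    (hN_le : ∀ x, Δ x ≠ 0 → ‖N x‖ ≤ Real.exp (A * ‖x‖ + B)) :
    ∃ A' B', 0 ≤ A' ∧ ∀ x, ‖f x‖ ≤ Real.exp (A' * ‖x‖ + B') := by
  have hφg : 0 ≤ ‖φ‖ * ‖g‖ := by positivity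
  refine exists_exp_bound_of_mul (B := B + ‖φ‖ * ‖g‖) hf hΔ hν hA (by positivity)
    (fun x => (hΔ_le x).trans (Real.exp_le_exp.2 (by linarith))) fun x => ?_
  by_cases hx : Δ x = 0
  · rw [hx, zero_mul, norm_zero]
    positivity
  calc ‖Δ x * f x‖ = ‖φ (N x g)‖ := by rw [hfN]
    _ ≤ ‖φ‖ * (‖N x‖ * ‖g‖) := (φ.le_opNorm _).trans (by gcongr; exact (N x).le_opNorm g)
    _ = ‖N x‖ * (‖φ‖ * ‖g‖) := by ring
    _ ≤ Real.exp (A * ‖x‖ + B) * Real.exp (‖φ‖ * ‖g‖) := by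
      gcongr
      · exact hN_le x hx
      · linarith [Real.add_one_le_exp (‖φ‖ * ‖g‖)]
    _ = Real.exp (A * ‖x‖ + (B + ‖φ‖ * ‖g‖)) := by rw [← Real.exp_add, add_assoc]

variable [CompleteSpace H] {A B C R : ℝ} {s : ℕ} {z : Fin 3 → ℂ}

/- With `ρ` the resolvent at `ν`, the entire functions `F g = φ (N(·) g) / Δ` satisfy
`F g x = (x - ν) F (ρ g) x + φ (ρ g)`; each application of `ρ` lowers the polynomial growth on the
three rays by one degree, until Phragmén–Lindelöf and Liouville apply. -/
theorem functional_eq_zero (h : IsCharacteristicPair T Δ N) (hν : Δ ν ≠ 0)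
    (hdense : Dense (T.domain : Set H)) (hA : 0 ≤ A) (hB : 0 ≤ B)
    (hΔ_le : ∀ x, ‖Δ x‖ ≤ Real.exp (A * ‖x‖ + B))
    (hN_le : ∀ x, Δ x ≠ 0 → ‖N x‖ ≤ Real.exp (A * ‖x‖ + B))
    (h0 : (0 : ℂ) ∈ interior (convexHull ℝ (range z))) (hC : 0 ≤ C)
    (hray : ∀ k, ∀ r : ℝ, 0 ≤ r → R < ‖(r : ℂ) * z k‖ → Δ (r * z k) ≠ 0 ∧
      ‖N (r * z k)‖ ≤ C * ‖(r : ℂ) * z k‖ ^ s * ‖Δ (r * z k)‖)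
    (hφ : ∀ μ j, ∀ y ∈ kerPow T μ j, φ y = 0) : φ = 0 := by
  choose F hFd hF using fun g => h.exists_entire_quotient_num_apply hν hφ g
  set ρ : H →L[ℂ] H := (Δ ν)⁻¹ • N ν
  have hFc : ∀ g, Continuous (F g) := fun g => (hFd g).continuous
  have hrec : ∀ g x, F g x = (x - ν) * F (ρ g) x + φ (ρ g) := h.quotient_eq_sub_mul_add hν hFc hF
  let rays : Set ℂ := {x | ∃ k, ∃ r : ℝ, 0 ≤ r ∧ x = r * z k}
  have hbound : ∀ g, ∃ K : ℝ, ∀ x ∈ rays, ‖F (ρ^[s] g) x‖ ≤ K := fun g =>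
    exists_bound_iterate_of_recursion hFc hrec <| exists_poly_bound_quotient (hFc g) (hF g) hC <| by
      rintro _ ⟨k, r, hr, rfl⟩ hR
      exact hray k r hr hR
  have hconst : ∀ g x y, F (ρ^[s] g) x = F (ρ^[s] g) y := by
    intro g x y
    obtain ⟨K, hK⟩ := hbound g
    obtain ⟨A', B', hA', hexp⟩ :=
      exists_exp_bound_quotient (hFd _) h.differentiable_det hν (hF (ρ^[s] g)) hA hB hΔ_le hN_le
    have hle : ∀ w, ‖F (ρ^[s] g) w‖ ≤ K :=
      norm_le_of_three_rays h0 (hFd _) hA' hexp fun k r hr => hK _ ⟨k, r, hr, rfl⟩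
    exact (hFd _).apply_eq_apply_of_bounded
      (isBounded_iff_forall_norm_le.2 ⟨K, forall_mem_range.2 hle⟩) x y
  have hρ : DenseRange ρ^[s + 2] :=
    denseRange_iterate ρ.continuous (h.denseRange_resolvent hν hdense) _
  exact DFunLike.coe_injective <| hρ.equalizer φ.continuous continuous_const <|
    funext fun g => apply_iterate_eq_zero_of_recursion hrec hconst g

theorem topologicalClosure_iSup_rootSubspace (h : IsCharacteristicPair T Δ N) (hν : Δ ν ≠ 0)
    (hdense : Dense (T.domain : Set H)) (hA : 0 ≤ A) (hB : 0 ≤ B)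
    (hΔ_le : ∀ x, ‖Δ x‖ ≤ Real.exp (A * ‖x‖ + B))
    (hN_le : ∀ x, Δ x ≠ 0 → ‖N x‖ ≤ Real.exp (A * ‖x‖ + B))
    (h0 : (0 : ℂ) ∈ interior (convexHull ℝ (range z))) (hC : 0 ≤ C)
    (hray : ∀ k, ∀ r : ℝ, 0 ≤ r → R < ‖(r : ℂ) * z k‖ → Δ (r * z k) ≠ 0 ∧
      ‖N (r * z k)‖ ≤ C * ‖(r : ℂ) * z k‖ ^ s * ‖Δ (r * z k)‖) :
    (⨆ μ, rootSubspace T μ).topologicalClosure = ⊤ :=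
  topologicalClosure_eq_top_of_forall_dual fun _ hφ =>
    h.functional_eq_zero hν hdense hA hB hΔ_le hN_le h0 hC hray fun μ j y hy =>
      hφ y (Submodule.mem_iSup_of_mem μ (mem_rootSubspace.2 ⟨j, hy⟩))

end IsCharacteristicPair

theorem isCompleteFamily_of_bases {H : Type*} [NormedAddCommGroup H] [NormedSpace ℂ H]
    {κ : Type*} {V : κ → Submodule ℂ H} (hV : (⨆ μ, V μ).topologicalClosure = ⊤)
    {ι : κ → Type*} (e : ∀ μ, Module.Basis (ι μ) ℂ (V μ)) :
    IsCompleteFamily (fun p : Σ μ, ι μ => (e p.1 p.2 : H)) := by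
  have hle : (⨆ μ, V μ) ≤ Submodule.span ℂ (range fun p : Σ μ, ι μ => (e p.1 p.2 : H)) := by
    refine iSup_le fun μ => ?_
    rw [← Submodule.map_subtype_top (V μ), ← (e μ).span_eq, Submodule.map_span]
    refine Submodule.span_mono ?_
    rintro _ ⟨_, ⟨j, rfl⟩, rfl⟩
    exact ⟨⟨μ, j⟩, rfl⟩
  exact (Submodule.dense_iff_topologicalClosure_eq_top.2 hV).mono hle

end CompletenessCriterion

section MinimalityCriterion

open Filter Topology

theorem isMinimalFamily_of_bases {H : Type*} [NormedAddCommGroup H] [NormedSpace ℂ H]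
    {κ : Type*} {V Z : κ → Submodule ℂ H} (hfin : ∀ μ, (V μ).FG)
    (hZ : ∀ μ, IsClosed (Z μ : Set H)) (hVZ : ∀ μ μ', μ' ≠ μ → V μ' ≤ Z μ)
    (hdisj : ∀ μ, Disjoint (Z μ) (V μ)) {ι : κ → Type*}
    (e : ∀ μ, Module.Basis (ι μ) ℂ (V μ)) :
    IsMinimalFamily (fun p : Σ μ, ι μ => (e p.1 p.2 : H)) := by
  rintro ⟨μ, i⟩ hmem
  let W : Submodule ℂ H := Submodule.span ℂ ((fun j => (e μ j : H)) '' {j | j ≠ i})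
  have hWV : W ≤ V μ := Submodule.span_le.2 (by rintro _ ⟨j, -, rfl⟩; exact (e μ j).2)
  have : FiniteDimensional ℂ W := Module.Finite.iff_fg.2 (Submodule.FG.of_le (hfin μ) hWV)
  have hle : Submodule.span ℂ ((fun p : Σ μ, ι μ => (e p.1 p.2 : H)) '' {j | j ≠ ⟨μ, i⟩}) ≤
      Z μ ⊔ W := by
    rw [Submodule.span_le]
    rintro _ ⟨⟨μ', j⟩, hj, rfl⟩
    rcases eq_or_ne μ' μ with rfl | hμ
    · exact Submodule.mem_sup_right (Submodule.subset_span ⟨j, fun hji => hj (by rw [hji]), rfl⟩)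
    · exact Submodule.mem_sup_left (hVZ μ μ' hμ (e μ' j).2)
  obtain ⟨y, hy, w, hw, hyw⟩ := Submodule.mem_sup.1
    (closure_minimal hle (Submodule.isClosed_sup_finiteDimensional _ W (hZ μ)) hmem)
  have hyV : y ∈ V μ := by
    rw [eq_sub_of_add_eq hyw]
    exact Submodule.sub_mem _ (e μ i).2 (hWV hw)
  rw [Submodule.disjoint_def.1 (hdisj μ) y hy hyV, zero_add] at hyw
  have hli : LinearIndependent ℂ fun j => (e μ j : H) :=
    (e μ).linearIndependent.map' _ (Submodule.ker_subtype _)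
  refine hli.notMem_span_image (s := {j | j ≠ i}) (x := i) (by simp) ?_
  rwa [hyw] at hw

theorem iteratedDeriv_clm_apply_const {E F : Type*} [NormedAddCommGroup E] [NormedSpace ℂ E]
    [NormedAddCommGroup F] [NormedSpace ℂ F] [CompleteSpace F] {N : ℂ → E →L[ℂ] F}
    (hN : Differentiable ℂ N) (y : E) (j : ℕ) (x : ℂ) :
    iteratedDeriv j (fun x => N x y) x = iteratedDeriv j N x y := by
  induction j generalizing x with
  | zero => simp only [iteratedDeriv_zero]
  | succ j ih =>
    have hderiv : DifferentiableAt ℂ (iteratedDeriv j N) x :=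
      (hN.contDiff (n := ⊤)).differentiable_iteratedDeriv j
        (by exact_mod_cast WithTop.coe_lt_top _) x
    rw [iteratedDeriv_succ, iteratedDeriv_succ, funext ih]
    simpa using (hderiv.hasDerivAt.clm_apply (hasDerivAt_const x y)).deriv

variable {H : Type*} [NormedAddCommGroup H] [NormedSpace ℂ H]

/-- The vectors `y` for which `Δ⁻¹ N(·) y` extends analytically across `μ`. -/
def regularSubspace (Δ : ℂ → ℂ) (N : ℂ → H →L[ℂ] H) (μ : ℂ) : Submodule ℂ H where
  carrier := {y | ∃ u : ℂ → H, AnalyticAt ℂ u μ ∧ ∀ᶠ x in 𝓝 μ, N x y = Δ x • u x}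
  add_mem' := by
    rintro y y' ⟨u, hu, huN⟩ ⟨u', hu', huN'⟩
    refine ⟨u + u', hu.add hu', ?_⟩
    filter_upwards [huN, huN'] with x hx hx'
    rw [map_add, hx, hx', Pi.add_apply, smul_add]
  zero_mem' := ⟨fun _ => 0, analyticAt_const, by simp⟩
  smul_mem' := by
    rintro c y ⟨u, hu, huN⟩
    refine ⟨c • u, hu.const_smul, ?_⟩
    filter_upwards [huN] with x hx
    rw [map_smul, hx, Pi.smul_apply, smul_comm]

/- If `Δ` vanishes at `μ` to order `m`, then `y` is regular iff `N(·) y` vanishes to order `m`. -/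
theorem isClosed_regularSubspace [CompleteSpace H] {Δ : ℂ → ℂ} {N : ℂ → H →L[ℂ] H} {ν : ℂ}
    (hΔ : Differentiable ℂ Δ) (hN : Differentiable ℂ N) (hν : Δ ν ≠ 0) (μ : ℂ) :
    IsClosed (regularSubspace Δ N μ : Set H) := by
  obtain ⟨m, r, hr, hr0, hΔr⟩ := exists_eq_pow_mul_of_entire hΔ hν μ
  have hset : (regularSubspace Δ N μ : Set H) = ⋂ j : Fin m, {y | iteratedDeriv j N μ y = 0} := by
    ext y
    have hNy : AnalyticAt ℂ (fun x => N x y) μ :=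
      (hN.clm_apply (differentiable_const y)).analyticAt μ
    simp only [mem_iInter, mem_ofPred_eq, Fin.forall_iff, ← iteratedDeriv_clm_apply_const hN]
    rw [← natCast_le_analyticOrderAt_iff_iteratedDeriv_eq_zero hNy, natCast_le_analyticOrderAt hNy]
    constructor
    · rintro ⟨u, hu, huN⟩
      refine ⟨fun x => r x • u x, hr.smul hu, ?_⟩
      filter_upwards [huN, hΔr] with x hNx hΔx
      rw [hNx, hΔx, mul_smul]
    · rintro ⟨g, hg, hgN⟩
      refine ⟨fun x => (r x)⁻¹ • g x, (hr.inv hr0).smul hg, ?_⟩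
      filter_upwards [hgN, hΔr, hr.continuousAt.eventually_ne hr0] with x hNx hΔx hrx
      rw [hNx, hΔx, mul_smul, smul_inv_smul₀ hrx]
  rw [hset]
  exact isClosed_iInter fun j => isClosed_eq (iteratedDeriv j N μ).continuous continuous_const

namespace IsCharacteristicPair

variable {T : H →ₗ.[ℂ] H} {Δ : ℂ → ℂ} {N : ℂ → H →L[ℂ] H} {ν μ : ℂ}

/- `q` is the polar part of the resolvent applied to `y`, multiplied by `(x - μ)ᵏ`; its value at `μ`
is the leading coefficient. -/
theorem exists_polar_part (h : IsCharacteristicPair T Δ N) {k : ℕ} {y : H}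
    (hy : y ∈ kerPow T μ k) : ∃ q : ℂ → H, Differentiable ℂ q ∧
      (∀ x, (x - μ) ^ k • N x y = Δ x • q x) ∧ (q μ = 0 → y ∈ kerPow T μ (k - 1)) := by
  induction k generalizing y with
  | zero =>
    rw [show y = 0 from hy]
    exact ⟨fun _ => 0, differentiable_const _, by simp, fun _ => Submodule.zero_mem _⟩
  | succ k ih =>
    obtain ⟨v, hv, hgraph⟩ := mem_kerPow_succ.1 hy
    have hNv : ∀ x, N x v = (x - μ) • N x y + Δ x • y := by
      intro x
      rw [← h.num_apply x _ _ hgraph]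
      simp only [map_sub, map_add, map_smul]
      module
    rcases k with _ | k
    · have hNy : ∀ x, (x - μ) • N x y + Δ x • y = 0 := fun x => by
        rw [← hNv, show v = 0 from hv, map_zero]
      refine ⟨fun _ => -y, differentiable_const _, fun x => ?_, fun hzero => neg_eq_zero.1 hzero⟩
      rw [zero_add, pow_one, smul_neg, eq_neg_iff_add_eq_zero, hNy]
    · obtain ⟨q, hq, hqv, hq0⟩ := ih hv
      refine ⟨fun x => q x - (x - μ) ^ (k + 1) • y, by fun_prop, fun x => ?_, fun hzero => ?_⟩
      · rw [smul_sub, ← hqv x, hNv x]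
        module
      · simp only [sub_self, zero_pow k.succ_ne_zero, zero_smul, sub_zero] at hzero
        exact mem_kerPow_succ.2 ⟨v, hq0 hzero, hgraph⟩

theorem eq_zero_of_mem_regularSubspace (h : IsCharacteristicPair T Δ N) (hν : Δ ν ≠ 0) {y : H}
    (hreg : y ∈ regularSubspace Δ N μ) {k : ℕ} (hy : y ∈ kerPow T μ k) : y = 0 := by
  obtain ⟨u, hu, huN⟩ := hreg
  induction k with
  | zero => exact hy
  | succ k ih =>
    obtain ⟨q, hq, hqN, hq0⟩ := h.exists_polar_part hy
    refine ih (hq0 ?_)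
    have hqμ : q μ = (μ - μ) ^ (k + 1) • u μ := by
      have := hu.continuousAt
      refine eq_of_eventuallyEq_nhdsNE (g := fun x => (x - μ) ^ (k + 1) • u x)
        hq.continuous.continuousAt (by fun_prop) ?_
      filter_upwards [huN.filter_mono nhdsWithin_le_nhds,
        eventually_ne_zero_of_entire h.differentiable_det hν μ] with x hx hΔx
      have hmul := hqN x
      rw [hx, smul_comm] at hmul
      exact (smul_right_injective H hΔx hmul).symm
    rw [hqμ, sub_self, zero_pow k.succ_ne_zero, zero_smul]

theorem disjoint_regularSubspace_rootSubspace (h : IsCharacteristicPair T Δ N) (hν : Δ ν ≠ 0)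
    (μ : ℂ) : Disjoint (regularSubspace Δ N μ) (rootSubspace T μ) :=
  Submodule.disjoint_def.2 fun _ hreg hroot =>
    have ⟨_, hk⟩ := mem_rootSubspace.1 hroot
    h.eq_zero_of_mem_regularSubspace hν hreg hk

theorem rootSubspace_le_regularSubspace [CompleteSpace H] (h : IsCharacteristicPair T Δ N)
    {μ' : ℂ} (hμ : μ' ≠ μ) : rootSubspace T μ' ≤ regularSubspace Δ N μ := by
  intro y hy
  obtain ⟨k, hk⟩ := mem_rootSubspace.1 hy
  obtain ⟨q, hq, hqN, -⟩ := h.exists_polar_part hk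
  have hne : (μ - μ') ^ k ≠ 0 := pow_ne_zero _ (sub_ne_zero.2 hμ.symm)
  have hpow : AnalyticAt ℂ (fun x : ℂ => (x - μ') ^ k) μ := by fun_prop
  refine ⟨fun x => ((x - μ') ^ k)⁻¹ • q x, (hpow.inv hne).smul (hq.analyticAt μ), ?_⟩
  filter_upwards [hpow.continuousAt.eventually_ne hne] with x hx
  rw [smul_comm, ← hqN x, inv_smul_smul₀ hx]

theorem kerPow_succ_le (h : IsCharacteristicPair T Δ N) {m k : ℕ} {r : ℂ → ℂ}
    (hr : ContinuousAt r μ) (hr0 : r μ ≠ 0) (hΔr : ∀ᶠ x in 𝓝 μ, Δ x = (x - μ) ^ m * r x)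
    (hmk : m ≤ k) : kerPow T μ (k + 1) ≤ kerPow T μ k := by
  intro y hy
  obtain ⟨q, hq, hqN, hq0⟩ := h.exists_polar_part hy
  refine hq0 ((smul_eq_zero.1 (?_ : r μ • q μ = 0)).resolve_left hr0)
  have hrq : r μ • q μ = (μ - μ) ^ (k + 1 - m) • N μ y := by
    have hN := h.differentiable_num.continuous
    have := hq.continuous
    refine eq_of_eventuallyEq_nhdsNE (f := fun x => r x • q x)
      (g := fun x => (x - μ) ^ (k + 1 - m) • N x y) (by fun_prop)
      (Continuous.continuousAt (by fun_prop)) ?_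
    filter_upwards [hΔr.filter_mono nhdsWithin_le_nhds, self_mem_nhdsWithin] with x hΔx hxμ
    have hmul := hqN x
    rw [hΔx, mul_smul, show k + 1 = m + (k + 1 - m) by omega, pow_add, mul_smul] at hmul
    exact (smul_right_injective H (pow_ne_zero m (sub_ne_zero.2 hxμ)) hmul).symm
  rw [hrq, sub_self, zero_pow (by omega), zero_smul]

theorem exists_rootSubspace_eq_kerPow (h : IsCharacteristicPair T Δ N) (hν : Δ ν ≠ 0) (μ : ℂ) :
    ∃ m, rootSubspace T μ = kerPow T μ m := by
  obtain ⟨m, r, hr, hr0, hΔr⟩ := exists_eq_pow_mul_of_entire h.differentiable_det hν μ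
  have hle : ∀ k ≥ m, kerPow T μ k ≤ kerPow T μ m := by
    intro k hk
    induction k, hk using Nat.le_induction with
    | base => exact le_rfl
    | succ k hk ih => exact (h.kerPow_succ_le hr.continuousAt hr0 hΔr hk).trans ih
  refine ⟨m, le_antisymm (iSup_le fun k => ?_) (le_iSup (kerPow T μ) m)⟩
  exact (monotone_kerPow T μ (le_max_left k m)).trans (hle _ (le_max_right k m))

theorem isMinimalFamily [CompleteSpace H] (h : IsCharacteristicPair T Δ N) (hν : Δ ν ≠ 0)
    (hfin : ∀ μ, (kerPow T μ 1).FG) {ι : ℂ → Type*}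
    (e : ∀ μ : ℂ, Module.Basis (ι μ) ℂ (rootSubspace T μ)) :
    IsMinimalFamily (fun p : Σ μ : ℂ, ι μ => (e p.1 p.2 : H)) := by
  refine isMinimalFamily_of_bases (fun μ => ?_)
    (isClosed_regularSubspace h.differentiable_det h.differentiable_num hν)
    (fun _ _ => h.rootSubspace_le_regularSubspace) (h.disjoint_regularSubspace_rootSubspace hν) e
  obtain ⟨m, hm⟩ := h.exists_rootSubspace_eq_kerPow hν μ
  exact hm ▸ fg_kerPow (hfin μ) m

end IsCharacteristicPair

end MinimalityCriterion

section MatrixSystems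

open unitInterval

variable {J : Type*} [Fintype J] [DecidableEq J]

/-- Multiplication by a matrix as a continuous linear map, depending linearly on the matrix. -/
noncomputable def mulVecOp : Matrix J J ℂ →ₗ[ℂ] (J → ℂ) →L[ℂ] (J → ℂ) :=
  LinearMap.toContinuousLinearMap.toLinearMap ∘ₗ Matrix.toLin'.toLinearMap

theorem mulVecOp_apply (A : Matrix J J ℂ) (v : J → ℂ) : mulVecOp A v = A *ᵥ v := rfl

theorem mulVecOp_eq_sum (A : Matrix J J ℂ) :
    mulVecOp A = ∑ i, ∑ j, A i j • mulVecOp (Matrix.single i j 1) := by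
  conv_lhs => rw [Matrix.matrix_eq_sum_single A]
  simp only [map_sum, ← map_smul, Matrix.smul_single, smul_eq_mul, mul_one]

theorem EntryIntegrable.mulVecOp {A : ℝ → Matrix J J ℂ} (hA : EntryIntegrable A) :
    IntervalIntegrable (fun t => mulVecOp (A t)) volume 0 1 := by
  have hterm (i j : J) : Integrable (fun t => A t i j • FirstOrderBVP.mulVecOp
      (Matrix.single i j (1 : ℂ))) (volume.restrict (uIoc 0 1)) :=
    (hA i j).def'.smul_const _
  rw [funext fun t => mulVecOp_eq_sum (A t), intervalIntegrable_iff]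
  exact integrable_finsetSum (ε' := (J → ℂ) →L[ℂ] J → ℂ) _ fun i _ =>
    integrable_finsetSum (ε' := (J → ℂ) →L[ℂ] J → ℂ) _ fun j _ => hterm i j

theorem differentiable_mulVecOp {A : ℂ → Matrix J J ℂ}
    (h : ∀ i j, Differentiable ℂ fun μ => A μ i j) : Differentiable ℂ fun μ => mulVecOp (A μ) := by
  rw [funext fun μ => mulVecOp_eq_sum (A μ)]
  exact Differentiable.fun_sum fun i _ => Differentiable.fun_sum fun j _ => (h i j).smul_const _

theorem differentiable_det {M : ℂ → Matrix J J ℂ} (h : ∀ i j, Differentiable ℂ fun μ => M μ i j) :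
    Differentiable ℂ fun μ => (M μ).det := by
  simp only [Matrix.det_apply']
  fun_prop

theorem differentiable_adjugate {M : ℂ → Matrix J J ℂ}
    (h : ∀ i j, Differentiable ℂ fun μ => M μ i j) (i j : J) :
    Differentiable ℂ fun μ => (M μ).adjugate i j := by
  simp only [Matrix.adjugate_apply]
  refine differentiable_det fun k l => ?_
  rcases eq_or_ne k j with rfl | hk
  · simp
  · simpa [Matrix.updateRow_ne hk] using h k l

variable {A : ℝ → Matrix J J ℂ}

/-- The solution `Φ` of `Φ' = A Φ`, `Φ(0) = 1`, on `[0, 1]`, extended by its boundary values. -/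
noncomputable def transitionMatrix (A : ℝ → Matrix J J ℂ) (hA : EntryIntegrable A) (x : ℝ) :
    Matrix J J ℂ :=
  Matrix.of fun i j => IccExtend zero_le_one
    (solutionOp (fun t => mulVecOp (A t)) hA.mulVecOp (ContinuousMap.const I (Pi.single j 1))) x i

theorem IccExtend_solutionOp_const (hA : EntryIntegrable A) (v : J → ℂ) (x : ℝ) :
    IccExtend zero_le_one (solutionOp _ hA.mulVecOp (ContinuousMap.const I v)) x =
      transitionMatrix A hA x *ᵥ v := by
  let L : (J → ℂ) →L[ℂ] J → ℂ := ContinuousMap.evalCLM ℂ (projIcc 0 1 zero_le_one x) ∘L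
    solutionOp _ hA.mulVecOp ∘L ContinuousLinearMap.const (R := ℂ) (M := J → ℂ) I
  change L v = _
  rw [← ContinuousLinearMap.coe_coe, ← LinearMap.toMatrix'_mulVec]
  congr 1

theorem solutionOp_const_apply (hA : EntryIntegrable A) (v : J → ℂ) (x : I) :
    solutionOp _ hA.mulVecOp (ContinuousMap.const I v) x = transitionMatrix A hA x *ᵥ v := by
  rw [← IccExtend_solutionOp_const hA, IccExtend_val]

theorem transitionMatrix_zero (hA : EntryIntegrable A) : transitionMatrix A hA 0 = 1 := by
  refine Matrix.ext_of_mulVec_single fun j => ?_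
  rw [Matrix.one_mulVec]
  refine (solutionOp_const_apply hA _ 0).symm.trans ?_
  rw [solutionOp_apply_zero, ContinuousMap.const_apply]

theorem isSolution_transitionMatrix_mulVec (hA : EntryIntegrable A) (v : J → ℂ) :
    IsSolution (fun t => mulVecOp (A t)) 0 fun x => transitionMatrix A hA x *ᵥ v := by
  rw [← funext (IccExtend_solutionOp_const hA v)]
  exact isSolution_solutionOp_const hA.mulVecOp v

theorem IsSolution.apply_eq_transitionMatrix_mulVec (hA : EntryIntegrable A) {y : ℝ → J → ℂ}
    (hy : IsSolution (fun t => mulVecOp (A t)) 0 y) (x : I) :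
    y x = transitionMatrix A hA x *ᵥ y 0 := by
  rw [hy.apply_eq_solutionOp_const hA.mulVecOp, solutionOp_const_apply]

theorem isMatrixSolution_transitionMatrix (hA : EntryIntegrable A) :
    IsMatrixSolution A (transitionMatrix A hA) := by
  have hcol := fun j => isSolution_transitionMatrix_mulVec hA (Pi.single j 1)
  simp only [Matrix.mulVec_single_one] at hcol
  refine ⟨fun i j => ac_pi_apply (hcol j).1 i, ?_⟩
  filter_upwards [Filter.eventually_all.2 fun j => (hcol j).2] with t hderiv ht i
  refine hasDerivAt_pi.2 fun j => (hasDerivAt_pi.1 (hderiv j ht) i).congr_deriv ?_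
  simp [mulVecOp_apply, Matrix.mul_apply, Matrix.mulVec, dotProduct]

theorem IsSolution.dotProduct_eq {ψ y : ℝ → J → ℂ}
    (hψ : IsSolution (fun t => mulVecOp (-(A t)ᵀ)) 0 ψ)
    (hy : IsSolution (fun t => mulVecOp (A t)) 0 y) {x : ℝ} (hx : x ∈ I) :
    ψ x ⬝ᵥ y x = ψ 0 ⬝ᵥ y 0 := by
  have hac : AbsolutelyContinuousOnInterval (fun t => ψ t ⬝ᵥ y t) 0 1 :=
    ac_finset_sum _ fun j _ => (ac_pi_apply hψ.1 j).fun_smul (ac_pi_apply hy.1 j)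
  have hderiv : ∀ᵐ t, t ∈ uIcc (0 : ℝ) 1 → HasDerivAt (fun t => ψ t ⬝ᵥ y t) 0 t := by
    rw [uIcc_of_le zero_le_one]
    filter_upwards [hψ.2, hy.2] with t hψt hyt ht
    refine (HasDerivAt.fun_sum (u := Finset.univ) fun j _ => (hasDerivAt_pi.1 (hψt ht) j).mul
      (hasDerivAt_pi.1 (hyt ht) j)).congr_deriv ?_
    simp only [Pi.zero_apply, add_zero, Finset.sum_add_distrib, mulVecOp_apply]
    change (-(A t)ᵀ *ᵥ ψ t) ⬝ᵥ y t + ψ t ⬝ᵥ (A t *ᵥ y t) = 0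
    rw [Matrix.neg_mulVec, neg_dotProduct, Matrix.mulVec_transpose, Matrix.dotProduct_mulVec,
      neg_add_cancel]
  simpa using ac_eq_add_integral (h := fun _ => (0 : ℂ)) hac intervalIntegrable_const hderiv
    (x := x) (by rwa [uIcc_of_le zero_le_one])

theorem isUnit_transitionMatrix (hA : EntryIntegrable A) {x : ℝ} (hx : x ∈ I) :
    IsUnit (transitionMatrix A hA x) := by
  have hadjoint : EntryIntegrable fun t => -(A t)ᵀ := fun i j => (hA j i).neg
  refine IsUnit.of_mul_eq_one_right (transitionMatrix _ hadjoint x)ᵀ ?_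
  ext i j
  have hdot := (isSolution_transitionMatrix_mulVec hadjoint (Pi.single i 1)).dotProduct_eq
    (isSolution_transitionMatrix_mulVec hA (Pi.single j 1)) hx
  rw [transitionMatrix_zero, transitionMatrix_zero] at hdot
  simpa [Matrix.mul_apply, dotProduct, Matrix.one_apply, Pi.single_apply, eq_comm] using hdot

end MatrixSystems

section System

variable {n : ℕ} {b : Fin n → ℂ} {Q : ℝ → Matrix (Fin n) (Fin n) ℂ} {μ : ℂ}

/-- The part `-i B Q` of the coefficient of `y' = (i μ B - i B Q) y + i B g` that does not depend
on `μ`. -/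
noncomputable def potential (b : Fin n → ℂ) (Q : ℝ → Matrix (Fin n) (Fin n) ℂ) (t : ℝ) :
    Matrix (Fin n) (Fin n) ℂ :=
  -(Matrix.diagonal (fun j => I * b j) * Q t)

/-- The coefficient `i μ B - i B Q` of the first order system `y' = (i μ B - i B Q) y + i B g`
to which `-i B⁻¹ y' + Q y = μ y + g` is equivalent. -/
noncomputable def coeffMatrix (b : Fin n → ℂ) (Q : ℝ → Matrix (Fin n) (Fin n) ℂ) (μ : ℂ) (t : ℝ) :
    Matrix (Fin n) (Fin n) ℂ :=
  Matrix.diagonal (fun j => I * b j * μ) + potential b Q t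

theorem coeffMatrix_eq_add_smul (b : Fin n → ℂ) (Q : ℝ → Matrix (Fin n) (Fin n) ℂ) (μ : ℂ)
    (t : ℝ) : coeffMatrix b Q μ t = potential b Q t + μ • Matrix.diagonal fun j => I * b j := by
  rw [coeffMatrix, add_comm, ← Matrix.diagonal_smul]
  congr 3
  exact funext fun j => mul_comm _ _

theorem coeffMatrix_mulVec (b : Fin n → ℂ) (Q : ℝ → Matrix (Fin n) (Fin n) ℂ) (μ : ℂ) (t : ℝ)
    (v : Fin n → ℂ) (j : Fin n) :
    (coeffMatrix b Q μ t *ᵥ v) j = I * b j * (μ * v j - (Q t *ᵥ v) j) := by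
  simp only [coeffMatrix, potential, Matrix.add_mulVec, Matrix.neg_mulVec, ← Matrix.mulVec_mulVec,
    Pi.add_apply, Pi.neg_apply, Matrix.mulVec_diagonal]
  ring

theorem EntryIntegrable.potential (hQ : EntryIntegrable Q) (b : Fin n → ℂ) :
    EntryIntegrable (potential b Q) := fun i j => by
  simpa only [FirstOrderBVP.potential, Matrix.neg_apply, Matrix.diagonal_mul] using!
    ((hQ i j).const_mul (I * b i)).neg

theorem EntryIntegrable.coeffMatrix (hQ : EntryIntegrable Q) (b : Fin n → ℂ) (μ : ℂ) :
    EntryIntegrable (coeffMatrix b Q μ) := fun i j =>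
  (intervalIntegrable_const (c := Matrix.diagonal (fun j => I * b j * μ) i j)).add
    (hQ.potential b i j)

theorem inv_diagonal_mulVec (hb : ∀ j, b j ≠ 0) (v : Fin n → ℂ) (j : Fin n) :
    ((Matrix.diagonal b)⁻¹ *ᵥ v) j = (b j)⁻¹ * v j := by
  have hinv : (Matrix.diagonal b)⁻¹ = Matrix.diagonal fun j => (b j)⁻¹ := by
    refine Matrix.inv_eq_right_inv ?_
    rw [Matrix.diagonal_mul_diagonal, ← Matrix.diagonal_one]
    exact congrArg _ (funext fun j => mul_inv_cancel₀ (hb j))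
  rw [hinv, Matrix.mulVec_diagonal]

theorem diffExpr_eq_iff (hb : ∀ j, b j ≠ 0) (Q : ℝ → Matrix (Fin n) (Fin n) ℂ) (μ : ℂ)
    {y : ℝ → Fin n → ℂ} {x : ℝ} (g : Fin n → ℂ) :
    diffExpr b Q y x = g + μ • y x ↔
      deriv y x = coeffMatrix b Q μ x *ᵥ y x + fun j => I * b j * g j := by
  rw [diffExpr, funext_iff, funext_iff]
  refine forall_congr' fun j => ?_
  simp only [Pi.add_apply, Pi.smul_apply, smul_eq_mul, coeffMatrix_mulVec, inv_diagonal_mulVec hb]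
  rw [← inv_I, ← mul_assoc, ← mul_inv, ← eq_sub_iff_add_eq,
    inv_mul_eq_iff_eq_mul₀ (mul_ne_zero I_ne_zero (hb j)), ← mul_add]
  exact Eq.congr_right (congrArg _ (by ring))

theorem isSolution_iff_diffExpr (hb : ∀ j, b j ≠ 0) (Q : ℝ → Matrix (Fin n) (Fin n) ℂ) (μ : ℂ)
    (g y : ℝ → Fin n → ℂ) :
    IsSolution (fun t => mulVecOp (coeffMatrix b Q μ t)) (fun x j => I * b j * g x j) y ↔
      AbsolutelyContinuousOnInterval y 0 1 ∧
        ∀ᵐ x ∂unitVol, diffExpr b Q y x = g x + μ • y x := by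
  refine and_congr_right fun hy => ?_
  rw [← ae_restrict_iff' measurableSet_Icc]
  refine Filter.eventually_congr ?_
  filter_upwards [ae_differentiableAt_of_ac hy] with x hx
  rw [diffExpr_eq_iff hb]
  exact ⟨fun h => h.deriv, fun h => hx.hasDerivAt.congr_deriv h⟩

end System

section L2

variable {n : ℕ}

instance isProbabilityMeasure_unitVol : IsProbabilityMeasure unitVol := ⟨by simp [unitVol]⟩

theorem integrable_of_L2 (g : L2 n) : Integrable g unitVol :=
  (Lp.memLp g).integrable one_le_two

theorem intervalIntegral_norm_le_norm (g : L2 n) : ∫ x in (0 : ℝ)..1, ‖g x‖ ≤ ‖g‖ := by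
  rw [intervalIntegral.integral_of_le zero_le_one, ← integral_Icc_eq_integral_Ioc,
    integral_norm_eq_lintegral_enorm (Lp.aestronglyMeasurable g), Lp.norm_def,
    ← eLpNorm_one_eq_lintegral_enorm]
  exact ENNReal.toReal_mono (Lp.memLp g).eLpNorm_ne_top
    (eLpNorm_le_eLpNorm_of_exponent_le one_le_two (Lp.aestronglyMeasurable g))

theorem intervalIntegrable_norm_L2 (g : L2 n) : IntervalIntegrable (fun x => ‖g x‖) volume 0 1 :=
  (intervalIntegrable_iff_integrableOn_Icc_of_le zero_le_one).2 (integrable_of_L2 g).norm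

/-- The source term `i B g` of the first order system `y' = (i μ B - i B Q) y + i B g`. -/
noncomputable def source (b : Fin n → ℂ) (g : L2 n) (x : ℝ) : Fin n → ℂ := fun j => I * b j * g x j

theorem intervalIntegrable_source_apply (b : Fin n → ℂ) (g : L2 n) (j : Fin n) :
    IntervalIntegrable (fun x => source b g x j) volume 0 1 := by
  rw [intervalIntegrable_iff_integrableOn_Icc_of_le zero_le_one]
  exact ((EuclideanSpace.proj (𝕜 := ℂ) j).integrable_comp (integrable_of_L2 g)).const_mul _

theorem intervalIntegrable_source (b : Fin n → ℂ) (g : L2 n) :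
    IntervalIntegrable (source b g) volume 0 1 :=
  ⟨Integrable.of_eval fun j => (intervalIntegrable_source_apply b g j).1,
    Integrable.of_eval fun j => (intervalIntegrable_source_apply b g j).2⟩

theorem norm_source_apply_le (b : Fin n → ℂ) (g : L2 n) (x : ℝ) (j : Fin n) :
    ‖source b g x j‖ ≤ ‖b‖ * ‖g x‖ := by
  rw [source, norm_mul, norm_mul, norm_I, one_mul]
  exact mul_le_mul (norm_le_pi_norm b j) (PiLp.norm_apply_le (g x) j) (norm_nonneg _)
    (norm_nonneg _)

/-- The primitive of the source term `i B g`, as an operator on `L²`. -/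
noncomputable def sourceOp (b : Fin n → ℂ) : L2 n →L[ℂ] C(unitInterval, Fin n → ℂ) :=
  LinearMap.mkContinuous
    { toFun := fun g => primitive (source b g) (intervalIntegrable_source b g)
      map_add' := fun g g' => by
        rw [← primitive_add]
        refine primitive_congr _ _ ?_
        filter_upwards [Lp.coeFn_add g g'] with t ht
        funext j
        simp only [source, ht, Pi.add_apply, PiLp.add_apply, mul_add]
      map_smul' := fun c g => by
        rw [← primitive_smul]
        refine primitive_congr _ _ ?_
        filter_upwards [Lp.coeFn_smul c g] with t ht
        funext j
        simp only [source, ht, Pi.smul_apply, PiLp.smul_apply, smul_eq_mul, RingHom.id_apply]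
        ring }
    ‖b‖ fun g => by
      refine (norm_primitive_le (intervalIntegrable_source b g)
        ((intervalIntegrable_norm_L2 g).const_mul ‖b‖) fun t =>
        (pi_norm_le_iff_of_nonneg (by positivity)).2 (norm_source_apply_le b g t)).trans ?_
      rw [intervalIntegral.integral_const_mul]
      exact mul_le_mul_of_nonneg_left (intervalIntegral_norm_le_norm g) (norm_nonneg b)

theorem sourceOp_apply (b : Fin n → ℂ) (g : L2 n) :
    sourceOp b g = primitive (source b g) (intervalIntegrable_source b g) := rfl

theorem memLp_unitVol_of_continuousOn {E : Type*} [NormedAddCommGroup E] {p : ENNReal}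
    {y : ℝ → E} (hy : ContinuousOn y (Icc 0 1)) : MemLp y p unitVol := by
  obtain ⟨M, hM⟩ := isCompact_Icc.exists_bound_of_continuousOn hy
  exact MemLp.of_bound (hy.aestronglyMeasurable_of_isCompact isCompact_Icc measurableSet_Icc) M
    ((ae_restrict_iff' measurableSet_Icc).2 (Filter.Eventually.of_forall hM))

theorem memLp_IccExtend {E : Type*} [NormedAddCommGroup E] (y : C(unitInterval, E)) :
    MemLp (IccExtend zero_le_one y) 2 unitVol :=
  memLp_unitVol_of_continuousOn y.continuous.Icc_extend'.continuousOn

/-- The embedding of the continuous functions on `[0, 1]` into `L²`. -/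
noncomputable def continuousToL2 (E : Type*) [NormedAddCommGroup E] [NormedSpace ℂ E] :
    C(unitInterval, E) →L[ℂ] Lp E 2 unitVol :=
  LinearMap.mkContinuous
    { toFun := fun y => (memLp_IccExtend y).toLp _
      map_add' := fun _ _ => rfl
      map_smul' := fun _ _ => rfl }
    1 fun y => by
      refine (Lp.norm_le_of_ae_bound (norm_nonneg y) ?_).trans_eq
        (by simp [measureUnivNNReal])
      filter_upwards [(memLp_IccExtend y).coeFn_toLp] with x hx
      exact hx ▸ norm_IccExtend_le y x

/-- The embedding of the continuous functions on `[0, 1]` into the Hilbert space `L²`; it passes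
from the supremum norm to the Euclidean norm on `ℂⁿ`. -/
noncomputable def embedL2 (n : ℕ) : C(unitInterval, Fin n → ℂ) →L[ℂ] L2 n :=
  ((EuclideanSpace.equiv (Fin n) ℂ).symm.toContinuousLinearMap.compLpL 2 unitVol) ∘L
    continuousToL2 (Fin n → ℂ)

theorem coeFn_embedL2 (y : C(unitInterval, Fin n → ℂ)) :
    ∀ᵐ x ∂unitVol, embedL2 n y x = WithLp.toLp 2 (IccExtend zero_le_one y x) := by
  filter_upwards [ContinuousLinearMap.coeFn_compLpL
    (EuclideanSpace.equiv (Fin n) ℂ).symm.toContinuousLinearMap (continuousToL2 (Fin n → ℂ) y),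
    (memLp_IccExtend y).coeFn_toLp] with x hcomp hy
  exact hcomp.trans (congrArg (WithLp.toLp 2) hy)

theorem eq_embedL2 {f : L2 n} {u : C(unitInterval, Fin n → ℂ)} {y : ℝ → Fin n → ℂ}
    (hf : ∀ᵐ x ∂unitVol, f x = WithLp.toLp 2 (y x)) (hu : ∀ x : unitInterval, y x = u x) :
    f = embedL2 n u := by
  refine Lp.ext ?_
  filter_upwards [hf, coeFn_embedL2 u, ae_restrict_mem measurableSet_Icc] with x hfx hux hx
  rw [hfx, hux, IccExtend_of_mem _ _ hx, ← hu]

theorem mem_bvpGraph_iff_isSolution {b : Fin n → ℂ} (hb : ∀ j, b j ≠ 0)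
    (Q : ℝ → Matrix (Fin n) (Fin n) ℂ) (C D : Matrix (Fin n) (Fin n) ℂ) (μ : ℂ) (f g : L2 n) :
    (f, g + μ • f) ∈ bvpGraph b Q C D ↔ ∃ y : ℝ → Fin n → ℂ,
      IsSolution (fun t => mulVecOp (coeffMatrix b Q μ t)) (source b g) y ∧
        (∀ᵐ x ∂unitVol, f x = WithLp.toLp 2 (y x)) ∧ C *ᵥ y 0 + D *ᵥ y 1 = 0 := by
  refine exists_congr fun y => ?_
  change _ ↔ IsSolution _ (fun x j => I * b j * (g x).ofLp j) y ∧ _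
  rw [isSolution_iff_diffExpr hb Q μ (fun x => (g x).ofLp), and_assoc]
  refine and_congr_right fun _ => ?_
  rw [and_left_comm]
  refine and_congr_left fun ⟨hf, _⟩ => Filter.eventually_congr ?_
  filter_upwards [hf, Lp.coeFn_add g (μ • f), Lp.coeFn_smul μ f] with x hfx hadd hsmul
  rw [hadd, Pi.add_apply, hsmul, Pi.smul_apply, hfx, ← (WithLp.ofLp_injective 2).eq_iff, eq_comm]
  rfl

end L2

section CharacteristicPairOfSystem

variable {n : ℕ} {b : Fin n → ℂ} {Q : ℝ → Matrix (Fin n) (Fin n) ℂ}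

/-- The solution operator of the first order system with spectral parameter `μ`: it sends
`v + ∫₀ˣ i B g` to the solution of `y' = (i μ B - i B Q) y + i B g` with `y(0) = v`. -/
noncomputable def systemOp (hQ : EntryIntegrable Q) (b : Fin n → ℂ) (μ : ℂ) :
    C(unitInterval, Fin n → ℂ) →L[ℂ] C(unitInterval, Fin n → ℂ) :=
  solutionOp (fun t => mulVecOp (coeffMatrix b Q μ t)) (hQ.coeffMatrix b μ).mulVecOp

theorem differentiable_systemOp (hQ : EntryIntegrable Q) (b : Fin n → ℂ) :
    Differentiable ℂ (systemOp hQ b) := by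
  have haffine (μ : ℂ) : (fun t => mulVecOp (coeffMatrix b Q μ t)) = fun t =>
      mulVecOp (potential b Q t) + μ • mulVecOp (Matrix.diagonal fun j => I * b j) :=
    funext fun t => by rw [coeffMatrix_eq_add_smul, map_add, map_smul]
  unfold systemOp
  simp only [haffine]
  exact differentiable_solutionOp (hQ.potential b).mulVecOp intervalIntegrable_const

/-- The fundamental matrix `Φ(·, μ)`, constructed from the solution operator. -/
noncomputable def propagator (hQ : EntryIntegrable Q) (b : Fin n → ℂ) (μ : ℂ) :
    ℝ → Matrix (Fin n) (Fin n) ℂ :=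
  transitionMatrix (coeffMatrix b Q μ) (hQ.coeffMatrix b μ)

theorem systemOp_const_apply (hQ : EntryIntegrable Q) (b : Fin n → ℂ) (μ : ℂ) (v : Fin n → ℂ)
    (x : unitInterval) :
    systemOp hQ b μ (ContinuousMap.const _ v) x = propagator hQ b μ x *ᵥ v :=
  solutionOp_const_apply (hQ.coeffMatrix b μ) v x

theorem differentiable_propagator (hQ : EntryIntegrable Q) (b : Fin n → ℂ) (x : ℝ)
    (i j : Fin n) : Differentiable ℂ fun μ => propagator hQ b μ x i j :=
  ((ContinuousLinearMap.proj (R := ℂ) (φ := fun _ : Fin n => ℂ) i) ∘L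
    ContinuousMap.evalCLM ℂ (projIcc 0 1 zero_le_one x)).differentiable.comp
    ((differentiable_systemOp hQ b).clm_apply
      (differentiable_const (ContinuousMap.const _ (Pi.single j 1))))

theorem isFundamentalMatrix_iff (hb : ∀ j, b j ≠ 0) (μ : ℂ)
    (Φ : ℝ → Matrix (Fin n) (Fin n) ℂ) :
    IsFundamentalMatrix b Q μ Φ ↔ Φ 0 = 1 ∧
      ∀ k, IsSolution (fun t => mulVecOp (coeffMatrix b Q μ t)) 0 fun x => (Φ x).col k := by
  refine and_congr_right fun _ => forall_congr' fun k => ?_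
  have hiff := isSolution_iff_diffExpr hb Q μ 0 fun x => (Φ x).col k
  simp only [Pi.zero_apply, mul_zero, zero_add] at hiff
  exact hiff.symm

theorem isFundamentalMatrix_propagator (hb : ∀ j, b j ≠ 0) (hQ : EntryIntegrable Q) (μ : ℂ) :
    IsFundamentalMatrix b Q μ (propagator hQ b μ) := by
  refine (isFundamentalMatrix_iff hb μ _).2 ⟨transitionMatrix_zero _, fun k => ?_⟩
  simpa only [Matrix.mulVec_single_one, propagator] using
    isSolution_transitionMatrix_mulVec (hQ.coeffMatrix b μ) (Pi.single k 1)

theorem IsFundamentalMatrix.eq_propagator (hb : ∀ j, b j ≠ 0) (hQ : EntryIntegrable Q) {μ : ℂ}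
    {Φ : ℝ → Matrix (Fin n) (Fin n) ℂ} (hΦ : IsFundamentalMatrix b Q μ Φ) (x : unitInterval) :
    Φ x = propagator hQ b μ x := by
  obtain ⟨hΦ0, hcol⟩ := (isFundamentalMatrix_iff hb μ Φ).1 hΦ
  ext i k
  have hx := (hcol k).apply_eq_transitionMatrix_mulVec (hQ.coeffMatrix b μ) x
  have hinit : (Φ 0).col k = Pi.single k 1 := by
    rw [hΦ0, ← Matrix.mulVec_single_one, Matrix.one_mulVec]
  rw [hinit, Matrix.mulVec_single_one] at hx
  exact congrFun hx i

/-- The boundary matrix `C + D Φ(1, μ)`, whose determinant is the characteristic determinant. -/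
noncomputable def boundaryMatrix (hQ : EntryIntegrable Q) (b : Fin n → ℂ)
    (C D : Matrix (Fin n) (Fin n) ℂ) (μ : ℂ) : Matrix (Fin n) (Fin n) ℂ :=
  C + D * propagator hQ b μ 1

theorem charDet_eq_det_boundaryMatrix (hb : ∀ j, b j ≠ 0) (hQ : EntryIntegrable Q)
    (C D : Matrix (Fin n) (Fin n) ℂ) (μ : ℂ) :
    charDet b Q C D μ = (boundaryMatrix hQ b C D μ).det := by
  have hΦ : IsFundamentalMatrix b Q μ (fundamentalMatrix b Q μ) :=
    Classical.epsilon_spec ⟨_, isFundamentalMatrix_propagator hb hQ μ⟩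
  rw [charDet, boundaryMatrix]
  exact congrArg (fun Φ => (C + D * Φ).det) (hΦ.eq_propagator hb hQ 1)

theorem boundaryMatrix_mulVec (hQ : EntryIntegrable Q) (b : Fin n → ℂ)
    (C D : Matrix (Fin n) (Fin n) ℂ) (μ : ℂ) (v : Fin n → ℂ) :
    boundaryMatrix hQ b C D μ *ᵥ v =
      C *ᵥ v + D *ᵥ systemOp hQ b μ (ContinuousMap.const _ v) 1 := by
  rw [boundaryMatrix, Matrix.add_mulVec, ← Matrix.mulVec_mulVec, systemOp_const_apply]
  rfl

theorem differentiable_boundaryMatrix (hQ : EntryIntegrable Q) (b : Fin n → ℂ)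
    (C D : Matrix (Fin n) (Fin n) ℂ) (i j : Fin n) :
    Differentiable ℂ fun μ => boundaryMatrix hQ b C D μ i j := by
  have hΦ := differentiable_propagator hQ b 1
  simp only [boundaryMatrix, Matrix.add_apply, Matrix.mul_apply]
  fun_prop

/-- The resolvent of `L_{C,D}(Q)` at `μ` multiplied by the characteristic determinant: solving
`(C + D Φ(1)) v = -D y_g(1)` for the initial value `v` by the adjugate matrix, where `y_g` is the
solution with source `g` and `y_g(0) = 0`, makes it an entire function of `μ`. -/
noncomputable def resolventNum (hQ : EntryIntegrable Q) (b : Fin n → ℂ)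
    (C D : Matrix (Fin n) (Fin n) ℂ) (μ : ℂ) : L2 n →L[ℂ] L2 n :=
  embedL2 n ∘L systemOp hQ b μ ∘L ((boundaryMatrix hQ b C D μ).det • sourceOp b -
    ContinuousLinearMap.const (R := ℂ) (M := Fin n → ℂ) unitInterval ∘L
      mulVecOp (boundaryMatrix hQ b C D μ).adjugate ∘L mulVecOp D ∘L
        ContinuousMap.evalCLM ℂ 1 ∘L systemOp hQ b μ ∘L sourceOp b)

theorem resolventNum_apply (hQ : EntryIntegrable Q) (b : Fin n → ℂ)
    (C D : Matrix (Fin n) (Fin n) ℂ) (μ : ℂ) (g : L2 n) :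
    resolventNum hQ b C D μ g = embedL2 n (systemOp hQ b μ
      ((boundaryMatrix hQ b C D μ).det • sourceOp b g - ContinuousMap.const _
        ((boundaryMatrix hQ b C D μ).adjugate *ᵥ
          (D *ᵥ systemOp hQ b μ (sourceOp b g) 1)))) := rfl

theorem differentiable_resolventNum (hQ : EntryIntegrable Q) (b : Fin n → ℂ)
    (C D : Matrix (Fin n) (Fin n) ℂ) : Differentiable ℂ (resolventNum hQ b C D) := by
  have hsystem := differentiable_systemOp hQ b
  have hdet := differentiable_det (differentiable_boundaryMatrix hQ b C D)
  have hadj := differentiable_mulVecOp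
    (differentiable_adjugate (differentiable_boundaryMatrix hQ b C D))
  exact (differentiable_const _).clm_comp (hsystem.clm_comp ((hdet.smul_const _).sub
    ((differentiable_const _).clm_comp (hadj.clm_comp ((differentiable_const _).clm_comp
    ((differentiable_const _).clm_comp (hsystem.clm_comp (differentiable_const _))))))))

theorem mem_bvpGraph_iff (hb : ∀ j, b j ≠ 0) (hQ : EntryIntegrable Q)
    (C D : Matrix (Fin n) (Fin n) ℂ) (μ : ℂ) (f g : L2 n) :
    (f, g + μ • f) ∈ bvpGraph b Q C D ↔ ∃ v : Fin n → ℂ,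
      f = embedL2 n (systemOp hQ b μ (ContinuousMap.const _ v + sourceOp b g)) ∧
        boundaryMatrix hQ b C D μ *ᵥ v + D *ᵥ systemOp hQ b μ (sourceOp b g) 1 = 0 := by
  have hboundary (v : Fin n → ℂ) :
      boundaryMatrix hQ b C D μ *ᵥ v + D *ᵥ systemOp hQ b μ (sourceOp b g) 1 =
        C *ᵥ v + D *ᵥ systemOp hQ b μ (ContinuousMap.const _ v + sourceOp b g) 1 := by
    rw [boundaryMatrix_mulVec, map_add, ContinuousMap.add_apply, Matrix.mulVec_add, add_assoc]
  simp only [mem_bvpGraph_iff_isSolution hb, hboundary]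
  constructor
  · rintro ⟨y, hy, hf, hCD⟩
    have hval := hy.apply_eq_solutionOp (hQ.coeffMatrix b μ).mulVecOp
      (intervalIntegrable_source b g)
    refine ⟨y 0, eq_embedL2 hf hval, ?_⟩
    rwa [systemOp, sourceOp_apply, ← hval 1]
  · rintro ⟨v, rfl, hCD⟩
    refine ⟨_, isSolution_solutionOp (hQ.coeffMatrix b μ).mulVecOp
      (intervalIntegrable_source b g) v, coeFn_embedL2 _, ?_⟩
    rw [IccExtend_left, IccExtend_right]
    convert hCD using 3
    · exact (solutionOp_apply_zero _ _).trans (by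
        rw [ContinuousMap.add_apply, primitive_apply_zero, add_zero, ContinuousMap.const_apply])
    · rfl

theorem isCharacteristicPair_bvp (hb : ∀ j, b j ≠ 0) (hQ : EntryIntegrable Q)
    (C D : Matrix (Fin n) (Fin n) ℂ) :
    IsCharacteristicPair (bvpOperator b Q C D) (fun μ => (boundaryMatrix hQ b C D μ).det)
      (resolventNum hQ b C D) where
  differentiable_det := differentiable_det (differentiable_boundaryMatrix hQ b C D)
  differentiable_num := differentiable_resolventNum hQ b C D
  mem_graph μ g := by
    rw [bvpOperator_graph, mem_bvpGraph_iff hb hQ]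
    refine ⟨-((boundaryMatrix hQ b C D μ).adjugate *ᵥ
      (D *ᵥ systemOp hQ b μ (sourceOp b g) 1)), ?_, ?_⟩
    · rw [resolventNum_apply, map_smul, sub_eq_neg_add]
      rfl
    · rw [Matrix.mulVec_neg, Matrix.mulVec_mulVec, Matrix.mul_adjugate, map_smul, map_smul,
        ContinuousMap.smul_apply, Matrix.mulVec_smul, Matrix.smul_mulVec, Matrix.one_mulVec,
        neg_add_cancel]
  num_apply μ y w h := by
    obtain ⟨g, rfl⟩ : ∃ g, w = g + μ • y := ⟨w - μ • y, by simp⟩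
    rw [bvpOperator_graph, mem_bvpGraph_iff hb hQ] at h
    obtain ⟨v, rfl, hv⟩ := h
    have hsource : (boundaryMatrix hQ b C D μ).det • (ContinuousMap.const _ v + sourceOp b g) =
        (boundaryMatrix hQ b C D μ).det • sourceOp b g -
          ContinuousMap.const _ (-((boundaryMatrix hQ b C D μ).det • v)) := by
      ext x j
      simp only [ContinuousMap.smul_apply, ContinuousMap.add_apply, ContinuousMap.sub_apply,
        ContinuousMap.const_apply, Pi.smul_apply, Pi.add_apply, Pi.sub_apply, Pi.neg_apply,
        smul_eq_mul]
      ring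
    rw [add_sub_cancel_right, resolventNum_apply, eq_neg_of_add_eq_zero_right hv,
      Matrix.mulVec_neg, Matrix.mulVec_mulVec, Matrix.adjugate_mul, Matrix.smul_mulVec,
      Matrix.one_mulVec, ← hsource, map_smul, map_smul]

theorem fg_kerPow_one_bvp (hb : ∀ j, b j ≠ 0) (hQ : EntryIntegrable Q)
    (C D : Matrix (Fin n) (Fin n) ℂ) (μ : ℂ) : (kerPow (bvpOperator b Q C D) μ 1).FG := by
  let solutions : (Fin n → ℂ) →L[ℂ] L2 n :=
    embedL2 n ∘L systemOp hQ b μ ∘L ContinuousLinearMap.const (R := ℂ) (M := Fin n → ℂ) unitInterval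
  refine Submodule.FG.of_le (T := LinearMap.range solutions.toLinearMap) ?_ fun y hy => ?_
  · rw [LinearMap.range_eq_map]
    exact Module.Finite.fg_top.map _
  · obtain ⟨w, hw, hgraph⟩ := mem_kerPow_succ.1 hy
    rw [show w = 0 from hw, bvpOperator_graph, mem_bvpGraph_iff hb hQ] at hgraph
    obtain ⟨v, hv, -⟩ := hgraph
    rw [map_zero, add_zero] at hv
    exact ⟨v, hv.symm⟩

end CharacteristicPairOfSystem

section DenseDomain

theorem IsSolution.congr_source {E : Type*} [NormedAddCommGroup E] [NormedSpace ℂ E]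
    {A : ℝ → E →L[ℂ] E} {h h' y : ℝ → E} (hy : IsSolution A h y) (hh : h =ᵐ[unitVol] h') :
    IsSolution A h' y := by
  refine ⟨hy.1, ?_⟩
  filter_upwards [hy.2, (ae_restrict_iff' measurableSet_Icc).1 hh] with x hderiv hx hxI
  exact hx hxI ▸ hderiv hxI

theorem IsSolution.cutoff_smul {J : Type*} [Fintype J] {A : ℝ → (J → ℂ) →L[ℂ] J → ℂ}
    {y : ℝ → J → ℂ} (hy : IsSolution A 0 y) {φ : ℝ → ℝ} (hφ : ContDiff ℝ 1 φ)
    (hφc : HasCompactSupport φ) :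
    IsSolution A (fun x => deriv φ x • y x) fun x => φ x • y x := by
  obtain ⟨K, hK⟩ := hφ.lipschitzWith_of_hasCompactSupport hφc one_ne_zero
  refine ⟨hK.lipschitzOnWith.absolutelyContinuousOnInterval.fun_smul hy.1, ?_⟩
  filter_upwards [hy.2] with x hx hxI
  refine ((hφ.differentiable one_ne_zero x).hasDerivAt.smul (hx hxI)).congr_deriv ?_
  rw [Pi.zero_apply, add_zero, ← (A x).map_smul_of_tower]

variable {n : ℕ} {b : Fin n → ℂ} {Q : ℝ → Matrix (Fin n) (Fin n) ℂ}

theorem memLp_toLp_of_continuousOn {y : ℝ → Fin n → ℂ} (hy : ContinuousOn y (Icc 0 1)) :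
    MemLp (fun x => WithLp.toLp 2 (y x) : ℝ → EuclideanSpace ℂ (Fin n)) 2 unitVol :=
  memLp_unitVol_of_continuousOn ((PiLp.continuous_toLp 2 _).comp_continuousOn hy)

theorem exists_source_eq (hb : ∀ j, b j ≠ 0) {h : ℝ → Fin n → ℂ}
    (hh : ContinuousOn h (Icc 0 1)) : ∃ g : L2 n, ∀ᵐ x ∂unitVol, source b g x = h x := by
  have hg := memLp_toLp_of_continuousOn
    ((mulVecOp (Matrix.diagonal fun j => (I * b j)⁻¹)).continuous.comp_continuousOn hh)
  let g : L2 n := hg.toLp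
  refine ⟨g, ?_⟩
  filter_upwards [hg.coeFn_toLp] with x hx
  funext j
  have hgj : g x j = (I * b j)⁻¹ * h x j := by
    rw [hx]
    exact Matrix.mulVec_diagonal (fun j => (I * b j)⁻¹) (h x) j
  rw [source, hgj, mul_inv_cancel_left₀ (mul_ne_zero I_ne_zero (hb j))]

theorem IsSolution.exists_mem_domain_bvp (hb : ∀ j, b j ≠ 0) {C D : Matrix (Fin n) (Fin n) ℂ}
    {μ : ℂ} {g : L2 n} {y : ℝ → Fin n → ℂ}
    (hy : IsSolution (fun t => mulVecOp (coeffMatrix b Q μ t)) (source b g) y)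
    (hCD : C *ᵥ y 0 + D *ᵥ y 1 = 0) :
    ∃ f ∈ (bvpOperator b Q C D).domain, ∀ᵐ x ∂unitVol, f x = WithLp.toLp 2 (y x) := by
  have hf := memLp_toLp_of_continuousOn hy.continuousOn
  refine ⟨hf.toLp, LinearPMap.mem_domain_of_mem_graph (y := g + μ • hf.toLp) ?_, hf.coeFn_toLp⟩
  rw [bvpOperator_graph, mem_bvpGraph_iff_isSolution hb]
  exact ⟨y, hy, hf.coeFn_toLp, hCD⟩

theorem exists_cutoff_mem_domain_bvp (hb : ∀ j, b j ≠ 0) {C D : Matrix (Fin n) (Fin n) ℂ}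
    {μ : ℂ} {y : ℝ → Fin n → ℂ} (hy : IsSolution (fun t => mulVecOp (coeffMatrix b Q μ t)) 0 y)
    {φ : ℝ → ℝ} (hφ : ContDiff ℝ 1 φ) (hφc : HasCompactSupport φ) (hφs : tsupport φ ⊆ Ioo 0 1) :
    ∃ f ∈ (bvpOperator b Q C D).domain,
      ∀ᵐ x ∂unitVol, f x = WithLp.toLp 2 (φ x • y x) := by
  have hzero {x : ℝ} (hx : x ∉ Ioo (0 : ℝ) 1) : φ x = 0 :=
    image_eq_zero_of_notMem_tsupport fun hmem => hx (hφs hmem)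
  obtain ⟨g, hg⟩ := exists_source_eq hb
    ((hφ.continuous_deriv le_rfl).continuousOn.smul hy.continuousOn)
  refine ((hy.cutoff_smul hφ hφc).congr_source ?_).exists_mem_domain_bvp hb (g := g) ?_
  · filter_upwards [hg] with x hx using hx.symm
  · rw [hzero (by simp), hzero (by simp), zero_smul, zero_smul, Matrix.mulVec_zero,
      Matrix.mulVec_zero, add_zero]

theorem ae_inner_eq_zero_of_mem_orthogonal_domain_bvp (hb : ∀ j, b j ≠ 0)
    {C D : Matrix (Fin n) (Fin n) ℂ} {h : L2 n} (hh : h ∈ (bvpOperator b Q C D).domainᗮ)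
    {μ : ℂ} {y : ℝ → Fin n → ℂ}
    (hy : IsSolution (fun t => mulVecOp (coeffMatrix b Q μ t)) 0 y) :
    ∀ᵐ x ∂unitVol, inner ℂ (h x) (WithLp.toLp 2 (y x)) = 0 := by
  have hmem := memLp_toLp_of_continuousOn hy.continuousOn
  have h_int : IntegrableOn (fun x => inner ℂ (h x) (WithLp.toLp 2 (y x))) (Icc (0 : ℝ) 1) := by
    refine (L2.integrable_inner (𝕜 := ℂ) h hmem.toLp).congr ?_
    filter_upwards [hmem.coeFn_toLp] with x hx
    rw [hx]
  have hIoo : ∀ᵐ x, x ∈ Ioo (0 : ℝ) 1 → inner ℂ (h x) (WithLp.toLp 2 (y x)) = 0 := by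
    refine isOpen_Ioo.ae_eq_zero_of_integral_contDiff_smul_eq_zero
      (h_int.mono_set Ioo_subset_Icc_self).locallyIntegrableOn fun φ hφ hφc hφs => ?_
    obtain ⟨f, hf, hfx⟩ := exists_cutoff_mem_domain_bvp (C := C) (D := D) hb hy
      (hφ.of_le (by exact_mod_cast le_top)) hφc hφs
    have horth := (Submodule.mem_orthogonal' _ _).1 hh f hf
    rw [L2.inner_def] at horth
    rw [← setIntegral_eq_integral_of_forall_compl_eq_zero (s := Icc (0 : ℝ) 1), ← horth]
    · refine integral_congr_ae ?_
      filter_upwards [hfx] with x hx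
      rw [hx, WithLp.toLp_smul, inner_smul_right_eq_smul]
    · intro x hx
      rw [image_eq_zero_of_notMem_tsupport fun hmem => hx (Ioo_subset_Icc_self (hφs hmem)),
        zero_smul]
  rw [ae_restrict_iff' measurableSet_Icc]
  filter_upwards [hIoo, ae_mem_Ioo_of_mem_Icc] with x hx hxI using hx ∘ hxI

theorem dense_domain_bvp (hb : ∀ j, b j ≠ 0) (hQ : EntryIntegrable Q)
    (C D : Matrix (Fin n) (Fin n) ℂ) : Dense ((bvpOperator b Q C D).domain : Set (L2 n)) := by
  rw [Submodule.dense_iff_topologicalClosure_eq_top, Submodule.topologicalClosure_eq_top_iff,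
    Submodule.eq_bot_iff]
  intro h hh
  have hcol (k : Fin n) := ae_inner_eq_zero_of_mem_orthogonal_domain_bvp hb hh
    (isSolution_transitionMatrix_mulVec (hQ.coeffMatrix b 0) (Pi.single k 1))
  refine Lp.ext ?_
  filter_upwards [Filter.eventually_all.2 hcol, ae_restrict_mem measurableSet_Icc,
    Lp.coeFn_zero (EuclideanSpace ℂ (Fin n)) 2 unitVol] with x hx hxI hzero
  have hvecMul : star (h x).ofLp ᵥ* transitionMatrix _ (hQ.coeffMatrix b 0) x = 0 := by
    funext k
    refine Eq.trans ?_ (hx k)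
    simp only [Matrix.mulVec_single_one, PiLp.inner_apply, RCLike.inner_apply']
    rfl
  have hstar := Matrix.vecMul_injective_of_isUnit (isUnit_transitionMatrix _ hxI)
    (hvecMul.trans (Matrix.zero_vecMul _).symm)
  rw [hzero]
  exact WithLp.ofLp_injective 2 (star_eq_zero.1 hstar)

end DenseDomain

section BorderedSystem

variable {J : Type*}

/-- The matrix `A` bordered by the column `u`, the row `v` and the corner entry `a`. -/
def bordered (A : Matrix J J ℂ) (u v : J → ℂ) (a : ℂ) : Matrix (J ⊕ Unit) (J ⊕ Unit) ℂ :=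
  Matrix.fromBlocks A (Matrix.replicateCol Unit u) (Matrix.replicateRow Unit v)
    (Matrix.of fun _ _ => a)

theorem bordered_one_zero [DecidableEq J] : bordered (1 : Matrix J J ℂ) 0 0 1 = 1 := by
  rw [bordered, ← Matrix.fromBlocks_one]
  congr 1

theorem bordered_diagonal_add [DecidableEq J] (a : J → ℂ) (P : Matrix J J ℂ) (u : J → ℂ) :
    bordered (Matrix.diagonal a + P) u 0 0 =
      Matrix.diagonal (Sum.elim a fun _ => 0) + bordered P u 0 0 := by
  ext (i | i) (j | j) <;> simp [bordered, Matrix.diagonal_apply]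

theorem EntryIntegrable.bordered {P : ℝ → Matrix J J ℂ} {h : ℝ → J → ℂ} (hP : EntryIntegrable P)
    (hh : ∀ j, IntervalIntegrable (fun t => h t j) volume 0 1) :
    EntryIntegrable fun t => bordered (P t) (h t) 0 0 := by
  rintro (i | i) (_ | _)
  exacts [hP i _, hh i, intervalIntegrable_const, intervalIntegrable_const]

variable [Fintype J]

theorem entrySum_bordered (A : Matrix J J ℂ) (u : J → ℂ) :
    entrySum (bordered A u 0 0) = entrySum A + ∑ i, ‖u i‖ := by
  simp [entrySum, bordered, Fintype.sum_sum_type, Finset.sum_add_distrib]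

theorem re_sum_le_sum_max_re (a : J → ℂ) (T : Finset J) :
    (∑ j ∈ T, a j).re ≤ ∑ j, max (a j).re 0 := by
  rw [re_sum]
  exact (Finset.sum_le_sum fun j _ => le_max_left _ _).trans
    (Finset.sum_le_sum_of_subset_of_nonneg T.subset_univ fun _ _ _ => le_max_right _ _)

variable [DecidableEq J]

/-- The sum of the absolute values of the coefficients in the expansion of
`det (∑ k, T k * M k)` by multilinearity in the rows of the matrices `M k`. -/
noncomputable def rowExpansionWeight (T : Fin 3 → Matrix J J ℂ) : ℝ :=
  ∑ r : J → Fin 3 × J, ∏ j, ‖T (r j).1 j (r j).2‖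

theorem rowExpansionWeight_nonneg (T : Fin 3 → Matrix J J ℂ) : 0 ≤ rowExpansionWeight T :=
  Finset.sum_nonneg fun _ _ => Finset.prod_nonneg fun _ _ => norm_nonneg _

theorem norm_det_add_mul_add_mul_le {a : J → ℂ} {P M : ℝ → Matrix J J ℂ} (hP : EntryIntegrable P)
    (hM : IsMatrixSolution (fun t => Matrix.diagonal a + P t) M) (hM0 : M 0 = 1) {x : ℝ}
    (hx : x ∈ Icc (0 : ℝ) 1) (C E D : Matrix J J ℂ) :
    ‖(C + E * M x + D * M 1).det‖ ≤ rowExpansionWeight ![C, E, D] *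
      Real.exp ((∑ j, max (a j).re 0) + ∫ t in (0 : ℝ)..1, entrySum (P t)) := by
  have row_expansion : C + E * M x + D * M 1 = Matrix.of fun j => ∑ s : Fin 3 × J,
      (![C, E, D] s.1 j s.2) • M ((![0, x, 1] : Fin 3 → ℝ) s.1) s.2 := by
    ext j k
    rw [Matrix.of_apply, Fintype.sum_prod_type, Fin.sum_univ_three]
    change _ = (∑ l, C j l • M 0 l + ∑ l, E j l • M x l + ∑ l, D j l • M 1 l) k
    simp [hM0, Matrix.mul_apply, Matrix.one_apply]
  rw [row_expansion]
  exact norm_det_sum_smul_le _ _ fun r => norm_det_rows_le hP hM hM0 (re_sum_le_sum_max_re a) hx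
    (fun j => (r j).2) fun j => (r j).1

theorem det_bordered {A : Matrix J J ℂ} (hA : IsUnit A.det) (u v : J → ℂ) (a : ℂ) :
    (bordered A u v a).det = A.det * a - v ⬝ᵥ (A.adjugate *ᵥ u) := by
  let _ := Matrix.invertibleOfIsUnitDet A hA
  have hadj : A.adjugate = A.det • ⅟A := by
    rw [← Matrix.mul_one A.adjugate, ← mul_invOf_self A, ← Matrix.mul_assoc,
      Matrix.adjugate_mul, Matrix.smul_mul, Matrix.one_mul]
  have hcorner : (Matrix.replicateRow Unit v * ⅟A * Matrix.replicateCol Unit u) () () =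
      v ⬝ᵥ (⅟A *ᵥ u) := by
    rw [Matrix.mul_assoc, ← Matrix.replicateCol_mulVec]
    rfl
  rw [bordered, Matrix.det_fromBlocks₁₁, Matrix.det_unique (n := Unit), Matrix.sub_apply, mul_sub,
    Matrix.of_apply, hadj, Matrix.smul_mulVec, dotProduct_smul, smul_eq_mul]
  exact congrArg _ (congrArg _ hcorner)

theorem IsMatrixSolution.bordered {A M : ℝ → Matrix J J ℂ} {h y : ℝ → J → ℂ}
    (hM : IsMatrixSolution A M) (hy : IsSolution (fun t => mulVecOp (A t)) h y) :
    IsMatrixSolution (fun t => bordered (A t) (h t) 0 0) fun t => bordered (M t) (y t) 0 1 := by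
  refine ⟨?_, ?_⟩
  · rintro (i | i) (_ | _)
    exacts [hM.1 i _, ac_pi_apply hy.1 i, ac_const _ _ _, ac_const _ _ _]
  · filter_upwards [hM.2, hy.2] with t hMt hyt ht
    rintro (i | _) <;> refine hasDerivAt_pi.2 ?_ <;> rintro (j | _)
    · refine (hasDerivAt_pi.1 (hMt ht i) j).congr_deriv ?_
      simp [FirstOrderBVP.bordered, Matrix.mul_apply]
    · refine (hasDerivAt_pi.1 (hyt ht) i).congr_deriv ?_
      simp [FirstOrderBVP.bordered, Matrix.mul_apply, Matrix.mulVec,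
        dotProduct, mulVecOp_apply]
    · refine (hasDerivAt_const t (0 : ℂ)).congr_deriv ?_
      simp [FirstOrderBVP.bordered, Matrix.mul_apply]
    · refine (hasDerivAt_const t (1 : ℂ)).congr_deriv ?_
      simp [FirstOrderBVP.bordered, Matrix.mul_apply]

theorem bordered_boundary_eq (C D M₁ : Matrix J J ℂ) (y₁ : J → ℂ) (M₂ : Matrix J J ℂ)
    (y₂ : J → ℂ) (i : J) :
    bordered (C + D * M₁) (D *ᵥ y₁) (M₂ i) (y₂ i) = bordered C 0 0 0 +
      Matrix.single (Sum.inr ()) (Sum.inl i) 1 * bordered M₂ y₂ 0 1 +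
        bordered D 0 0 0 * bordered M₁ y₁ 0 1 := by
  ext (j | j) (k | k) <;>
    simp [bordered, Matrix.mul_apply, Matrix.mulVec, dotProduct, Matrix.single_apply]

theorem norm_det_bordered_boundary_le {a : J → ℂ} {P M : ℝ → Matrix J J ℂ} {h y : ℝ → J → ℂ}
    (hP : EntryIntegrable P) (hh : ∀ j, IntervalIntegrable (fun t => h t j) volume 0 1)
    (hM : IsMatrixSolution (fun t => Matrix.diagonal a + P t) M) (hM0 : M 0 = 1)
    (hy : IsSolution (fun t => mulVecOp (Matrix.diagonal a + P t)) h y) (hy0 : y 0 = 0)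
    {x : ℝ} (hx : x ∈ Icc (0 : ℝ) 1) (C D : Matrix J J ℂ) (i : J) :
    ‖(bordered (C + D * M 1) (D *ᵥ y 1) (M x i) (y x i)).det‖ ≤
      rowExpansionWeight ![bordered C 0 0 0, Matrix.single (Sum.inr ()) (Sum.inl i) 1,
          bordered D 0 0 0] *
        Real.exp ((∑ j, max (a j).re 0) + ∫ t in (0 : ℝ)..1, (entrySum (P t) + ∑ j, ‖h t j‖)) := by
  have hsol := hM.bordered hy
  simp only [bordered_diagonal_add] at hsol
  have hinit : bordered (M 0) (y 0) 0 1 = 1 := by rw [hM0, hy0, bordered_one_zero]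
  rw [bordered_boundary_eq]
  simpa [entrySum_bordered, Fintype.sum_sum_type] using
    norm_det_add_mul_add_mul_le (hP.bordered hh) hsol hinit hx (bordered C 0 0 0)
      (Matrix.single (Sum.inr ()) (Sum.inl i) 1) (bordered D 0 0 0)

end BorderedSystem

section Growth

variable {n : ℕ} {b : Fin n → ℂ} {Q : ℝ → Matrix (Fin n) (Fin n) ℂ}

/-- The exponential growth rate of the characteristic determinant at `μ`: the sum of the positive
parts of the numbers `Re (i b_j μ)`. -/
noncomputable def growthExponent (b : Fin n → ℂ) (μ : ℂ) : ℝ := ∑ j, max (I * b j * μ).re 0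

theorem growthExponent_le (b : Fin n → ℂ) (μ : ℂ) :
    growthExponent b μ ≤ (∑ j, ‖b j‖) * ‖μ‖ := by
  rw [growthExponent, Finset.sum_mul]
  refine Finset.sum_le_sum fun j _ => max_le ?_ (by positivity)
  calc (I * b j * μ).re ≤ ‖I * b j * μ‖ := re_le_norm _
    _ = ‖b j‖ * ‖μ‖ := by rw [norm_mul, norm_mul, norm_I, one_mul]

theorem growthExponent_ofReal_mul (b : Fin n → ℂ) (z : ℂ) {r : ℝ} (hr : 0 < r) :
    growthExponent b (r * z) = (I * tau b z * (r * z)).re := by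
  have hscale (j) : (I * b j * (r * z)).re = r * (I * b j * z).re := by
    rw [mul_left_comm, re_ofReal_mul]
  rw [tau, Finset.mul_sum, Finset.sum_mul, re_sum, growthExponent, Finset.sum_filter]
  refine Finset.sum_congr rfl fun j _ => ?_
  rw [hscale]
  split_ifs with hj
  · exact max_eq_left (mul_pos hr hj).le
  · exact max_eq_right (mul_nonpos_of_nonneg_of_nonpos hr.le (not_lt.1 hj))

theorem integral_entrySum_add_norm_source_le (hQ : EntryIntegrable Q) (b : Fin n → ℂ) {g : L2 n}
    (hg : ‖g‖ ≤ 1) :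
    ∫ t in (0 : ℝ)..1, (entrySum (potential b Q t) + ∑ j, ‖source b g t j‖) ≤
      (∫ t in (0 : ℝ)..1, entrySum (potential b Q t)) + n * ‖b‖ := by
  have hsource : IntervalIntegrable (fun t => ∑ j, ‖source b g t j‖) volume 0 1 := by
    simpa only [Finset.sum_fn] using!
      IntervalIntegrable.sum Finset.univ fun j _ => (intervalIntegrable_source_apply b g j).norm
  have hsource_le (t) : ∑ j, ‖source b g t j‖ ≤ n * ‖b‖ * ‖g t‖ := by
    simpa [mul_assoc] using Finset.sum_le_sum fun j (_ : j ∈ Finset.univ) =>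
      norm_source_apply_le b g t j
  rw [intervalIntegral.integral_add (hQ.potential b).entrySum hsource]
  gcongr
  calc ∫ t in (0 : ℝ)..1, ∑ j, ‖source b g t j‖
      ≤ ∫ t in (0 : ℝ)..1, n * ‖b‖ * ‖g t‖ :=
        intervalIntegral.integral_mono zero_le_one hsource
          ((intervalIntegrable_norm_L2 g).const_mul _) hsource_le
    _ = n * ‖b‖ * ∫ t in (0 : ℝ)..1, ‖g t‖ := intervalIntegral.integral_const_mul _ _
    _ ≤ n * ‖b‖ := mul_le_of_le_one_right (by positivity)
        ((intervalIntegral_norm_le_norm g).trans hg)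

theorem exists_norm_det_boundaryMatrix_le (hQ : EntryIntegrable Q) (b : Fin n → ℂ)
    (C D : Matrix (Fin n) (Fin n) ℂ) :
    ∃ K : ℝ, 0 ≤ K ∧ ∀ μ,
      ‖(boundaryMatrix hQ b C D μ).det‖ ≤ K * Real.exp (growthExponent b μ) := by
  refine ⟨rowExpansionWeight ![C, 0, D] *
    Real.exp (∫ t in (0 : ℝ)..1, entrySum (potential b Q t)),
    mul_nonneg (rowExpansionWeight_nonneg _) (Real.exp_pos _).le, fun μ => ?_⟩
  have hdet := norm_det_add_mul_add_mul_le (hQ.potential b)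
    (isMatrixSolution_transitionMatrix (hQ.coeffMatrix b μ)) (transitionMatrix_zero _)
    (left_mem_Icc.2 zero_le_one) C 0 D
  rw [Matrix.zero_mul, add_zero, add_comm (∑ j, _), Real.exp_add, ← mul_assoc] at hdet
  exact hdet

theorem isSolution_systemOp_sourceOp (hQ : EntryIntegrable Q) (b : Fin n → ℂ) (μ : ℂ)
    (g : L2 n) :
    IsSolution (fun t => mulVecOp (coeffMatrix b Q μ t)) (source b g)
      (IccExtend zero_le_one (systemOp hQ b μ (sourceOp b g))) := by
  have hsol := isSolution_solutionOp (hQ.coeffMatrix b μ).mulVecOp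
    (intervalIntegrable_source b g) 0
  rwa [show ContinuousMap.const unitInterval (0 : Fin n → ℂ) = 0 from rfl, zero_add] at hsol

theorem systemOp_resolvent_apply (hQ : EntryIntegrable Q) {C D : Matrix (Fin n) (Fin n) ℂ} {μ : ℂ}
    (hμ : (boundaryMatrix hQ b C D μ).det ≠ 0) (u : C(unitInterval, Fin n → ℂ))
    (x : unitInterval) (i : Fin n) :
    systemOp hQ b μ ((boundaryMatrix hQ b C D μ).det • u - ContinuousMap.const _
      ((boundaryMatrix hQ b C D μ).adjugate *ᵥ (D *ᵥ systemOp hQ b μ u 1))) x i =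
    (bordered (boundaryMatrix hQ b C D μ) (D *ᵥ systemOp hQ b μ u 1) (propagator hQ b μ x i)
      (systemOp hQ b μ u x i)).det := by
  rw [det_bordered hμ.isUnit, map_sub, map_smul, ContinuousMap.sub_apply,
    ContinuousMap.smul_apply, systemOp_const_apply]
  rfl

theorem exists_norm_resolventNum_le (hQ : EntryIntegrable Q) (b : Fin n → ℂ)
    (C D : Matrix (Fin n) (Fin n) ℂ) :
    ∃ K : ℝ, 0 ≤ K ∧ ∀ μ, (boundaryMatrix hQ b C D μ).det ≠ 0 →
      ‖resolventNum hQ b C D μ‖ ≤ K * Real.exp (growthExponent b μ) := by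
  set weight : Fin n → ℝ := fun i => rowExpansionWeight
    ![bordered C 0 0 0, Matrix.single (Sum.inr ()) (Sum.inl i) 1, bordered D 0 0 0]
  have hweight (i) : 0 ≤ weight i := rowExpansionWeight_nonneg _
  set L := (∫ t in (0 : ℝ)..1, entrySum (potential b Q t)) + n * ‖b‖
  have hsum : 0 ≤ ∑ i, weight i := Finset.sum_nonneg fun i _ => hweight i
  refine ⟨‖embedL2 n‖ * ((∑ i, weight i) * Real.exp L), by positivity, fun μ hμ => ?_⟩
  refine ContinuousLinearMap.opNorm_le_of_unit_norm (by positivity) fun g hg => ?_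
  rw [resolventNum_apply, mul_assoc]
  refine ContinuousLinearMap.le_opNorm_of_le _ ((ContinuousMap.norm_le _ (by positivity)).2
    fun x => (pi_norm_le_iff_of_nonneg (by positivity)).2 fun i => ?_)
  rw [systemOp_resolvent_apply hQ hμ]
  have hforced := isSolution_systemOp_sourceOp hQ b μ g
  have hforced_zero : IccExtend zero_le_one (systemOp hQ b μ (sourceOp b g)) 0 = 0 := by
    rw [IccExtend_left]
    exact (solutionOp_apply_zero _ _).trans (primitive_apply_zero (intervalIntegrable_source b g))
  have hdet := norm_det_bordered_boundary_le (hQ.potential b)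
    (intervalIntegrable_source_apply b g)
    (isMatrixSolution_transitionMatrix (hQ.coeffMatrix b μ)) (transitionMatrix_zero _)
    hforced hforced_zero x.2 C D i
  rw [IccExtend_val, IccExtend_right] at hdet
  calc _ ≤ weight i * Real.exp (growthExponent b μ + L) := hdet.trans (by
        gcongr
        · exact hweight i
        · rfl
        · exact integral_entrySum_add_norm_source_le hQ b hg.le)
    _ ≤ (∑ i, weight i) * Real.exp (growthExponent b μ + L) := by
        gcongr
        exact Finset.single_le_sum (fun j _ => hweight j) (Finset.mem_univ i)
    _ = _ := by rw [Real.exp_add]; ring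

end Growth

section Completeness

variable {n : ℕ} {b : Fin n → ℂ} {Q : ℝ → Matrix (Fin n) (Fin n) ℂ}
  {C D : Matrix (Fin n) (Fin n) ℂ}

theorem mul_exp_growthExponent_le_of_arg_eq (hb : ∀ j, b j ≠ 0) (hQ : EntryIntegrable Q) {z : ℂ}
    {c R : ℝ} {s : ℕ} (hΔ : ∀ μ : ℂ, R < ‖μ‖ → arg μ = arg z →
      c * Real.exp (I * tau b z * μ).re / ‖μ‖ ^ s ≤ ‖charDet b Q C D μ‖)
    {r : ℝ} (hr : 0 < r) (hz : z ≠ 0) (hR : R < ‖(r : ℂ) * z‖) :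
    c * Real.exp (growthExponent b (r * z)) ≤
      ‖(boundaryMatrix hQ b C D (r * z)).det‖ * ‖(r : ℂ) * z‖ ^ s := by
  have hlower := hΔ (r * z) hR (arg_real_mul z hr)
  have hrz : (r : ℂ) * z ≠ 0 := mul_ne_zero (ofReal_ne_zero.2 hr.ne') hz
  rwa [charDet_eq_det_boundaryMatrix hb hQ, ← growthExponent_ofReal_mul b z hr,
    div_le_iff₀ (pow_pos (norm_pos_iff.2 hrz) s)] at hlower

theorem exists_norm_resolventNum_le_on_ray (hb : ∀ j, b j ≠ 0) (hQ : EntryIntegrable Q)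
    {z : Fin 3 → ℂ} {c R : ℝ} (hc : 0 < c) (hR : 0 < R) {s : ℕ}
    (hΔ : ∀ k, ∀ μ : ℂ, R < ‖μ‖ → arg μ = arg (z k) →
      c * Real.exp (I * tau b (z k) * μ).re / ‖μ‖ ^ s ≤ ‖charDet b Q C D μ‖) :
    ∃ K : ℝ, 0 ≤ K ∧ ∀ k, ∀ r : ℝ, 0 ≤ r → R < ‖(r : ℂ) * z k‖ →
      (boundaryMatrix hQ b C D (r * z k)).det ≠ 0 ∧ ‖resolventNum hQ b C D (r * z k)‖ ≤
        K * ‖(r : ℂ) * z k‖ ^ s * ‖(boundaryMatrix hQ b C D (r * z k)).det‖ := by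
  obtain ⟨K, hK, hnum⟩ := exists_norm_resolventNum_le hQ b C D
  refine ⟨K / c, by positivity, fun k r hr hlt => ?_⟩
  have hrz : (r : ℂ) * z k ≠ 0 := norm_pos_iff.1 (hR.trans hlt)
  have hr : 0 < r := hr.lt_of_ne' (ofReal_ne_zero.1 (left_ne_zero_of_mul hrz))
  have hlower := mul_exp_growthExponent_le_of_arg_eq hb hQ (hΔ k) hr
    (right_ne_zero_of_mul hrz) hlt
  have hdet : (boundaryMatrix hQ b C D (r * z k)).det ≠ 0 := fun h0 => by
    rw [h0, norm_zero, zero_mul] at hlower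
    exact hlower.not_gt (by positivity)
  refine ⟨hdet, (hnum _ hdet).trans ?_⟩
  calc K * Real.exp (growthExponent b (r * z k))
      = K / c * (c * Real.exp (growthExponent b (r * z k))) := by field_simp
    _ ≤ K / c * (‖(boundaryMatrix hQ b C D (r * z k)).det‖ * ‖(r : ℂ) * z k‖ ^ s) := by gcongr
    _ = K / c * ‖(r : ℂ) * z k‖ ^ s * ‖(boundaryMatrix hQ b C D (r * z k)).det‖ := by ring

theorem mul_exp_growthExponent_le_exp {K L : ℝ} (hK : K ≤ L) (b : Fin n → ℂ) (μ : ℂ) :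
    K * Real.exp (growthExponent b μ) ≤ Real.exp ((∑ j, ‖b j‖) * ‖μ‖ + L) := by
  rw [add_comm, Real.exp_add]
  gcongr
  · linarith [Real.add_one_le_exp L]
  · exact growthExponent_le b μ

theorem topologicalClosure_iSup_rootSubspace_bvpOperator (hb : ∀ j, b j ≠ 0)
    (hQ : EntryIntegrable Q) {ν : ℂ} (hν : (boundaryMatrix hQ b C D ν).det ≠ 0)
    {z : Fin 3 → ℂ} (h0 : (0 : ℂ) ∈ interior (convexHull ℝ (range z))) {M R : ℝ} (hM : 0 ≤ M)
    {s : ℕ} (hray : ∀ k, ∀ r : ℝ, 0 ≤ r → R < ‖(r : ℂ) * z k‖ →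
      (boundaryMatrix hQ b C D (r * z k)).det ≠ 0 ∧ ‖resolventNum hQ b C D (r * z k)‖ ≤
        M * ‖(r : ℂ) * z k‖ ^ s * ‖(boundaryMatrix hQ b C D (r * z k)).det‖) :
    (⨆ μ, rootSubspace (bvpOperator b Q C D) μ).topologicalClosure = ⊤ := by
  obtain ⟨K, hK, hdet⟩ := exists_norm_det_boundaryMatrix_le hQ b C D
  obtain ⟨K', -, hnum⟩ := exists_norm_resolventNum_le hQ b C D
  exact (isCharacteristicPair_bvp hb hQ C D).topologicalClosure_iSup_rootSubspace hν
    (dense_domain_bvp hb hQ C D) (A := ∑ j, ‖b j‖) (B := max K K') (by positivity)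
    (le_max_of_le_left hK)
    (fun μ => (hdet μ).trans (mul_exp_growthExponent_le_exp (le_max_left _ _) b μ))
    (fun μ hμ => (hnum μ hμ).trans (mul_exp_growthExponent_le_exp (le_max_right _ _) b μ))
    h0 hM hray

end Completeness

end FirstOrderBVP

open FirstOrderBVP in
theorem mainTheorem4_general {n : ℕ} (b : Fin n → ℂ) (hb : ∀ j, b j ≠ 0)
    (Q : ℝ → Matrix (Fin n) (Fin n) ℂ)
    (hQ : ∀ j k, IntegrableOn (fun x => Q x j k) (Icc (0 : ℝ) 1))
    (C D : Matrix (Fin n) (Fin n) ℂ) (z : Fin 3 → ℂ)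
    (htri : (0 : ℂ) ∈ interior (convexHull ℝ (range z)))
    (c R : ℝ) (hc : 0 < c) (hR : 0 < R) (s : ℕ)
    (hΔ : ∀ k, ∀ μ : ℂ, R < ‖μ‖ → arg μ = arg (z k) →
      c * Real.exp (I * tau b (z k) * μ).re / ‖μ‖ ^ s ≤ ‖charDet b Q C D μ‖)
    (ι : ℂ → Type*)
    (e : ∀ μ : ℂ, Module.Basis (ι μ) ℂ (rootSubspace (bvpOperator b Q C D) μ)) :
    IsCompleteFamily (fun p : Σ μ : ℂ, ι μ => (e p.1 p.2 : L2 n)) ∧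
      IsMinimalFamily (fun p : Σ μ : ℂ, ι μ => (e p.1 p.2 : L2 n)) := by
  have hQ : EntryIntegrable Q := fun j k =>
    (intervalIntegrable_iff_integrableOn_Icc_of_le zero_le_one).2 (hQ j k)
  obtain ⟨M, hM, hray⟩ := exists_norm_resolventNum_le_on_ray hb hQ hc hR hΔ
  obtain ⟨ν, hν⟩ : ∃ ν, (boundaryMatrix hQ b C D ν).det ≠ 0 := by
    obtain ⟨k, hk⟩ := exists_ne_zero_of_zero_mem_interior htri
    have hk : 0 < ‖z k‖ := norm_pos_iff.2 hk
    refine ⟨_, (hray k ((R + 1) / ‖z k‖) (by positivity) ?_).1⟩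
    rw [norm_mul, norm_real, Real.norm_of_nonneg (by positivity), div_mul_cancel₀ _ hk.ne']
    exact lt_add_one R
  exact ⟨isCompleteFamily_of_bases
      (topologicalClosure_iSup_rootSubspace_bvpOperator hb hQ hν htri hM hray) e,
    (isCharacteristicPair_bvp hb hQ C D).isMinimalFamily hν (fg_kerPow_one_bvp hb hQ C D) e⟩

open FirstOrderBVP in
theorem mainTheorem4 {n : ℕ} (b : Fin n → ℂ) (hb : ∀ j, b j ≠ 0)
    (Q : ℝ → Matrix (Fin n) (Fin n) ℂ)
    (hQ : ∀ j k, IntegrableOn (fun x => Q x j k) (Icc (0 : ℝ) 1))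
    (C D : Matrix (Fin n) (Fin n) ℂ) (hCD : (Matrix.fromCols C D).rank = n)
    (z : Fin 3 → ℂ) (hz : ∀ k, Feasible b (z k))
    (htri : (0 : ℂ) ∈ interior (convexHull ℝ (range z)))
    (c R : ℝ) (hc : 0 < c) (hR : 0 < R) (s : ℕ)
    (hΔ : ∀ k, ∀ μ : ℂ, R < ‖μ‖ → arg μ = arg (z k) →
      c * Real.exp (I * tau b (z k) * μ).re / ‖μ‖ ^ s ≤ ‖charDet b Q C D μ‖)
    (ι : ℂ → Type*)
    (e : ∀ μ : ℂ, Module.Basis (ι μ) ℂ (rootSubspace (bvpOperator b Q C D) μ)) :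
    IsCompleteFamily (fun p : Σ μ : ℂ, ι μ => (e p.1 p.2 : L2 n)) ∧
      IsMinimalFamily (fun p : Σ μ : ℂ, ι μ => (e p.1 p.2 : L2 n)) :=
  mainTheorem4_general b hb Q hQ C D z htri c R hc hR s hΔ ι e
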